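/- Let $k\ge 2$ and $0<\chi<1$ be fixed. For each $n\ge k$ let $(\pi_t)_{t\ge0}$ be the continuous-time random $k$-cycle walk on the symmetric group $\mathcal S_n$, started from an arbitrary (possibly random) permutation $\pi_0$: $\pi_t=\pi_0\circ\gamma_1\circ\cdots\circ\gamma_{N_t}$, where $\gamma_1,\gamma_2,\dots$ are i.i.d. uniform on the set of $k$-cycles of $\mathcal S_n$, $(N_t)_{t\ge0}$ is a Poisson process of rate $1$, and $\pi_0$, $(\gamma_m)_{m\ge1}$ and $(N_t)_{t\ge0}$ are independent. Let $N_i(t)$ be the number of cycles of size $i$ of $\pi_t$ (fixed points are cycles of size $1$), and let $M_j(t)=\sum_{2^j\le i<2^{j+1}}N_i(t)$. Let $K=K(n)$ be a power of two closest to $n^\chi$, and let $$\tau=\inf\{t\ge0:\ \exists\,0\le j\le\log_2K+1,\ M_j(t)>(\log n)^6/2\}\qquad(\inf\emptyset=\infty).$$ Suppose that $\mathbb P(\tau<n\log n)\to0$ as $n\to\infty$, and that there is a constant $D>0$, independent of $j$ and $n$, such that, almost surely, $M_j(0)\le D\log(j+2)$ for all integers $0\le j\le\log_2\log n$. Let $(Z_i)_{i\ge1}$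 be independent Poisson random variables, $Z_i$ of mean $1/i$. Then for every sequence $t=t(n)\ge 0$ with $t(n)/n\to\infty$ as $n\to\infty$ and $t(n)\le n\log n$, the total variation distance between the laws of the vectors $(N_i(t(n)))_{i=1}^{K}$ and $(Z_i)_{i=1}^{K}$ tends to $0$ as $n\to\infty$. -/

import Mathlib

open Filter Topology MeasureTheory ProbabilityTheory
open scoped NNReal ENNReal

namespace KCycleWalk

/-- The finite group of permutations of `n` points carries the discrete σ-algebra. -/
instance instMeasurableSpacePermFin (n : ℕ) : MeasurableSpace (Equiv.Perm (Fin n)) := ⊤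

/-- The conjugacy class of `k`-cycles in the symmetric group on `n` points (`2 ≤ k`). -/
def kCycles (k n : ℕ) : Set (Equiv.Perm (Fin n)) :=
  {σ | σ.IsCycle ∧ σ.support.card = k}

/-- `cycleCount σ i` is the number of cycles of `σ` of size `i`; fixed points are the cycles of
size `1` (`Equiv.Perm.partition` lists the sizes of all cycles, fixed points included). -/
def cycleCount {n : ℕ} (σ : Equiv.Perm (Fin n)) (i : ℕ) : ℕ :=
  σ.partition.parts.count i

/-- The number of cycles of `σ` whose size lies in the dyadic strip `[2 ^ j, 2 ^ (j + 1))`. -/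
def stripCount {n : ℕ} (σ : Equiv.Perm (Fin n)) (j : ℕ) : ℕ :=
  ∑ i ∈ Finset.Ico (2 ^ j) (2 ^ (j + 1)), cycleCount σ i

/-- A Poisson process of rate `1` on `[0, ∞)`: it starts at `0`, has independent increments, the
increment over `(s, t]` is Poisson of mean `t - s`, and almost every path is nondecreasing and
right-continuous. -/
structure IsPoissonProcess {Ω : Type*} [MeasurableSpace Ω] (N : ℝ≥0 → Ω → ℕ) (μ : Measure Ω) :
    Prop where
  measurable : ∀ t, Measurable (N t)
  zero : ∀ᵐ ω ∂μ, N 0 ω = 0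
  paths : ∀ᵐ ω ∂μ, Monotone (fun t => N t ω) ∧
    ∀ t, ContinuousWithinAt (fun s => N s ω) (Set.Ici t) t
  indep : HasIndepIncrements N μ
  law : ∀ s t : ℝ≥0, s ≤ t → HasLaw (fun ω => N t ω - N s ω) (poissonMeasure (t - s)) μ

/-- `π` is the continuous-time random `k`-cycle walk on the permutations of `n` points, with an
arbitrary (possibly random) initial permutation: `π t = π₀ ∘ γ₁ ∘ ⋯ ∘ γ_{N t}`, where
`γ₁, γ₂, …` are i.i.d. uniform on the `k`-cycles (here numbered from `0`), `N` is a Poisson process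
of rate `1`, and `π₀`, `(γ₁, γ₂, …)` and `N` are independent. -/
def IsKCycleWalk (k n : ℕ) {Ω : Type*} [MeasurableSpace Ω]
    (π : ℝ≥0 → Ω → Equiv.Perm (Fin n)) (μ : Measure Ω) : Prop :=
  ∃ (π₀ : Ω → Equiv.Perm (Fin n)) (γ : ℕ → Ω → Equiv.Perm (Fin n)) (N : ℝ≥0 → Ω → ℕ),
    Measurable π₀ ∧
    (∀ m, Measurable (γ m)) ∧
    (∀ m, HasLaw (γ m) (uniformOn (kCycles k n)) μ) ∧
    iIndepFun γ μ ∧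
    IsPoissonProcess N μ ∧
    IndepFun (fun ω m => γ m ω) (fun ω t => N t ω) μ ∧
    IndepFun π₀ (fun ω => ((fun m => γ m ω : ℕ → Equiv.Perm (Fin n)),
      (fun t => N t ω : ℝ≥0 → ℕ))) μ ∧
    ∀ t ω, π t ω = π₀ ω * ((List.range (N t ω)).map (fun m => γ m ω)).prod

/-- `2 ^ l` is a power of two closest to the real number `x`. -/
def IsClosestDyadic (l : ℕ) (x : ℝ) : Prop :=
  ∀ m : ℕ, |(2 : ℝ) ^ l - x| ≤ |(2 : ℝ) ^ m - x|

/-- The first time at which one of the dyadic strips `j = 0, …, l + 1` contains more than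
`(log n) ^ 6 / 2` cycles (`∞` if there is no such time). -/
noncomputable def overflowTime {n : ℕ} {Ω : Type*} (l : ℕ)
    (π : ℝ≥0 → Ω → Equiv.Perm (Fin n)) (ω : Ω) : ℝ≥0∞ :=
  sInf {s : ℝ≥0∞ | ∃ t : ℝ≥0, s = (t : ℝ≥0∞) ∧
    ∃ j : ℕ, j ≤ l + 1 ∧ Real.log n ^ 6 / 2 < (stripCount (π t ω) j : ℝ)}

/-- The total variation distance `½ ∑ₓ |μ {x} - ν {x}|` between two probability measures on a
countable space with measurable points. -/
noncomputable def tvDist {S : Type*} [MeasurableSpace S] (μ ν : Measure S) : ℝ :=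
  (1 / 2) * ∑' x : S, |μ.real {x} - ν.real {x}|

/-- The law of the vector `(N_i(t))`, `1 ≤ i ≤ K`, of cycle counts (coordinate `i : Fin K` counts
the cycles of size `i + 1`). -/
noncomputable def smallCycleLaw {n : ℕ} {Ω : Type*} [MeasurableSpace Ω] (μ : Measure Ω) (K : ℕ)
    (σ : Ω → Equiv.Perm (Fin n)) : Measure (Fin K → ℕ) :=
  μ.map (fun ω (i : Fin K) => cycleCount (σ ω) (i + 1))

/-- The law of a vector `(Z_i)`, `1 ≤ i ≤ K`, of independent Poisson variables, `Z_i` of mean `1 / i`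
(coordinate `i : Fin K` is `Z_{i + 1}`). -/
noncomputable def poissonVectorLaw (K : ℕ) : Measure (Fin K → ℕ) :=
  Measure.pi (fun i : Fin K => poissonMeasure (1 / ((i : ℝ≥0) + 1)))

end KCycleWalk

/-! To first order in `1 / n`, a step of the walk can affect the cycles of size at most `K` in two
ways. It hits a given cycle of size `a`, with probability about `k * a / n`, and merges it into a
long cycle; or two points adjacent in the `k`-cycle lie at distance `i` along a long cycle and cut
off a new cycle of size `i`, with probability about `k / n` for each `i`. The small cycles therefore
behave like an immigration-death process with immigration rate `c = k / n` in every size and death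
rate `c * i` per particle of size `i`. Its stationary law is the product of Poisson laws of means `1
/ i`.

The comparison is made on test functions, without a coupling. `step` is a discrete chain with
independent deaths followed by independent births. For a test function `f` with `|f| ≤ 1`, the steps
of the walk are exchanged one by one for steps of the chain (`abs_integral_walk_sub_le`); an
exchange made `r` steps before the end is tested on `step^[r] f`. An extra particle of size `a`
changes this function by at most `2 * (1 - k * a / n) ^ r`, because it must survive `r` steps
(`IsLip.iterate_step`). Walk and chain share the same generator, so one exchange costs only second
order terms, which come from two simultaneous contacts (`abs_avg_sub_step_le`). The weights sum over
`r` to at most `2 * n / (k * a)`, so the total cost is `K / n` times a power of `log n`, whatever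
the number of steps (`sum_step_error_le`). This needs few cycles in each dyadic strip, which holds
before the overflow time.

The Poisson vector is invariant for the generator by the Chen–Stein identity, hence almost invariant
for the chain, and the chain forgets its start (`abs_iterate_step_sub_integral_le`). What remains of
the start is about `∑ M_j(0) * exp (-t * k * 2 ^ j / n)`. The hypothesis on `M_j(0)` covers the low
strips; in the others `log n < 2 ^ j`, so the overflow level `(log n) ^ 6 / 2` is below `64 ^ j`.
Altogether the sum is of order `(n / t) ^ 7`, which tends to `0`.

Averaging over the independent Poisson clock turns `(1 - p) ^ m` into `exp (-t * p)`. Every position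
of the jump chain before step `N t` is occupied at some real time before `t`
(`IsPoissonProcess.measure_exists_state_le`), so an overfull strip along the jump chain forces `τ <
n log n`. -/

namespace KCycleWalk

/-! ### Thinning, births and the comparison chain on multisets of sizes -/

/-- `g` changes by at most `w a` when a particle of size `a` is added. -/
def IsLip (w : ℕ → ℝ) (g : Multiset ℕ → ℝ) : Prop :=
  ∀ a s, |g (a ::ₘ s) - g s| ≤ w a

/-- The mean of `g` after each particle `a` of the configuration is removed independently with
probability `p a`. -/
noncomputable def thin (p : ℕ → ℝ) (g : Multiset ℕ → ℝ) (s : Multiset ℕ) : ℝ :=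
  (s.antidiagonal.map fun yz =>
    (yz.1.map fun a => 1 - p a).prod * (yz.2.map p).prod * g yz.1).sum

theorem thin_zero (p : ℕ → ℝ) (g : Multiset ℕ → ℝ) : thin p g 0 = g 0 := by
  simp [thin]

theorem thin_cons (p : ℕ → ℝ) (g : Multiset ℕ → ℝ) (a : ℕ) (s : Multiset ℕ) :
    thin p g (a ::ₘ s) =
      (1 - p a) * thin p (fun y => g (a ::ₘ y)) s + p a * thin p g s := by
  simp only [thin, Multiset.antidiagonal_cons, Multiset.map_add, Multiset.map_map,
    Multiset.sum_add, ← Multiset.sum_map_mul_left]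
  rw [add_comm]
  congr 2
  · refine Multiset.map_congr rfl fun x _ => ?_
    simp; ring
  · refine Multiset.map_congr rfl fun x _ => ?_
    simp; ring

theorem thin_sub (p : ℕ → ℝ) (g h : Multiset ℕ → ℝ) (s : Multiset ℕ) :
    thin p (fun y => g y - h y) s = thin p g s - thin p h s := by
  simp only [thin, mul_sub, Multiset.sum_map_sub]

theorem thin_cons' (p : ℕ → ℝ) (g : Multiset ℕ → ℝ) (a : ℕ) (s : Multiset ℕ) :
    thin p g (a ::ₘ s) =
      thin p (fun y => g (a ::ₘ y)) s - p a * thin p (fun y => g (a ::ₘ y) - g y) s := by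
  rw [thin_cons, thin_sub]; ring

theorem abs_thin_le {p : ℕ → ℝ} (hp0 : ∀ a, 0 ≤ p a) (hp1 : ∀ a, p a ≤ 1)
    {B : ℝ} (s : Multiset ℕ) : ∀ {g : Multiset ℕ → ℝ}, (∀ y, |g y| ≤ B) → |thin p g s| ≤ B := by
  induction s using Multiset.induction_on with
  | empty => intro g hg; simpa [thin_zero] using hg 0
  | cons a s ih =>
    intro g hg
    rw [thin_cons]
    have h1 := ih (g := fun y => g (a ::ₘ y)) (fun y => hg _)
    have h2 := ih hg
    have h3 := hp0 a
    have h4 := sub_nonneg.2 (hp1 a)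
    calc |(1 - p a) * thin p (fun y => g (a ::ₘ y)) s + p a * thin p g s|
        ≤ (1 - p a) * |thin p (fun y => g (a ::ₘ y)) s| + p a * |thin p g s| := by
          refine (abs_add_le _ _).trans ?_
          rw [abs_mul, abs_mul, abs_of_nonneg h3, abs_of_nonneg h4]
      _ ≤ (1 - p a) * B + p a * B := by gcongr
      _ = B := by ring

/-- The extra particle is itself thinned: it is felt only if it survives, which has probability `1 -
p a`. This gain is the source of all decay in the proof. -/
theorem IsLip.thin {p : ℕ → ℝ} (hp0 : ∀ a, 0 ≤ p a) (hp1 : ∀ a, p a ≤ 1)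
    {w : ℕ → ℝ} {g : Multiset ℕ → ℝ} (hg : IsLip w g) :
    IsLip (fun a => (1 - p a) * w a) (thin p g) := by
  intro a s
  have : KCycleWalk.thin p g (a ::ₘ s) - KCycleWalk.thin p g s
      = (1 - p a) * KCycleWalk.thin p (fun y => g (a ::ₘ y) - g y) s := by
    rw [thin_cons, thin_sub]; ring
  rw [this, abs_mul, abs_of_nonneg (sub_nonneg.2 (hp1 a))]
  exact mul_le_mul_of_nonneg_left (abs_thin_le hp0 hp1 s fun y => hg a y)
    (sub_nonneg.2 (hp1 a))

/-- Union bound: the configuration changes with probability at most the sum of the death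
probabilities, and then `g` moves by at most `2 * B`. -/
theorem abs_thin_sub_le {p : ℕ → ℝ} (hp0 : ∀ a, 0 ≤ p a) (hp1 : ∀ a, p a ≤ 1)
    {B : ℝ} (s : Multiset ℕ) : ∀ {g : Multiset ℕ → ℝ}, (∀ y, |g y| ≤ B) →
      |thin p g s - g s| ≤ 2 * B * (s.map p).sum := by
  induction s using Multiset.induction_on with
  | empty => intro g hg; simp [thin_zero]
  | cons a s ih =>
    intro g hg
    have h1 := ih (g := fun y => g (a ::ₘ y)) (fun y => hg _)
    have h2 : |KCycleWalk.thin p (fun y => g (a ::ₘ y) - g y) s| ≤ 2 * B :=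
      abs_thin_le hp0 hp1 s fun y => by
        have := abs_sub (g (a ::ₘ y)) (g y)
        linarith [hg (a ::ₘ y), hg y]
    rw [thin_cons', Multiset.map_cons, Multiset.sum_cons]
    have h3 := mul_le_mul_of_nonneg_left h2 (hp0 a)
    rw [← abs_of_nonneg (hp0 a), ← abs_mul, abs_of_nonneg (hp0 a)] at h3
    rw [abs_le] at *
    constructor <;> nlinarith [h1.1, h1.2, h3.1, h3.2]

/-- First order expansion of the thinning operator. -/
theorem abs_thin_sub_first_order_le {p : ℕ → ℝ} (hp0 : ∀ a, 0 ≤ p a) (hp1 : ∀ a, p a ≤ 1)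
    {w : ℕ → ℝ} (s : Multiset ℕ) : ∀ {g : Multiset ℕ → ℝ}, IsLip w g →
      |thin p g s - g s - (s.map fun a => p a * (g (s.erase a) - g s)).sum|
        ≤ 2 * (s.map fun a => p a * w a).sum * (s.map p).sum := by
  induction s using Multiset.induction_on with
  | empty => intro g hg; simp [thin_zero]
  | cons a s ih =>
    intro g hg
    have h1 := ih (g := fun y => g (a ::ₘ y)) (fun b y => by
      have := hg b (a ::ₘ y)
      rwa [Multiset.cons_swap] at this)
    -- This difference will be multiplied by `p a`, so the zeroth order estimate is enough; it
    -- produces the cross terms `p a * w a * p b`.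
    have h2 : |KCycleWalk.thin p (fun y => g (a ::ₘ y) - g y) s - (g (a ::ₘ s) - g s)|
        ≤ 2 * w a * (s.map p).sum := abs_thin_sub_le hp0 hp1 s fun y => hg a y
    have hw : ∀ b, 0 ≤ w b := fun b => (abs_nonneg _).trans (hg b 0)
    have hs0 : 0 ≤ (s.map fun a => p a * w a).sum :=
      Multiset.sum_nonneg fun x hx => by
        obtain ⟨b, -, rfl⟩ := Multiset.mem_map.1 hx
        exact mul_nonneg (hp0 b) (hw b)
    have e : (s.map fun b => p b * (g ((a ::ₘ s).erase b) - g (a ::ₘ s))).sum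
        = (s.map fun b => p b * (g (a ::ₘ s.erase b) - g (a ::ₘ s))).sum := by
      congr 1
      refine Multiset.map_congr rfl fun b hb => ?_
      by_cases hab : a = b
      · subst hab; rw [Multiset.erase_cons_head, Multiset.cons_erase hb]
      · rw [Multiset.erase_cons_tail _ hab]
    rw [thin_cons', Multiset.map_cons, Multiset.sum_cons, e, Multiset.erase_cons_head,
      Multiset.map_cons, Multiset.sum_cons, Multiset.map_cons, Multiset.sum_cons]
    have h3 := mul_le_mul_of_nonneg_left h2 (hp0 a)
    rw [← abs_of_nonneg (hp0 a), ← abs_mul, abs_of_nonneg (hp0 a)] at h3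
    have h4 := mul_nonneg hs0 (hp0 a)
    have h5 := mul_nonneg (mul_nonneg (hp0 a) (hw a)) (hp0 a)
    rw [abs_le] at *
    constructor <;> nlinarith [h1.1, h1.2, h3.1, h3.2]

/-- The mean of `g` after, for each `i = 1, …, m`, a particle of size `i` is added independently with
probability `c`. -/
noncomputable def birth (c : ℝ) : ℕ → (Multiset ℕ → ℝ) → Multiset ℕ → ℝ
  | 0, g => g
  | m + 1, g => fun s => (1 - c) * birth c m g s + c * birth c m g ((m + 1) ::ₘ s)

theorem birth_shift (c : ℝ) (a m : ℕ) : ∀ (g : Multiset ℕ → ℝ) (s : Multiset ℕ),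
    birth c m (fun y => g (a ::ₘ y)) s = birth c m g (a ::ₘ s) := by
  induction m with
  | zero => intro g s; rfl
  | succ m ih => intro g s; simp only [birth, ih]; rw [Multiset.cons_swap]

theorem birth_sub (c : ℝ) (m : ℕ) (g h : Multiset ℕ → ℝ) : ∀ (s : Multiset ℕ),
    birth c m (fun y => g y - h y) s = birth c m g s - birth c m h s := by
  induction m with
  | zero => intro s; rfl
  | succ m ih => intro s; simp only [birth, ih]; ring

theorem abs_birth_le {c : ℝ} (hc0 : 0 ≤ c) (hc1 : c ≤ 1) {B : ℝ} (m : ℕ) {g : Multiset ℕ → ℝ}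
    (hg : ∀ y, |g y| ≤ B) : ∀ s, |birth c m g s| ≤ B := by
  induction m with
  | zero => exact hg
  | succ m ih =>
    intro s
    have h4 := sub_nonneg.2 hc1
    calc |(1 - c) * birth c m g s + c * birth c m g ((m + 1) ::ₘ s)|
        ≤ (1 - c) * |birth c m g s| + c * |birth c m g ((m + 1) ::ₘ s)| := by
          refine (abs_add_le _ _).trans ?_
          rw [abs_mul, abs_mul, abs_of_nonneg hc0, abs_of_nonneg h4]
      _ ≤ (1 - c) * B + c * B := by gcongr <;> exact ih _
      _ = B := by ring

/-- Births ignore the present configuration, so an extra particle passes through them unchanged. -/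
theorem IsLip.birth {c : ℝ} (hc0 : 0 ≤ c) (hc1 : c ≤ 1) {w : ℕ → ℝ} {g : Multiset ℕ → ℝ}
    (hg : IsLip w g) (m : ℕ) : IsLip w (birth c m g) := by
  intro a s
  rw [← birth_shift, ← birth_sub]
  exact abs_birth_le hc0 hc1 m (fun y => hg a y) s

theorem abs_birth_sub_le {c : ℝ} (hc0 : 0 ≤ c) (hc1 : c ≤ 1) {B : ℝ} (m : ℕ)
    {g : Multiset ℕ → ℝ} (hg : ∀ y, |g y| ≤ B) (s : Multiset ℕ) :
    |birth c m g s - g s| ≤ 2 * B * (c * m) := by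
  induction m with
  | zero => simp [KCycleWalk.birth]
  | succ m ih =>
    have h1 := abs_birth_le hc0 hc1 m hg s
    have h2 := abs_birth_le hc0 hc1 m hg ((m + 1) ::ₘ s)
    have h3 : |birth c m g ((m + 1) ::ₘ s) - birth c m g s| ≤ 2 * B :=
      (abs_sub _ _).trans (by linarith)
    have h4 := mul_le_mul_of_nonneg_left h3 hc0
    rw [← abs_of_nonneg hc0, ← abs_mul, abs_of_nonneg hc0] at h4
    simp only [KCycleWalk.birth]
    push_cast
    rw [abs_le] at *
    constructor <;> nlinarith [ih.1, ih.2, h4.1, h4.2]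

/-- First order expansion of the birth operator. -/
theorem abs_birth_sub_first_order_le {c : ℝ} (hc0 : 0 ≤ c) (hc1 : c ≤ 1) {w : ℕ → ℝ} (m : ℕ)
    {g : Multiset ℕ → ℝ} (hg : IsLip w g) (s : Multiset ℕ) :
    |birth c m g s - g s - ∑ i ∈ Finset.Icc 1 m, c * (g (i ::ₘ s) - g s)|
      ≤ 2 * (∑ i ∈ Finset.Icc 1 m, c * w i) * (c * m) := by
  have hw : ∀ b, 0 ≤ w b := fun b => (abs_nonneg _).trans (hg b 0)
  induction m with
  | zero => simp [KCycleWalk.birth]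
  | succ m ih =>
    have h1 : |birth c m (fun y => g ((m + 1) ::ₘ y) - g y) s - (g ((m + 1) ::ₘ s) - g s)|
        ≤ 2 * w (m + 1) * (c * m) := abs_birth_sub_le hc0 hc1 m (fun y => hg (m + 1) y) s
    rw [birth_sub, birth_shift] at h1
    rw [Finset.sum_Icc_succ_top (by omega), Finset.sum_Icc_succ_top (by omega)]
    simp only [KCycleWalk.birth]
    push_cast
    have h4 := mul_le_mul_of_nonneg_left h1 hc0
    rw [← abs_of_nonneg hc0, ← abs_mul, abs_of_nonneg hc0] at h4
    have h5 : 0 ≤ ∑ i ∈ Finset.Icc 1 m, c * w i :=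
      Finset.sum_nonneg fun i _ => mul_nonneg hc0 (hw i)
    have h6 := mul_nonneg h5 hc0
    have h7 := mul_nonneg (mul_nonneg hc0 (hw (m + 1))) hc0
    rw [abs_le] at *
    constructor <;> nlinarith [ih.1, ih.2, h4.1, h4.2]

/-- One step of the comparison chain: independent deaths, then independent births. -/
noncomputable def step (p : ℕ → ℝ) (c : ℝ) (K : ℕ) (g : Multiset ℕ → ℝ) : Multiset ℕ → ℝ :=
  thin p (birth c K g)

/-- The generator of the immigration-death process. -/
noncomputable def gen (p : ℕ → ℝ) (c : ℝ) (K : ℕ) (g : Multiset ℕ → ℝ) (s : Multiset ℕ) : ℝ :=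
  (∑ i ∈ Finset.Icc 1 K, c * (g (i ::ₘ s) - g s)) + (s.map fun a => p a * (g (s.erase a) - g s)).sum

theorem abs_step_le {p : ℕ → ℝ} (hp0 : ∀ a, 0 ≤ p a) (hp1 : ∀ a, p a ≤ 1)
    {c : ℝ} (hc0 : 0 ≤ c) (hc1 : c ≤ 1) {B : ℝ} (K : ℕ) {g : Multiset ℕ → ℝ}
    (hg : ∀ y, |g y| ≤ B) (s : Multiset ℕ) : |step p c K g s| ≤ B :=
  abs_thin_le hp0 hp1 s (abs_birth_le hc0 hc1 K hg)

theorem IsLip.step {p : ℕ → ℝ} (hp0 : ∀ a, 0 ≤ p a) (hp1 : ∀ a, p a ≤ 1)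
    {c : ℝ} (hc0 : 0 ≤ c) (hc1 : c ≤ 1) (K : ℕ) {w : ℕ → ℝ} {g : Multiset ℕ → ℝ}
    (hg : IsLip w g) : IsLip (fun a => (1 - p a) * w a) (step p c K g) :=
  (hg.birth hc0 hc1 K).thin hp0 hp1

theorem abs_iterate_step_le {p : ℕ → ℝ} (hp0 : ∀ a, 0 ≤ p a) (hp1 : ∀ a, p a ≤ 1)
    {c : ℝ} (hc0 : 0 ≤ c) (hc1 : c ≤ 1) {B : ℝ} (K : ℕ) {g : Multiset ℕ → ℝ}
    (hg : ∀ y, |g y| ≤ B) (m : ℕ) : ∀ s, |(KCycleWalk.step p c K)^[m] g s| ≤ B := by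
  induction m with
  | zero => exact hg
  | succ m ih =>
    rw [Function.iterate_succ_apply']
    exact abs_step_le hp0 hp1 hc0 hc1 K ih

/-- The factor `(1 - p a) ^ m` is the survival probability of the extra particle. Its summability in
`m` is what lets one-step errors be added over arbitrarily many steps. -/
theorem IsLip.iterate_step {p : ℕ → ℝ} (hp0 : ∀ a, 0 ≤ p a) (hp1 : ∀ a, p a ≤ 1)
    {c : ℝ} (hc0 : 0 ≤ c) (hc1 : c ≤ 1) (K : ℕ) {w : ℕ → ℝ} {g : Multiset ℕ → ℝ}
    (hg : IsLip w g) (m : ℕ) :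
    IsLip (fun a => (1 - p a) ^ m * w a) ((KCycleWalk.step p c K)^[m] g) := by
  induction m with
  | zero => simpa using hg
  | succ m ih =>
    rw [Function.iterate_succ_apply']
    convert ih.step hp0 hp1 hc0 hc1 K using 2
    ring

theorem IsLip.abs_erase_sub_le {w : ℕ → ℝ} {g : Multiset ℕ → ℝ} (hg : IsLip w g)
    (s : Multiset ℕ) (a : ℕ) : |g (s.erase a) - g s| ≤ w a := by
  by_cases ha : a ∈ s
  · have := hg a (s.erase a)
    rwa [Multiset.cons_erase ha, abs_sub_comm] at this
  · rw [Multiset.erase_of_notMem ha, sub_self, abs_zero]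
    exact (abs_nonneg _).trans (hg a 0)

/-- The comparison chain is close to the identity plus the generator. -/
theorem abs_step_sub_gen_le {p : ℕ → ℝ} (hp0 : ∀ a, 0 ≤ p a) (hp1 : ∀ a, p a ≤ 1)
    {c : ℝ} (hc0 : 0 ≤ c) (hc1 : c ≤ 1) (K : ℕ) {w : ℕ → ℝ} {g : Multiset ℕ → ℝ}
    (hg : IsLip w g) (s : Multiset ℕ) :
    |step p c K g s - g s - gen p c K g s|
      ≤ 2 * ((s.map fun a => p a * w a).sum + ∑ i ∈ Finset.Icc 1 K, c * w i)
          * ((s.map p).sum + c * K) := by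
  have hw : ∀ b, 0 ≤ w b := fun b => (abs_nonneg _).trans (hg b 0)
  have h1 := abs_thin_sub_first_order_le hp0 hp1 s (hg.birth hc0 hc1 K)
  have h2 := abs_birth_sub_first_order_le hc0 hc1 K hg s
  -- Replacing `birth c K g` by `g` inside the first order death term costs one death together with
  -- one birth, again of second order.
  have h3 : |(s.map fun a => p a * (birth c K g (s.erase a) - birth c K g s)).sum
      - (s.map fun a => p a * (g (s.erase a) - g s)).sum|
      ≤ 2 * (s.map fun a => p a * w a).sum * (c * K) := by
    rw [← Multiset.sum_map_sub]
    refine (Multiset.abs_sum_le_sum_abs).trans ?_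
    rw [Multiset.map_map]
    calc _ ≤ (s.map fun a => 2 * (c * K) * (p a * w a)).sum := by
          refine Multiset.sum_map_le_sum_map _ _ fun a ha => ?_
          have h5 : |birth c K (fun y => g (a ::ₘ y) - g y) (s.erase a)
              - (g (a ::ₘ s.erase a) - g (s.erase a))| ≤ 2 * w a * (c * K) :=
            abs_birth_sub_le hc0 hc1 K (fun y => hg a y) _
          rw [birth_sub, birth_shift, Multiset.cons_erase ha, abs_sub_comm] at h5
          have h6 := mul_le_mul_of_nonneg_left h5 (hp0 a)
          rw [← abs_of_nonneg (hp0 a), ← abs_mul, abs_of_nonneg (hp0 a)] at h6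
          simp only [Function.comp]
          rw [abs_le] at *
          constructor <;> nlinarith [h6.1, h6.2]
      _ = _ := by rw [Multiset.sum_map_mul_left]; ring
  have hs0 : 0 ≤ (s.map fun a => p a * w a).sum :=
      Multiset.sum_nonneg fun x hx => by
        obtain ⟨b, -, rfl⟩ := Multiset.mem_map.1 hx
        exact mul_nonneg (hp0 b) (hw b)
  have hs1 : 0 ≤ (s.map p).sum :=
      Multiset.sum_nonneg fun x hx => by
        obtain ⟨b, -, rfl⟩ := Multiset.mem_map.1 hx
        exact hp0 b
  have hs2 : 0 ≤ ∑ i ∈ Finset.Icc 1 K, c * w i :=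
      Finset.sum_nonneg fun i _ => mul_nonneg hc0 (hw i)
  have h7 := mul_nonneg hs2 hs1
  simp only [step, gen]
  rw [abs_le] at *
  constructor <;> nlinarith [h1.1, h1.2, h2.1, h2.2, h3.1, h3.2]

/-- Lipschitz functions of configurations. -/
theorem IsLip.abs_sub_add_le {w : ℕ → ℝ} {g : Multiset ℕ → ℝ} (hg : IsLip w g)
    (s u : Multiset ℕ) : |g (u + s) - g s| ≤ (u.map w).sum := by
  induction u using Multiset.induction_on with
  | empty => simp
  | cons a u ih =>
    rw [Multiset.cons_add, Multiset.map_cons, Multiset.sum_cons]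
    calc _ = |(g (a ::ₘ (u + s)) - g (u + s)) + (g (u + s) - g s)| := by ring_nf
      _ ≤ _ := (abs_add_le _ _).trans (add_le_add (hg a _) ih)

theorem IsLip.abs_sub_le {w : ℕ → ℝ} {g : Multiset ℕ → ℝ} (hg : IsLip w g)
    (s u : Multiset ℕ) : |g s - g u| ≤ ((s - u).map w).sum + ((u - s).map w).sum := by
  have h1 := hg.abs_sub_add_le (s ∩ u) (s - u)
  have h2 := hg.abs_sub_add_le (s ∩ u) (u - s)
  have e1 : s - u + s ∩ u = s := by rw [Multiset.sub_add_inter]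
  have e2 : u - s + s ∩ u = u := by rw [Multiset.inter_comm, Multiset.sub_add_inter]
  rw [e1] at h1
  rw [e2] at h2
  rw [abs_le] at *
  constructor <;> linarith [h1.1, h1.2, h2.1, h2.2]

end KCycleWalk

/-! ### Cycles of a permutation counted through periods of points -/

namespace KCycleWalk

open Function

section Orbits

variable {n : ℕ}

theorem minimalPeriod_perm_pos (σ : Equiv.Perm (Fin n)) (y : Fin n) : 0 < minimalPeriod σ y :=
  minimalPeriod_pos_of_mem_periodicPts (σ.injective.mem_periodicPts y)

/-- The orbit of `y`, as a finite set. -/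
noncomputable def orbitFinset (σ : Equiv.Perm (Fin n)) (y : Fin n) : Finset (Fin n) :=
  (Finset.range (minimalPeriod σ y)).image fun i => σ^[i] y

theorem card_orbitFinset (σ : Equiv.Perm (Fin n)) (y : Fin n) :
    (orbitFinset σ y).card = minimalPeriod σ y := by
  rw [orbitFinset, Finset.card_image_of_injOn, Finset.card_range]
  intro i hi j hj h
  exact iterate_injOn_Iio_minimalPeriod (by simpa using hi) (by simpa using hj) h

theorem mem_orbitFinset {σ : Equiv.Perm (Fin n)} {y z : Fin n} :
    z ∈ orbitFinset σ y ↔ ∃ i, σ^[i] y = z := by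
  simp only [orbitFinset, Finset.mem_image, Finset.mem_range]
  constructor
  · rintro ⟨i, -, h⟩; exact ⟨i, h⟩
  · rintro ⟨i, h⟩
    exact ⟨i % minimalPeriod σ y, Nat.mod_lt _ (minimalPeriod_perm_pos σ y), by
      rw [iterate_mod_minimalPeriod_eq, h]⟩

theorem mem_orbitFinset_comm {σ : Equiv.Perm (Fin n)} {y z : Fin n} :
    z ∈ orbitFinset σ y ↔ y ∈ orbitFinset σ z := by
  suffices H : ∀ y z : Fin n, z ∈ orbitFinset σ y → y ∈ orbitFinset σ z from ⟨H y z, H z y⟩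
  intro y z h
  simp only [orbitFinset, Finset.mem_image, Finset.mem_range] at h
  obtain ⟨i, hi, rfl⟩ := h
  refine mem_orbitFinset.2 ⟨minimalPeriod σ y - i, ?_⟩
  rw [← iterate_add_apply, Nat.sub_add_cancel hi.le, iterate_minimalPeriod]

theorem minimalPeriod_iterate (σ : Equiv.Perm (Fin n)) (y : Fin n) (i : ℕ) :
    minimalPeriod σ (σ^[i] y) = minimalPeriod σ y :=
  minimalPeriod_apply_iterate (σ.injective.mem_periodicPts y) i

theorem minimalPeriod_eq_card_support_cycleOf {σ : Equiv.Perm (Fin n)} {y : Fin n}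
    (h : σ y ≠ y) : minimalPeriod σ y = (σ.cycleOf y).support.card := by
  have h1 := σ.isCycleOn_support_cycleOf y
  have hy : y ∈ (σ.cycleOf y).support := by
    rw [Equiv.Perm.mem_support_cycleOf_iff]
    exact ⟨Equiv.Perm.SameCycle.refl _ _, Equiv.Perm.mem_support.2 h⟩
  refine Nat.dvd_antisymm ?_ ?_
  · have : IsPeriodicPt σ (σ.cycleOf y).support.card y := by
      rw [IsPeriodicPt, IsFixedPt, Equiv.Perm.iterate_eq_pow]
      exact (h1.pow_apply_eq hy).2 dvd_rfl
    exact this.minimalPeriod_dvd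
  · rw [← h1.pow_apply_eq hy, ← Equiv.Perm.iterate_eq_pow]
    exact iterate_minimalPeriod

/-- The cycles of length `a` are counted by the points of period `a`. -/
theorem mul_cycleCount (σ : Equiv.Perm (Fin n)) (a : ℕ) :
    a * cycleCount σ a = (Finset.univ.filter fun y => minimalPeriod σ y = a).card := by
  -- From length `2` on, cycles are cycle factors and each contributes its support as a fibre.
  -- Lengths `0` and `1` are separate because `cycleType` omits fixed points.
  rcases Nat.lt_or_ge 1 a with ha | ha
  · have e : cycleCount σ a = (σ.cycleFactorsFinset.filter fun c => c.support.card = a).card := by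
      rw [cycleCount, Equiv.Perm.parts_partition, Multiset.count_add,
        Multiset.count_replicate, if_neg (by omega), add_zero, Equiv.Perm.cycleType,
        Multiset.count_map]
      rw [Finset.card, Finset.filter_val]
      congr 1
      exact Multiset.filter_congr fun c _ => by simp [eq_comm]
    have hmove : ∀ y, minimalPeriod σ y = a → σ y ≠ y := fun y hy h => by
      have : minimalPeriod σ y = 1 := minimalPeriod_eq_one_iff_isFixedPt.2 h
      omega
    rw [Finset.card_eq_sum_card_fiberwise (f := fun y => σ.cycleOf y)
      (t := σ.cycleFactorsFinset.filter fun c => c.support.card = a), e, mul_comm,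
      ← smul_eq_mul, ← Finset.sum_const]
    · refine Finset.sum_congr rfl fun c hc => ?_
      rw [Finset.mem_filter] at hc
      rw [← hc.2]
      congr 1
      ext y
      simp only [Finset.mem_filter, Finset.mem_univ, true_and]
      constructor
      · intro hy
        have hcy : c = σ.cycleOf y := Equiv.Perm.cycle_is_cycleOf hy hc.1
        refine ⟨?_, hcy.symm⟩
        have : σ y ≠ y := by
          rw [← Equiv.Perm.mem_support]
          exact Equiv.Perm.mem_cycleFactorsFinset_support_le hc.1 hy
        rw [minimalPeriod_eq_card_support_cycleOf this, ← hcy]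
      · rintro ⟨h1, h2⟩
        rw [← h2, Equiv.Perm.mem_support_cycleOf_iff]
        refine ⟨Equiv.Perm.SameCycle.refl _ _, Equiv.Perm.mem_support.2 (hmove y ?_)⟩
        rw [h1, hc.2]
    · intro y hy
      have hy' : minimalPeriod σ y = a := by simpa using hy
      rw [Finset.mem_coe, Finset.mem_filter]
      refine ⟨?_, ?_⟩
      · rw [Equiv.Perm.cycleOf_mem_cycleFactorsFinset_iff, Equiv.Perm.mem_support]
        exact hmove y hy'
      · rw [← minimalPeriod_eq_card_support_cycleOf (hmove y hy'), hy']
  · interval_cases a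
    · rw [zero_mul, eq_comm, Finset.card_eq_zero, Finset.filter_eq_empty_iff]
      exact fun y _ => (minimalPeriod_perm_pos σ y).ne'
    · have : σ.cycleType.count 1 = 0 :=
        Multiset.count_eq_zero.2 fun h => absurd (Equiv.Perm.one_lt_of_mem_cycleType h) (by simp)
      rw [one_mul, cycleCount, Equiv.Perm.parts_partition, Multiset.count_add, this,
        Multiset.count_replicate_self, zero_add, ← Finset.card_compl]
      congr 1
      ext y
      simp [minimalPeriod_eq_one_iff_isFixedPt, IsFixedPt]

/-- The multiset of the sizes, up to `K`, of the cycles of `σ`. -/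
def smallParts (K : ℕ) (σ : Equiv.Perm (Fin n)) : Multiset ℕ :=
  σ.partition.parts.filter (· ≤ K)

theorem count_smallParts {K a : ℕ} (ha : a ≤ K) (σ : Equiv.Perm (Fin n)) :
    (smallParts K σ).count a = cycleCount σ a := by
  rw [smallParts, Multiset.count_filter_of_pos (p := (· ≤ K)) ha, cycleCount]

theorem pos_of_mem_smallParts {K a : ℕ} {σ : Equiv.Perm (Fin n)} (h : a ∈ smallParts K σ) :
    0 < a :=
  σ.partition.parts_pos (Multiset.mem_of_mem_filter h)

theorem le_of_mem_smallParts {K a : ℕ} {σ : Equiv.Perm (Fin n)} (h : a ∈ smallParts K σ) :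
    a ≤ K :=
  (Multiset.mem_filter.1 h).2

/-- Sums over the small parts as sums over points. -/
theorem sum_map_smallParts (K : ℕ) (σ : Equiv.Perm (Fin n)) (u : ℕ → ℝ) :
    ((smallParts K σ).map fun a : ℕ => (a : ℝ) * u a).sum =
      ∑ y, if minimalPeriod σ y ≤ K then u (minimalPeriod σ y) else 0 := by
  have h1 : ((smallParts K σ).map fun a : ℕ => (a : ℝ) * u a).sum =
      ∑ a ∈ Finset.Icc 1 K, ((smallParts K σ).count a : ℝ) * ((a : ℝ) * u a) := by
    rw [Finset.sum_multiset_map_count]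
    simp only [nsmul_eq_mul]
    refine Finset.sum_subset ?_ ?_
    · intro a ha
      rw [Multiset.mem_toFinset] at ha
      exact Finset.mem_Icc.2 ⟨pos_of_mem_smallParts ha, le_of_mem_smallParts ha⟩
    · intro a _ ha
      rw [Multiset.mem_toFinset] at ha
      rw [Multiset.count_eq_zero_of_notMem ha]; simp
  rw [h1, ← Finset.sum_filter,
    ← Finset.sum_fiberwise_of_maps_to (t := Finset.Icc 1 K) (g := fun y => minimalPeriod σ y)]
  · refine Finset.sum_congr rfl fun a ha => ?_
    have ha' := (Finset.mem_Icc.1 ha).2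
    rw [count_smallParts ha', ← mul_assoc, mul_comm (cycleCount σ a : ℝ), ← Nat.cast_mul,
      mul_cycleCount, Finset.filter_filter, ← nsmul_eq_mul, ← Finset.sum_const]
    refine Finset.sum_congr ?_ fun y hy => ?_
    · ext y; simp only [Finset.mem_filter, Finset.mem_univ, true_and]
      constructor
      · intro h; exact ⟨h ▸ ha', h⟩
      · exact fun h => h.2
    · rw [(Finset.mem_filter.1 hy).2.2]
  · intro y hy
    exact Finset.mem_Icc.2 ⟨minimalPeriod_perm_pos σ y, (Finset.mem_filter.1 hy).2⟩

/-- The points of period `a` whose orbit meets `Y`. -/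
noncomputable def hitPoints (σ : Equiv.Perm (Fin n)) (Y : Finset (Fin n)) (a : ℕ) : Finset (Fin n) :=
  Finset.univ.filter fun y => minimalPeriod σ y = a ∧ ∃ x ∈ Y, x ∈ orbitFinset σ y

theorem minimalPeriod_eq_of_mem_orbitFinset {σ : Equiv.Perm (Fin n)} {x y : Fin n}
    (h : x ∈ orbitFinset σ y) : minimalPeriod σ x = minimalPeriod σ y := by
  obtain ⟨i, rfl⟩ := mem_orbitFinset.1 h
  exact minimalPeriod_iterate σ y i

theorem card_hitPoints_eq_zero {σ : Equiv.Perm (Fin n)} {Y : Finset (Fin n)} {a : ℕ}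
    (h : ∀ x ∈ Y, minimalPeriod σ x ≠ a) : (hitPoints σ Y a).card = 0 := by
  rw [Finset.card_eq_zero, hitPoints, Finset.filter_eq_empty_iff]
  rintro y - ⟨h1, x, hx, hxy⟩
  exact h x hx ((minimalPeriod_eq_of_mem_orbitFinset hxy).trans h1)

theorem card_hitPoints_le (σ : Equiv.Perm (Fin n)) (Y : Finset (Fin n)) (a : ℕ) :
    (hitPoints σ Y a).card ≤ a * (Y.filter fun x => minimalPeriod σ x = a).card := by
  have : hitPoints σ Y a ⊆ (Y.filter fun x => minimalPeriod σ x = a).biUnion (orbitFinset σ) := by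
    intro y hy
    obtain ⟨h1, x, hx, hxy⟩ := (Finset.mem_filter.1 hy).2
    exact Finset.mem_biUnion.2 ⟨x, Finset.mem_filter.2
      ⟨hx, (minimalPeriod_eq_of_mem_orbitFinset hxy).trans h1⟩, mem_orbitFinset_comm.1 hxy⟩
  refine (Finset.card_le_card this).trans (Finset.card_biUnion_le.trans ?_)
  rw [mul_comm, ← smul_eq_mul, ← Finset.sum_const]
  refine Finset.sum_le_sum fun x hx => ?_
  rw [card_orbitFinset, (Finset.mem_filter.1 hx).2]

theorem card_hitPoints_eq {σ : Equiv.Perm (Fin n)} {Y : Finset (Fin n)} {a : ℕ} {x : Fin n}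
    (hx : x ∈ Y) (hxa : minimalPeriod σ x = a)
    (h : ∀ z ∈ Y, minimalPeriod σ z = a → z = x) : (hitPoints σ Y a).card = a := by
  conv_rhs => rw [← hxa, ← card_orbitFinset]
  congr 1
  ext y
  constructor
  · intro hy
    obtain ⟨h1, z, hz, hzy⟩ := (Finset.mem_filter.1 hy).2
    have := h z hz ((minimalPeriod_eq_of_mem_orbitFinset hzy).trans h1)
    exact mem_orbitFinset_comm.1 (this ▸ hzy)
  · intro hy
    exact Finset.mem_filter.2 ⟨Finset.mem_univ _,
      (minimalPeriod_eq_of_mem_orbitFinset hy).trans hxa, x, hx, mem_orbitFinset_comm.1 hy⟩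

theorem iterate_eq_of_agree {σ σ' : Equiv.Perm (Fin n)} {Y : Finset (Fin n)}
    (h : ∀ y, y ∉ Y → σ' y = σ y) {y : Fin n} (hy : ∀ x ∈ Y, x ∉ orbitFinset σ y) (i : ℕ) :
    σ'^[i] y = σ^[i] y := by
  induction i with
  | zero => rfl
  | succ i ih =>
    rw [iterate_succ_apply', iterate_succ_apply', ih]
    exact h _ fun hm => hy _ hm (mem_orbitFinset.2 ⟨i, rfl⟩)

/-- An orbit that avoids `Y` never meets a point where the two permutations may differ, so it is an
orbit of both. -/
theorem avoid_of_agree {σ σ' : Equiv.Perm (Fin n)} {Y : Finset (Fin n)}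
    (h : ∀ y, y ∉ Y → σ' y = σ y) {y : Fin n} (hy : ∀ x ∈ Y, x ∉ orbitFinset σ y) :
    minimalPeriod σ' y = minimalPeriod σ y ∧ ∀ x ∈ Y, x ∉ orbitFinset σ' y := by
  have h1 := iterate_eq_of_agree h hy
  constructor
  · refine Nat.dvd_antisymm (IsPeriodicPt.minimalPeriod_dvd ?_) (IsPeriodicPt.minimalPeriod_dvd ?_)
    · rw [IsPeriodicPt, IsFixedPt, h1, iterate_minimalPeriod]
    · rw [IsPeriodicPt, IsFixedPt, ← h1, iterate_minimalPeriod]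
  · intro x hx hm
    obtain ⟨i, hi⟩ := mem_orbitFinset.1 hm
    exact hy x hx (mem_orbitFinset.2 ⟨i, by rw [← h1, hi]⟩)

/-- Two permutations that agree off `Y` have the same cycles avoiding `Y`. -/
theorem mul_cycleCount_add_card_hitPoints {σ σ' : Equiv.Perm (Fin n)} {Y : Finset (Fin n)}
    (h : ∀ y, y ∉ Y → σ' y = σ y) (a : ℕ) :
    a * cycleCount σ' a + (hitPoints σ Y a).card
      = a * cycleCount σ a + (hitPoints σ' Y a).card := by
  have key : ∀ ρ : Equiv.Perm (Fin n), a * cycleCount ρ a = (hitPoints ρ Y a).card +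
      (Finset.univ.filter fun y =>
        minimalPeriod ρ y = a ∧ ¬ ∃ x ∈ Y, x ∈ orbitFinset ρ y).card := by
    intro ρ
    rw [mul_cycleCount, hitPoints, ← Finset.filter_filter, ← Finset.filter_filter]
    exact (Finset.card_filter_add_card_filter_not _).symm
  have e : (Finset.univ.filter fun y =>
        minimalPeriod σ' y = a ∧ ¬ ∃ x ∈ Y, x ∈ orbitFinset σ' y)
      = Finset.univ.filter fun y =>
        minimalPeriod σ y = a ∧ ¬ ∃ x ∈ Y, x ∈ orbitFinset σ y := by
    ext y
    simp only [Finset.mem_filter, Finset.mem_univ, true_and, not_exists, not_and]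
    constructor
    · rintro ⟨h1, h2⟩
      obtain ⟨h3, h4⟩ := avoid_of_agree (fun z hz => (h z hz).symm) h2
      exact ⟨h3.trans h1, h4⟩
    · rintro ⟨h1, h2⟩
      obtain ⟨h3, h4⟩ := avoid_of_agree h h2
      exact ⟨h3.trans h1, h4⟩
  rw [key σ, key σ', e]
  omega

/-- Here `s` and `s'` list the small cycles of `σ` and `σ'` that meet `Y`; all others are common.
The additive form avoids truncated subtraction of multisets. -/
theorem smallParts_eq_of_card_hitPoints {K : ℕ} {σ σ' : Equiv.Perm (Fin n)} {Y : Finset (Fin n)}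
    (h : ∀ y, y ∉ Y → σ' y = σ y) {s s' : Multiset ℕ}
    (hs : ∀ a, 1 ≤ a → a ≤ K → (hitPoints σ Y a).card = a * s.count a)
    (hs' : ∀ a, 1 ≤ a → a ≤ K → (hitPoints σ' Y a).card = a * s'.count a)
    (hsK : ∀ a ∈ s, 1 ≤ a ∧ a ≤ K) (hsK' : ∀ a ∈ s', 1 ≤ a ∧ a ≤ K) :
    smallParts K σ' + s = smallParts K σ + s' := by
  refine Multiset.ext.2 fun a => ?_
  rw [Multiset.count_add, Multiset.count_add]
  by_cases ha : 1 ≤ a ∧ a ≤ K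
  · have h1 := mul_cycleCount_add_card_hitPoints h a
    rw [hs a ha.1 ha.2, hs' a ha.1 ha.2, ← mul_add, ← mul_add] at h1
    rw [count_smallParts ha.2, count_smallParts ha.2]
    exact Nat.eq_of_mul_eq_mul_left ha.1 h1
  · have h1 : s.count a = 0 := Multiset.count_eq_zero.2 fun h => ha (hsK a h)
    have h2 : s'.count a = 0 := Multiset.count_eq_zero.2 fun h => ha (hsK' a h)
    have h3 : ∀ ρ : Equiv.Perm (Fin n), (smallParts K ρ).count a = 0 := fun ρ =>
      Multiset.count_eq_zero.2 fun h => ha ⟨pos_of_mem_smallParts h, le_of_mem_smallParts h⟩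
    rw [h1, h2, h3, h3]

/-- A Lipschitz function of the small parts changes at most by the weights of the cycles met by the
set on which two permutations differ. -/
theorem IsLip.abs_smallParts_sub_le {K : ℕ} {w : ℕ → ℝ} {g : Multiset ℕ → ℝ} (hg : IsLip w g)
    {σ σ' : Equiv.Perm (Fin n)} {Y : Finset (Fin n)} (h : ∀ y, y ∉ Y → σ' y = σ y) :
    |g (smallParts K σ') - g (smallParts K σ)|
      ≤ ∑ x ∈ Y, w (minimalPeriod σ' x) + ∑ x ∈ Y, w (minimalPeriod σ x) := by
  have hw : ∀ b, 0 ≤ w b := fun b => (abs_nonneg _).trans (hg b 0)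
  have key : ∀ {ρ ρ' : Equiv.Perm (Fin n)}, (∀ y, y ∉ Y → ρ' y = ρ y) →
      ((smallParts K ρ' - smallParts K ρ).map w).sum ≤ ∑ x ∈ Y, w (minimalPeriod ρ' x) := by
    intro ρ ρ' h
    -- Every new cycle meets `Y`, so the new sizes, with multiplicity, are among the periods of the
    -- points of `Y`.
    have hle : smallParts K ρ' - smallParts K ρ ≤ Y.val.map fun x => minimalPeriod ρ' x := by
      rw [Multiset.le_iff_count]
      intro a
      rw [Multiset.count_sub]
      by_cases ha : 1 ≤ a ∧ a ≤ K
      · have h1 := mul_cycleCount_add_card_hitPoints h a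
        have h2 := card_hitPoints_le ρ' Y a
        rw [count_smallParts ha.2, count_smallParts ha.2, Multiset.count_map]
        have h3 : (Multiset.filter (fun x => a = minimalPeriod ρ' x) Y.val).card
            = (Y.filter fun x => minimalPeriod ρ' x = a).card := by
          rw [Finset.card, Finset.filter_val]
          congr 1
          exact Multiset.filter_congr fun c _ => eq_comm
        rw [h3]
        have h4 : a * cycleCount ρ' a
            ≤ a * (cycleCount ρ a + (Y.filter fun x => minimalPeriod ρ' x = a).card) := by
          rw [mul_add]; omega
        have := Nat.le_of_mul_le_mul_left h4 ha.1
        omega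
      · have : (smallParts K ρ').count a = 0 := Multiset.count_eq_zero.2 fun h =>
          ha ⟨pos_of_mem_smallParts h, le_of_mem_smallParts h⟩
        rw [this]; simp
    obtain ⟨u, hu⟩ := Multiset.le_iff_exists_add.1 hle
    have e : ∑ x ∈ Y, w (minimalPeriod ρ' x)
        = ((Y.val.map fun x => minimalPeriod ρ' x).map w).sum := by
      rw [Multiset.map_map]; rfl
    rw [e, hu, Multiset.map_add, Multiset.sum_add]
    exact le_add_of_nonneg_right (Multiset.sum_nonneg fun x hx => by
      obtain ⟨b, -, rfl⟩ := Multiset.mem_map.1 hx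
      exact hw b)
  exact (hg.abs_sub_le _ _).trans (add_le_add (key h) (key fun y hy => (h y hy).symm))

end Orbits

end KCycleWalk

/-! ### Deterministic effect of one step on the small cycles -/

namespace KCycleWalk

open Function

section OneStep

variable {n : ℕ}

/-- In what follows `σ'` stands for `σ * (τ * γ * τ⁻¹)`; it is determined by
`σ' (τ j) = σ (τ (γ j))`. -/
theorem agree_off_image {σ σ' τ γ : Equiv.Perm (Fin n)}
    (h : ∀ j, σ' (τ j) = σ (τ (γ j))) (y : Fin n) (hy : y ∉ γ.support.map τ.toEmbedding) :
    σ' y = σ y := by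
  obtain ⟨j, rfl⟩ := τ.surjective y
  have : γ j = j := by
    by_contra hj
    exact hy (Finset.mem_map.2 ⟨j, Equiv.Perm.mem_support.2 hj, rfl⟩)
  rw [h, this]

/-- After its first move `σ'` acts as `σ` off the image of the support of `γ`, so the two
trajectories agree until that set is met again. -/
theorem iterate_eq_until_hit {σ σ' τ γ : Equiv.Perm (Fin n)}
    (h : ∀ j, σ' (τ j) = σ (τ (γ j))) (j : Fin n) {i : ℕ}
    (hi : ∀ m, 1 ≤ m → m < i → ∀ b ∈ γ.support, σ^[m] (τ (γ j)) ≠ τ b) :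
    ∀ m, 1 ≤ m → m ≤ i → σ'^[m] (τ j) = σ^[m] (τ (γ j)) := by
  intro m hm
  induction m, hm using Nat.le_induction with
  | base => intro _; exact h j
  | succ m hm ih =>
    intro hmi
    rw [iterate_succ_apply', iterate_succ_apply', ih (by omega)]
    refine agree_off_image h _ fun hmem => ?_
    obtain ⟨b, hb, hb'⟩ := Finset.mem_map.1 hmem
    exact hi m hm (by omega) b hb hb'.symm

/-- The orbit of `τ j` under `σ'` starts with an arc of the orbit of `τ (γ j)` under `σ`, which ends
in the image of the support of `γ`. -/
theorem exists_first_arc {σ σ' τ γ : Equiv.Perm (Fin n)}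
    (h : ∀ j, σ' (τ j) = σ (τ (γ j))) {j : Fin n} (hj : j ∈ γ.support) :
    ∃ i, 1 ≤ i ∧ i ≤ minimalPeriod σ' (τ j) ∧ ∃ b ∈ γ.support,
      σ^[i] (τ (γ j)) = τ b ∧ σ'^[i] (τ j) = τ b := by
  classical
  set a := minimalPeriod σ' (τ j) with ha
  have ha1 : 1 ≤ a := minimalPeriod_perm_pos σ' _
  by_cases hex : ∃ i, 1 ≤ i ∧ i ≤ a ∧ ∃ b ∈ γ.support, σ^[i] (τ (γ j)) = τ b
  · have hsp := Nat.find_spec hex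
    have hmin := fun m hm => Nat.find_min hex (m := m) hm
    set i := Nat.find hex
    obtain ⟨h1, h2, b, hb, hbi⟩ := hsp
    refine ⟨i, h1, h2, b, hb, hbi, ?_⟩
    rw [← hbi]
    refine iterate_eq_until_hit h j (fun m hm hmi c hc hcm => ?_) i h1 le_rfl
    exact hmin m hmi ⟨hm, by omega, c, hc, hcm⟩
  -- If `σ` met no contact point within a full period of `σ'`, the two trajectories would agree over
  -- that period; but the one of `σ'` ends at the contact point `τ j`.
  · exfalso
    push Not at hex
    have := iterate_eq_until_hit h j (i := a) (fun m hm hma b hb => hex m hm hma.le b hb) a ha1 le_rfl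
    rw [ha, iterate_minimalPeriod] at this
    exact hex a ha1 le_rfl j hj this.symm

/-- The total weight of the moves of length `1, …, K` from `τ a` to `τ b` along `σ`. -/
noncomputable def pairWeight (σ τ : Equiv.Perm (Fin n)) (K : ℕ) (u : ℕ → ℝ) (a b : Fin n) : ℝ :=
  ∑ i ∈ Finset.Icc 1 K, if σ^[i] (τ a) = τ b then u i else 0

theorem pairWeight_nonneg (σ τ : Equiv.Perm (Fin n)) (K : ℕ) {u : ℕ → ℝ} (hu : ∀ i, 0 ≤ u i)
    (a b : Fin n) : 0 ≤ pairWeight σ τ K u a b :=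
  Finset.sum_nonneg fun i _ => by split_ifs; exacts [hu i, le_rfl]

theorem le_pairWeight {σ τ : Equiv.Perm (Fin n)} {K : ℕ} {u : ℕ → ℝ} (hu : ∀ i, 0 ≤ u i)
    {a b : Fin n} {i : ℕ} (hi1 : 1 ≤ i) (hiK : i ≤ K) (h : σ^[i] (τ a) = τ b) :
    u i ≤ pairWeight σ τ K u a b := by
  have := Finset.single_le_sum (s := Finset.Icc 1 K)
    (f := fun i => if σ^[i] (τ a) = τ b then u i else 0)
    (fun i _ => by split_ifs; exacts [hu i, le_rfl]) (Finset.mem_Icc.2 ⟨hi1, hiK⟩)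
  simp only [h, if_true] at this
  exact this

/-- The weight of all contacts of the points `τ j`, `j ∈ J`, with the small cycles of `σ` and with
one another. -/
noncomputable def contactWeight (σ τ : Equiv.Perm (Fin n)) (J : Finset (Fin n)) (K : ℕ)
    (w : ℕ → ℝ) : ℝ :=
  ∑ j ∈ J, w (minimalPeriod σ (τ j)) + ∑ j ∈ J, ∑ b ∈ J.erase j, pairWeight σ τ K w j b

/-- The first order effect of the step on `g`. -/
noncomputable def firstOrder (σ τ γ : Equiv.Perm (Fin n)) (K : ℕ) (g : Multiset ℕ → ℝ) : ℝ :=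
  ∑ j ∈ γ.support,
    ((if minimalPeriod σ (τ j) ≤ K then
        g ((smallParts K σ).erase (minimalPeriod σ (τ j))) - g (smallParts K σ) else 0) +
      ∑ i ∈ Finset.Icc 1 K,
        if 2 * K < minimalPeriod σ (τ (γ j)) ∧ σ^[i] (τ (γ j)) = τ j then
          g (i ::ₘ smallParts K σ) - g (smallParts K σ) else 0)

theorem sum_support_comp (γ : Equiv.Perm (Fin n)) (f : Fin n → ℝ) :
    ∑ j ∈ γ.support, f (γ j) = ∑ j ∈ γ.support, f j :=
  Finset.sum_equiv γ (fun j => by simp) fun _ _ => rfl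

/-- A small cycle of `σ'` through `τ j` begins with a `σ`-arc from `τ (γ j)` no longer than the
cycle. Either the arc closes up, and `τ (γ j)` was on a `σ`-cycle at most as long, or it joins two
contact points. As `w` is antitone, the old contact pays for the new cycle. -/
theorem sum_new_weight_le {σ σ' τ γ : Equiv.Perm (Fin n)}
    (h : ∀ j, σ' (τ j) = σ (τ (γ j))) {K : ℕ} {w : ℕ → ℝ} (hw : ∀ a, 0 ≤ w a)
    (hanti : Antitone w) (hwK : ∀ a, K < a → w a = 0) :
    ∑ j ∈ γ.support, w (minimalPeriod σ' (τ j)) ≤ contactWeight σ τ γ.support K w := by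
  rw [contactWeight, ← sum_support_comp γ fun j => w (minimalPeriod σ (τ j)),
    ← sum_support_comp γ fun j => ∑ b ∈ γ.support.erase j, pairWeight σ τ K w j b,
    ← Finset.sum_add_distrib]
  refine Finset.sum_le_sum fun j hj => ?_
  have h0 : 0 ≤ ∑ b ∈ γ.support.erase (γ j), pairWeight σ τ K w (γ j) b :=
    Finset.sum_nonneg fun b _ => pairWeight_nonneg σ τ K hw _ _
  by_cases hK : minimalPeriod σ' (τ j) ≤ K
  · obtain ⟨i, hi1, hia, b, hb, hbi, -⟩ := exists_first_arc h hj
    by_cases hbj : b = γ j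
    · subst hbj
      have : minimalPeriod σ (τ (γ j)) ≤ i := IsPeriodicPt.minimalPeriod_le hi1 hbi
      exact (hanti (this.trans hia)).trans (le_add_of_nonneg_right h0)
    · have h1 := le_pairWeight hw hi1 (hia.trans hK) hbi
      have h2 := Finset.single_le_sum (s := γ.support.erase (γ j))
        (f := fun b => pairWeight σ τ K w (γ j) b)
        (fun b _ => pairWeight_nonneg σ τ K hw _ _) (Finset.mem_erase.2 ⟨hbj, hb⟩)
      have h3 := hanti hia
      have h4 := hw (minimalPeriod σ (τ (γ j)))
      linarith
  · rw [hwK _ (not_le.1 hK)]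
    exact add_nonneg (hw _) h0

theorem abs_step_change_le {σ σ' τ γ : Equiv.Perm (Fin n)}
    (h : ∀ j, σ' (τ j) = σ (τ (γ j))) {K : ℕ} {w : ℕ → ℝ} {g : Multiset ℕ → ℝ} (hg : IsLip w g)
    (hanti : Antitone w) (hwK : ∀ a, K < a → w a = 0) :
    |g (smallParts K σ') - g (smallParts K σ)| ≤ 2 * contactWeight σ τ γ.support K w := by
  have hw : ∀ b, 0 ≤ w b := fun b => (abs_nonneg _).trans (hg b 0)
  have h1 := hg.abs_smallParts_sub_le (K := K) (agree_off_image h)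
  rw [Finset.sum_map, Finset.sum_map] at h1
  have h2 := sum_new_weight_le h hw hanti hwK
  have h3 : ∑ j ∈ γ.support, w (minimalPeriod σ (τ j)) ≤ contactWeight σ τ γ.support K w :=
    le_add_of_nonneg_right (Finset.sum_nonneg fun j _ => Finset.sum_nonneg fun b _ =>
      pairWeight_nonneg σ τ K hw _ _)
  simp only [Equiv.coe_toEmbedding] at h1
  linarith

theorem abs_firstOrder_le (σ τ γ : Equiv.Perm (Fin n)) (K : ℕ) {w : ℕ → ℝ}
    {g : Multiset ℕ → ℝ} (hg : IsLip w g) :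
    |firstOrder σ τ γ K g| ≤ contactWeight σ τ γ.support K w := by
  have hw : ∀ b, 0 ≤ w b := fun b => (abs_nonneg _).trans (hg b 0)
  rw [firstOrder, Finset.sum_add_distrib, contactWeight]
  refine (abs_add_le _ _).trans (add_le_add ?_ ?_)
  · refine (Finset.abs_sum_le_sum_abs _ _).trans (Finset.sum_le_sum fun j _ => ?_)
    split_ifs
    · exact hg.abs_erase_sub_le _ _
    · simpa using hw _
  · rw [← sum_support_comp γ fun j => ∑ b ∈ γ.support.erase j, pairWeight σ τ K w j b]
    refine (Finset.abs_sum_le_sum_abs _ _).trans (Finset.sum_le_sum fun j hj => ?_)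
    have h2 := Finset.single_le_sum (s := γ.support.erase (γ j))
        (f := fun b => pairWeight σ τ K w (γ j) b)
        (fun b _ => pairWeight_nonneg σ τ K hw _ _)
        (Finset.mem_erase.2 ⟨(Equiv.Perm.mem_support.1 hj).symm, hj⟩)
    refine le_trans ?_ h2
    refine (Finset.abs_sum_le_sum_abs _ _).trans (Finset.sum_le_sum fun i _ => ?_)
    split_ifs with h3 h4 h4
    · exact hg i _
    · exact absurd h3.2 h4
    · simpa using hw _
    · simp

/-- The contacts other than the one of `τ j` with its cycle. -/
noncomputable def otherContacts (σ τ : Equiv.Perm (Fin n)) (J : Finset (Fin n)) (K : ℕ)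
    (j : Fin n) : ℝ :=
  ∑ m ∈ J.erase j, (if minimalPeriod σ (τ m) ≤ 2 * K then 1 else 0) +
    ∑ a ∈ J, ∑ b ∈ J.erase a, pairWeight σ τ K (fun _ => 1) a b

/-- The contacts other than the one of `τ j` with `τ b`. -/
noncomputable def otherContactsPair (σ τ : Equiv.Perm (Fin n)) (J : Finset (Fin n)) (K : ℕ)
    (j b : Fin n) : ℝ :=
  ∑ m ∈ J, (if minimalPeriod σ (τ m) ≤ 2 * K then if m = b then 0 else 1 else 0) +
    ∑ a ∈ J, ∑ c ∈ J.erase a,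
      if (a = j ∧ c = b) ∨ (a = b ∧ c = j) then 0 else pairWeight σ τ K (fun _ => 1) a c

theorem otherContacts_nonneg (σ τ : Equiv.Perm (Fin n)) (J : Finset (Fin n)) (K : ℕ)
    (j : Fin n) : 0 ≤ otherContacts σ τ J K j :=
  add_nonneg (Finset.sum_nonneg fun m _ => by split_ifs <;> norm_num)
    (Finset.sum_nonneg fun a _ => Finset.sum_nonneg fun b _ =>
      pairWeight_nonneg σ τ K (fun _ => zero_le_one) _ _)

theorem otherContactsPair_nonneg (σ τ : Equiv.Perm (Fin n)) (J : Finset (Fin n)) (K : ℕ)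
    (j b : Fin n) : 0 ≤ otherContactsPair σ τ J K j b :=
  add_nonneg (Finset.sum_nonneg fun m _ => by split_ifs <;> norm_num)
    (Finset.sum_nonneg fun a _ => Finset.sum_nonneg fun c _ => by
      split_ifs
      exacts [le_rfl, pairWeight_nonneg σ τ K (fun _ => zero_le_one) _ _])

theorem one_le_otherContacts_of_small {σ τ : Equiv.Perm (Fin n)} {J : Finset (Fin n)} {K : ℕ}
    {j m : Fin n} (hm : m ∈ J) (hmj : m ≠ j) (h : minimalPeriod σ (τ m) ≤ 2 * K) :
    1 ≤ otherContacts σ τ J K j := by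
  have h1 := Finset.single_le_sum (s := J.erase j)
    (f := fun m => if minimalPeriod σ (τ m) ≤ 2 * K then (1 : ℝ) else 0)
    (fun m _ => by split_ifs <;> norm_num) (Finset.mem_erase.2 ⟨hmj, hm⟩)
  simp only [h, if_true] at h1
  exact h1.trans (le_add_of_nonneg_right (Finset.sum_nonneg fun a _ =>
    Finset.sum_nonneg fun b _ => pairWeight_nonneg σ τ K (fun _ => zero_le_one) _ _))

theorem one_le_otherContacts_of_pair {σ τ : Equiv.Perm (Fin n)} {J : Finset (Fin n)} {K : ℕ}
    {j a b : Fin n} (ha : a ∈ J) (hb : b ∈ J) (hab : b ≠ a) {i : ℕ} (hi1 : 1 ≤ i) (hiK : i ≤ K)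
    (h : σ^[i] (τ a) = τ b) : 1 ≤ otherContacts σ τ J K j := by
  have h1 := le_pairWeight (u := fun _ => 1) (fun _ => zero_le_one) hi1 hiK h
  have h2 := Finset.single_le_sum (s := J.erase a)
    (f := fun b => pairWeight σ τ K (fun _ => 1) a b)
    (fun b _ => pairWeight_nonneg σ τ K (fun _ => zero_le_one) _ _) (Finset.mem_erase.2 ⟨hab, hb⟩)
  have h3 := Finset.single_le_sum (s := J)
    (f := fun a => ∑ b ∈ J.erase a, pairWeight σ τ K (fun _ => 1) a b)
    (fun a _ => Finset.sum_nonneg fun b _ =>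
      pairWeight_nonneg σ τ K (fun _ => zero_le_one) _ _) ha
  exact (h1.trans (h2.trans h3)).trans (le_add_of_nonneg_left
    (Finset.sum_nonneg fun m _ => by split_ifs <;> norm_num))

theorem one_le_otherContactsPair_of_small {σ τ : Equiv.Perm (Fin n)} {J : Finset (Fin n)} {K : ℕ}
    {j b m : Fin n} (hm : m ∈ J) (hmb : m ≠ b) (h : minimalPeriod σ (τ m) ≤ 2 * K) :
    1 ≤ otherContactsPair σ τ J K j b := by
  have h1 := Finset.single_le_sum (s := J)
    (f := fun m => if minimalPeriod σ (τ m) ≤ 2 * K then if m = b then (0 : ℝ) else 1 else 0)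
    (fun m _ => by split_ifs <;> norm_num) hm
  simp only [h, if_true, hmb, if_false] at h1
  exact h1.trans (le_add_of_nonneg_right (Finset.sum_nonneg fun a _ =>
    Finset.sum_nonneg fun c _ => by
      split_ifs
      exacts [le_rfl, pairWeight_nonneg σ τ K (fun _ => zero_le_one) _ _]))

theorem one_le_otherContactsPair_of_pair {σ τ : Equiv.Perm (Fin n)} {J : Finset (Fin n)} {K : ℕ}
    {j b a c : Fin n} (ha : a ∈ J) (hc : c ∈ J) (hac : c ≠ a)
    (hne : ¬ ((a = j ∧ c = b) ∨ (a = b ∧ c = j))) {i : ℕ} (hi1 : 1 ≤ i) (hiK : i ≤ K)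
    (h : σ^[i] (τ a) = τ c) : 1 ≤ otherContactsPair σ τ J K j b := by
  have h1 := le_pairWeight (u := fun _ => 1) (fun _ => zero_le_one) hi1 hiK h
  have hnn : ∀ a c, (0 : ℝ) ≤ if (a = j ∧ c = b) ∨ (a = b ∧ c = j) then 0
      else pairWeight σ τ K (fun _ => 1) a c := fun a c => by
    split_ifs
    exacts [le_rfl, pairWeight_nonneg σ τ K (fun _ => zero_le_one) _ _]
  have h2 := Finset.single_le_sum (s := J.erase a)
    (f := fun c => if (a = j ∧ c = b) ∨ (a = b ∧ c = j) then 0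
      else pairWeight σ τ K (fun _ => 1) a c)
    (fun c _ => hnn a c) (Finset.mem_erase.2 ⟨hac, hc⟩)
  have h3 := Finset.single_le_sum (s := J)
    (f := fun a => ∑ c ∈ J.erase a, if (a = j ∧ c = b) ∨ (a = b ∧ c = j) then 0
      else pairWeight σ τ K (fun _ => 1) a c)
    (fun a _ => Finset.sum_nonneg fun c _ => hnn a c) ha
  simp only [if_neg hne] at h2
  exact (h1.trans (h2.trans h3)).trans (le_add_of_nonneg_left
    (Finset.sum_nonneg fun m _ => by split_ifs <;> norm_num))

/-- An isolated contact with a small cycle removes it. -/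
theorem step_change_of_isolated_cycle {σ σ' τ γ : Equiv.Perm (Fin n)}
    (h : ∀ j, σ' (τ j) = σ (τ (γ j))) {K : ℕ} (g : Multiset ℕ → ℝ) {j : Fin n}
    (hj : j ∈ γ.support) (hjK : minimalPeriod σ (τ j) ≤ K)
    (hbig : ∀ m ∈ γ.support, m ≠ j → 2 * K < minimalPeriod σ (τ m))
    (hpair : ∀ a ∈ γ.support, ∀ b ∈ γ.support, b ≠ a → ∀ i, 1 ≤ i → i ≤ K →
      σ^[i] (τ a) ≠ τ b) :
    g (smallParts K σ') - g (smallParts K σ) = firstOrder σ τ γ K g := by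
  have hγ : ∀ m, m ∈ γ.support → γ m ∈ γ.support := fun m hm => Equiv.Perm.apply_mem_support.2 hm
  have harc : ∀ m ∈ γ.support, minimalPeriod σ' (τ m) ≤ K →
      γ m = j ∧ minimalPeriod σ' (τ (γ m)) ≤ K := by
    intro m hm hmK
    obtain ⟨i, hi1, hia, b, hb, hbi, hbi'⟩ := exists_first_arc h hm
    have hb' : b = γ m := by
      by_contra hne
      exact hpair _ (hγ m hm) b hb hne i hi1 (hia.trans hmK) hbi
    subst hb'
    refine ⟨?_, ?_⟩
    · by_contra hne
      have h1 : minimalPeriod σ (τ (γ m)) ≤ i := IsPeriodicPt.minimalPeriod_le hi1 hbi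
      have h2 := hbig _ hb hne
      omega
    · rwa [← hbi', minimalPeriod_iterate]
  -- `harc` propagates from `m` to `γ m`. Using it twice gives `γ m = j = γ (γ m)`, which is
  -- impossible for `m` in the support.
  have hnew : ∀ m ∈ γ.support, K < minimalPeriod σ' (τ m) := by
    intro m hm
    by_contra hmK
    obtain ⟨h1, h2⟩ := harc m hm (not_lt.1 hmK)
    obtain ⟨h3, -⟩ := harc _ (hγ m hm) h2
    exact Equiv.Perm.mem_support.1 hm (γ.injective (h3.trans h1.symm))
  have hparts := smallParts_eq_of_card_hitPoints (K := K) (agree_off_image h)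
    (s := {minimalPeriod σ (τ j)}) (s' := 0) (fun a ha1 haK => by
      by_cases haj : a = minimalPeriod σ (τ j)
      · rw [haj, Multiset.count_singleton_self, mul_one]
        refine card_hitPoints_eq (x := τ j) (Finset.mem_map.2 ⟨j, hj, rfl⟩) rfl fun z hz hzj => ?_
        obtain ⟨m, hm, rfl⟩ := Finset.mem_map.1 hz
        by_contra hne
        have := hbig m hm fun e => hne (by rw [e]; rfl)
        simp only [Equiv.coe_toEmbedding] at hzj
        omega
      · rw [Multiset.count_eq_zero_of_notMem (by simpa using haj), mul_zero]
        refine card_hitPoints_eq_zero fun z hz hza => ?_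
        obtain ⟨m, hm, rfl⟩ := Finset.mem_map.1 hz
        simp only [Equiv.coe_toEmbedding] at hza
        by_cases hmj : m = j
        · exact haj (by rw [← hza, hmj])
        · have := hbig m hm hmj
          omega)
    (fun a ha1 haK => by
      rw [Multiset.count_zero, mul_zero]
      refine card_hitPoints_eq_zero fun z hz hza => ?_
      obtain ⟨m, hm, rfl⟩ := Finset.mem_map.1 hz
      have := hnew m hm
      simp only [Equiv.coe_toEmbedding] at hza
      omega)
    (fun a ha => by
      rw [Multiset.mem_singleton] at ha
      exact ⟨ha ▸ minimalPeriod_perm_pos σ _, ha ▸ hjK⟩)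
    (by simp)
  have hparts' : smallParts K σ' = (smallParts K σ).erase (minimalPeriod σ (τ j)) := by
    rw [add_zero, add_comm, Multiset.singleton_add] at hparts
    rw [← hparts, Multiset.erase_cons_head]
  have hL : firstOrder σ τ γ K g =
      g ((smallParts K σ).erase (minimalPeriod σ (τ j))) - g (smallParts K σ) := by
    rw [firstOrder, Finset.sum_add_distrib, Finset.sum_eq_single_of_mem j hj, if_pos hjK,
      Finset.sum_eq_zero, add_zero]
    · intro m hm
      refine Finset.sum_eq_zero fun i hi => if_neg fun hc => ?_
      rw [Finset.mem_Icc] at hi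
      exact hpair _ (hγ m hm) m hm (Equiv.Perm.mem_support.1 hm).symm i hi.1 hi.2 hc.2
    · intro m hm hmj
      have := hbig m hm hmj
      exact if_neg (by omega)
  rw [hL, hparts']

/-- An isolated contact of two points creates a small cycle if the points are adjacent in `γ`, and
has no effect on the small cycles otherwise. -/
theorem step_change_of_isolated_pair {σ σ' τ γ : Equiv.Perm (Fin n)}
    (h : ∀ j, σ' (τ j) = σ (τ (γ j))) {K : ℕ} (g : Multiset ℕ → ℝ) {j b : Fin n}
    (hj : j ∈ γ.support) (hb : b ∈ γ.support) {i : ℕ} (hi1 : 1 ≤ i) (hiK : i ≤ K)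
    (hjb : b ≠ j) (hi : σ^[i] (τ j) = τ b)
    (hbig : ∀ m ∈ γ.support, 2 * K < minimalPeriod σ (τ m))
    (hpair : ∀ a ∈ γ.support, ∀ c ∈ γ.support, c ≠ a → ∀ i', 1 ≤ i' → i' ≤ K →
      σ^[i'] (τ a) = τ c → (a = j ∧ c = b) ∨ (a = b ∧ c = j)) :
    g (smallParts K σ') - g (smallParts K σ) = firstOrder σ τ γ K g := by
  have hγ : ∀ m, m ∈ γ.support → γ m ∈ γ.support := fun m hm => Equiv.Perm.apply_mem_support.2 hm
  have hne : ∀ m ∈ γ.support, ∀ i', 1 ≤ i' → i' ≤ 2 * K → σ^[i'] (τ m) ≠ τ m := by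
    intro m hm i' h1 h2 h3
    have h4 : minimalPeriod σ (τ m) ≤ i' := IsPeriodicPt.minimalPeriod_le h1 h3
    have h5 := hbig m hm
    omega
  have huniq : ∀ i', i' ≤ K → σ^[i'] (τ j) = τ b → i' = i := by
    intro i' h1 h2
    have h3 := hbig j hj
    exact iterate_injOn_Iio_minimalPeriod (f := σ) (x := τ j) (by simp; omega) (by simp; omega)
      (h2.trans hi.symm)
  have hpair' : ∀ a ∈ γ.support, ∀ c ∈ γ.support, ∀ i', 1 ≤ i' → i' ≤ K →
      σ^[i'] (τ a) = τ c → a = j ∧ c = b ∧ i' = i := by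
    intro a ha c hc i' h1 h2 h3
    have hca : c ≠ a := by rintro rfl; exact hne c hc i' h1 (by omega) h3
    rcases hpair a ha c hc hca i' h1 h2 h3 with ⟨rfl, rfl⟩ | ⟨rfl, rfl⟩
    · exact ⟨rfl, rfl, huniq i' h2 h3⟩
    -- Arcs in both directions would give a period `i' + i ≤ 2 * K`. This is why long cycles are
    -- required to exceed `2 * K` rather than `K`.
    · exfalso
      refine hne c hj (i' + i) (by omega) (by omega) ?_
      rw [iterate_add_apply, hi, h3]
  have harc : ∀ m ∈ γ.support, minimalPeriod σ' (τ m) ≤ K →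
      γ m = j ∧ i ≤ minimalPeriod σ' (τ m) ∧ σ'^[i] (τ m) = τ b := by
    intro m hm hmK
    obtain ⟨i', hi1', hia, c, hc, hci, hci'⟩ := exists_first_arc h hm
    obtain ⟨h1, rfl, rfl⟩ := hpair' _ (hγ m hm) c hc i' hi1' (hia.trans hmK) hci
    exact ⟨h1, hia, hci'⟩
  have hnew : ∀ m ∈ γ.support, minimalPeriod σ' (τ m) ≤ K →
      m = b ∧ γ b = j ∧ minimalPeriod σ' (τ m) = i := by
    intro m hm hmK
    obtain ⟨h1, h2, h3⟩ := harc m hm hmK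
    have h4 : minimalPeriod σ' (τ b) ≤ K := by rwa [← h3, minimalPeriod_iterate]
    obtain ⟨h5, -, -⟩ := harc b hb h4
    have h6 : m = b := γ.injective (h1.trans h5.symm)
    subst h6
    exact ⟨rfl, h1, le_antisymm (IsPeriodicPt.minimalPeriod_le hi1 h3) h2⟩
  have hL : firstOrder σ τ γ K g =
      if γ b = j then g (i ::ₘ smallParts K σ) - g (smallParts K σ) else 0 := by
    rw [firstOrder, Finset.sum_add_distrib, Finset.sum_eq_zero, zero_add,
      Finset.sum_eq_single_of_mem b hb,
      Finset.sum_eq_single_of_mem i (Finset.mem_Icc.2 ⟨hi1, hiK⟩)]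
    · by_cases hbj : γ b = j
      · rw [if_pos hbj, if_pos ⟨hbig _ (hγ b hb), by rw [hbj, hi]⟩]
      · rw [if_neg hbj, if_neg fun hc => hbj (hpair' _ (hγ b hb) b hb i hi1 hiK hc.2).1]
    · intro i' hi' hne'
      rw [Finset.mem_Icc] at hi'
      exact if_neg fun hc => hne' (hpair' _ (hγ b hb) b hb i' hi'.1 hi'.2 hc.2).2.2
    · intro m hm hmb
      refine Finset.sum_eq_zero fun i' hi' => if_neg fun hc => ?_
      rw [Finset.mem_Icc] at hi'
      exact hmb (hpair' _ (hγ m hm) m hm i' hi'.1 hi'.2 hc.2).2.1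
    · intro m hm
      have := hbig m hm
      exact if_neg (by omega)
  have hold : ∀ a, 1 ≤ a → a ≤ K →
      (hitPoints σ (γ.support.map τ.toEmbedding) a).card = a * (0 : Multiset ℕ).count a := by
    intro a ha1 haK
    rw [Multiset.count_zero, mul_zero]
    refine card_hitPoints_eq_zero fun z hz hza => ?_
    obtain ⟨m, hm, rfl⟩ := Finset.mem_map.1 hz
    have := hbig m hm
    simp only [Equiv.coe_toEmbedding] at hza
    omega
  rw [hL]
  by_cases hbj : γ b = j
  · rw [if_pos hbj]
    -- From `τ b` the new permutation follows the arc that starts at `τ (γ b) = τ j` and ends at `τ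
    -- b`, so it closes a cycle of length `i`.
    have hcyc : σ'^[i] (τ b) = τ b := by
      rw [iterate_eq_until_hit h b (i := i) (fun m hm1 hmi c hc hmc => ?_) i hi1 le_rfl, hbj, hi]
      rw [hbj] at hmc
      have := (hpair' j hj c hc m hm1 (by omega) hmc).2.2
      omega
    have hper : minimalPeriod σ' (τ b) = i :=
      (hnew b hb ((IsPeriodicPt.minimalPeriod_le hi1 hcyc).trans hiK)).2.2
    have hparts := smallParts_eq_of_card_hitPoints (K := K) (agree_off_image h)
      (s := 0) (s' := {i}) hold (fun a ha1 haK => by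
        by_cases hai : a = i
        · rw [hai, Multiset.count_singleton_self, mul_one]
          refine card_hitPoints_eq (x := τ b) (Finset.mem_map.2 ⟨b, hb, rfl⟩) hper
            fun z hz hzj => ?_
          obtain ⟨m, hm, rfl⟩ := Finset.mem_map.1 hz
          simp only [Equiv.coe_toEmbedding] at hzj ⊢
          rw [(hnew m hm (by omega)).1]
        · rw [Multiset.count_eq_zero_of_notMem (by simpa using hai), mul_zero]
          refine card_hitPoints_eq_zero fun z hz hza => ?_
          obtain ⟨m, hm, rfl⟩ := Finset.mem_map.1 hz
          simp only [Equiv.coe_toEmbedding] at hza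
          exact hai (hza.symm.trans (hnew m hm (by omega)).2.2))
      (by simp) (fun a ha => by
        rw [Multiset.mem_singleton] at ha
        exact ha ▸ ⟨hi1, hiK⟩)
    rw [add_zero, add_comm, Multiset.singleton_add] at hparts
    rw [hparts]
  · rw [if_neg hbj]
    have hparts := smallParts_eq_of_card_hitPoints (K := K) (agree_off_image h)
      (s := 0) (s' := 0) hold (fun a ha1 haK => by
        rw [Multiset.count_zero, mul_zero]
        refine card_hitPoints_eq_zero fun z hz hza => ?_
        obtain ⟨m, hm, rfl⟩ := Finset.mem_map.1 hz
        simp only [Equiv.coe_toEmbedding] at hza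
        exact hbj (hnew m hm (by omega)).2.1)
      (by simp) (by simp)
    rw [add_zero, add_zero] at hparts
    rw [hparts, sub_self]

/-- The weight of the contacts that do not occur alone. -/
noncomputable def doubleContactWeight (σ τ : Equiv.Perm (Fin n)) (J : Finset (Fin n)) (K : ℕ)
    (w : ℕ → ℝ) : ℝ :=
  ∑ j ∈ J, w (minimalPeriod σ (τ j)) * otherContacts σ τ J K j +
    ∑ j ∈ J, ∑ b ∈ J.erase j, pairWeight σ τ K w j b * otherContactsPair σ τ J K j b

/-- If some contact occurs alone, `firstOrder` is exact. Otherwise each contact of positive weight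
is accompanied by another one, so `contactWeight` is at most `doubleContactWeight`, and the crude
bounds `2` for the change and `1` for `firstOrder` give the constant `3`. -/
theorem abs_step_change_sub_firstOrder_le {σ σ' τ γ : Equiv.Perm (Fin n)}
    (h : ∀ j, σ' (τ j) = σ (τ (γ j))) {K : ℕ} {w : ℕ → ℝ} {g : Multiset ℕ → ℝ} (hg : IsLip w g)
    (hanti : Antitone w) (hwK : ∀ a, K < a → w a = 0) :
    |g (smallParts K σ') - g (smallParts K σ) - firstOrder σ τ γ K g|
      ≤ 3 * doubleContactWeight σ τ γ.support K w := by
  have hw : ∀ b, 0 ≤ w b := fun b => (abs_nonneg _).trans (hg b 0)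
  have hD : 0 ≤ doubleContactWeight σ τ γ.support K w :=
    add_nonneg (Finset.sum_nonneg fun j _ => mul_nonneg (hw _) (otherContacts_nonneg _ _ _ _ _))
      (Finset.sum_nonneg fun j _ => Finset.sum_nonneg fun b _ => mul_nonneg
        (pairWeight_nonneg σ τ K hw _ _) (otherContactsPair_nonneg _ _ _ _ _ _))
  by_cases h1 : ∃ j ∈ γ.support, minimalPeriod σ (τ j) ≤ K ∧ otherContacts σ τ γ.support K j < 1
  · obtain ⟨j, hj, hjK, hlt⟩ := h1
    rw [step_change_of_isolated_cycle h g hj hjK, sub_self, abs_zero]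
    · positivity
    · intro m hm hmj
      by_contra hle
      exact absurd (one_le_otherContacts_of_small hm hmj (not_lt.1 hle)) (not_le.2 hlt)
    · intro a ha b hb hab i hi1 hiK hi
      exact absurd (one_le_otherContacts_of_pair ha hb hab hi1 hiK hi) (not_le.2 hlt)
  by_cases h2 : ∃ j ∈ γ.support, ∃ b ∈ γ.support, b ≠ j ∧ (∃ i, 1 ≤ i ∧ i ≤ K ∧
      σ^[i] (τ j) = τ b) ∧ otherContactsPair σ τ γ.support K j b < 1
  · obtain ⟨j, hj, b, hb, hbj, ⟨i, hi1, hiK, hi⟩, hlt⟩ := h2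
    have hbig : ∀ m ∈ γ.support, m ≠ b → 2 * K < minimalPeriod σ (τ m) := by
      intro m hm hmb
      by_contra hle
      exact absurd (one_le_otherContactsPair_of_small hm hmb (not_lt.1 hle)) (not_le.2 hlt)
    rw [step_change_of_isolated_pair h g hj hb hi1 hiK hbj hi, sub_self, abs_zero]
    · positivity
    · intro m hm
      -- The point `τ b` lies on the cycle of `τ j`, so nothing is lost by omitting `m = b` in
      -- `otherContactsPair`.
      by_cases hmb : m = b
      · rw [hmb, ← hi, minimalPeriod_iterate]
        exact hbig j hj hbj.symm
      · exact hbig m hm hmb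
    · intro a ha c hc hca i' hi1' hiK' hi'
      by_contra hne
      exact absurd (one_le_otherContactsPair_of_pair ha hc hca hne hi1' hiK' hi') (not_le.2 hlt)
  · push Not at h1 h2
    have hWD : contactWeight σ τ γ.support K w ≤ doubleContactWeight σ τ γ.support K w := by
      refine add_le_add (Finset.sum_le_sum fun j hj => ?_)
        (Finset.sum_le_sum fun j hj => Finset.sum_le_sum fun b hb => ?_)
      · by_cases hjK : minimalPeriod σ (τ j) ≤ K
        · exact le_mul_of_one_le_right (hw _) (h1 j hj hjK)
        · rw [hwK _ (not_le.1 hjK), zero_mul]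
      · obtain ⟨hbj, hb⟩ := Finset.mem_erase.1 hb
        by_cases hex : ∃ i, 1 ≤ i ∧ i ≤ K ∧ σ^[i] (τ j) = τ b
        · exact le_mul_of_one_le_right (pairWeight_nonneg σ τ K hw _ _) (h2 j hj b hb hbj hex)
        · have : pairWeight σ τ K w j b = 0 := Finset.sum_eq_zero fun i hi =>
            if_neg fun hi' => hex ⟨i, (Finset.mem_Icc.1 hi).1, (Finset.mem_Icc.1 hi).2, hi'⟩
          rw [this, zero_mul]
    have h3 := abs_step_change_le h hg hanti hwK
    have h4 := abs_firstOrder_le σ τ γ K hg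
    rw [abs_le] at *
    constructor <;> linarith [h3.1, h3.2, h4.1, h4.2]

end OneStep

end KCycleWalk

/-! ### Averages over a uniformly random conjugation -/

namespace KCycleWalk

open Function

section Averages

variable {n : ℕ}

theorem sum_perm_mul_right (ρ : Equiv.Perm (Fin n)) (F : Equiv.Perm (Fin n) → ℝ) :
    ∑ τ, F (τ * ρ) = ∑ τ, F τ :=
  Fintype.sum_equiv (Equiv.mulRight ρ) _ _ fun _ => rfl

/-- Summing over all conjugates is summing over the conjugacy class. -/
theorem sum_conj_eq {k : ℕ} {γ₀ : Equiv.Perm (Fin n)} (hγ₀ : γ₀ ∈ kCycles k n)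
    {C : Finset (Equiv.Perm (Fin n))} (hC : ∀ γ, γ ∈ C ↔ γ ∈ kCycles k n)
    (F : Equiv.Perm (Fin n) → ℝ) :
    (C.card : ℝ) * ∑ τ, F (τ * γ₀ * τ⁻¹) =
      Fintype.card (Equiv.Perm (Fin n)) * ∑ γ ∈ C, F γ := by
  have hconj : ∀ γ ∈ C, ∀ τ, τ * γ * τ⁻¹ ∈ C := by
    intro γ hγ τ
    obtain ⟨h1, h2⟩ := (hC γ).1 hγ
    exact (hC _).2 ⟨h1.conj, by rw [Equiv.Perm.card_support_conj, h2]⟩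
  have h1 : ∀ γ ∈ C, ∑ τ, F (τ * γ * τ⁻¹) = ∑ τ, F (τ * γ₀ * τ⁻¹) := by
    intro γ hγ
    obtain ⟨h1, h2⟩ := (hC γ).1 hγ
    have : IsConj γ₀ γ := hγ₀.1.isConj h1 (hγ₀.2.trans h2.symm)
    obtain ⟨ρ, rfl⟩ := isConj_iff.1 this
    rw [← sum_perm_mul_right ρ fun τ => F (τ * γ₀ * τ⁻¹)]
    refine Finset.sum_congr rfl fun τ _ => ?_
    congr 1
  have h2 : ∀ τ, ∑ γ ∈ C, F (τ * γ * τ⁻¹) = ∑ γ ∈ C, F γ := by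
    intro τ
    refine Finset.sum_bij (fun γ _ => τ * γ * τ⁻¹) (fun γ hγ => hconj γ hγ τ) ?_ ?_ fun _ _ => rfl
    · intro a _ b _ hab
      simpa using hab
    · intro γ hγ
      refine ⟨τ⁻¹ * γ * τ, ?_, by group⟩
      simpa using hconj γ hγ τ⁻¹
  calc (C.card : ℝ) * ∑ τ, F (τ * γ₀ * τ⁻¹) = ∑ γ ∈ C, ∑ τ, F (τ * γ * τ⁻¹) := by
        rw [Finset.sum_congr rfl h1, Finset.sum_const, nsmul_eq_mul]
    _ = ∑ τ : Equiv.Perm (Fin n), ∑ γ ∈ C, F γ := by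
        rw [Finset.sum_comm]; exact Finset.sum_congr rfl fun τ _ => h2 τ
    _ = _ := by rw [Finset.sum_const, nsmul_eq_mul, Finset.card_univ]

theorem sum_perm_apply (j : Fin n) (F : Fin n → ℝ) :
    (n : ℝ) * ∑ τ : Equiv.Perm (Fin n), F (τ j)
      = Fintype.card (Equiv.Perm (Fin n)) * ∑ z, F z := by
  have h1 : ∀ y, ∑ τ : Equiv.Perm (Fin n), F (τ y) = ∑ τ : Equiv.Perm (Fin n), F (τ j) := by
    intro y
    rw [← sum_perm_mul_right (Equiv.swap j y) fun τ => F (τ j)]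
    simp
  calc (n : ℝ) * ∑ τ : Equiv.Perm (Fin n), F (τ j)
        = ∑ y : Fin n, ∑ τ : Equiv.Perm (Fin n), F (τ y) := by
        rw [Finset.sum_congr rfl fun y _ => h1 y, Finset.sum_const, nsmul_eq_mul]; simp
    _ = ∑ τ : Equiv.Perm (Fin n), ∑ z, F z := by
        rw [Finset.sum_comm]
        exact Finset.sum_congr rfl fun τ _ => Equiv.sum_comp τ F
    _ = _ := by rw [Finset.sum_const, nsmul_eq_mul, Finset.card_univ]

/-- The functions of `τ` that depend only on the values on `J` other than the one at `j`. -/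
def IndepOf {α : Type*} (J : Finset (Fin n)) (j : Fin n) (φ : Equiv.Perm (Fin n) → α) : Prop :=
  ∀ τ τ' : Equiv.Perm (Fin n), (∀ i ∈ J, i ≠ j → τ i = τ' i) → φ τ = φ τ'

/-- Resampling the value at `j` given the other values on `J`. -/
theorem sum_resample_le {J : Finset (Fin n)} (hJ : 2 * J.card ≤ n) {j : Fin n} (hj : j ∈ J)
    {ψ : Equiv.Perm (Fin n) → Fin n → ℝ} (h0 : ∀ τ z, 0 ≤ ψ τ z) (hψ : IndepOf J j ψ) :
    ∑ τ, ψ τ (τ j) ≤ 2 / n * ∑ τ, ∑ z, ψ τ z := by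
  have hn : 0 < n := j.pos
  -- Swapping `j` with an index `y` outside `J.erase j` leaves the other values on `J` alone, so `τ
  -- y` may stand for `τ j`. At least `n / 2` such `y` exist, whence the factor `2 / n`.
  have h1 : ∀ y ∈ (J.erase j)ᶜ, ∑ τ, ψ τ (τ y) = ∑ τ, ψ τ (τ j) := by
    intro y hy
    rw [← sum_perm_mul_right (Equiv.swap j y) fun τ => ψ τ (τ j)]
    refine Finset.sum_congr rfl fun τ _ => ?_
    have : ψ (τ * Equiv.swap j y) = ψ τ := by
      refine hψ _ _ fun i hi hij => ?_
      rw [Equiv.Perm.mul_apply, Equiv.swap_apply_of_ne_of_ne hij]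
      rintro rfl
      exact (Finset.mem_compl.1 hy) (Finset.mem_erase.2 ⟨hij, hi⟩)
    rw [this]; simp
  have hJ0 : 0 < J.card := Finset.card_pos.2 ⟨j, hj⟩
  have hcard : (n : ℝ) / 2 ≤ ((J.erase j)ᶜ.card : ℝ) := by
    rw [Finset.card_compl, Finset.card_erase_of_mem hj, Fintype.card_fin]
    have : n ≤ 2 * (n - (J.card - 1)) := by omega
    have h : (n : ℝ) ≤ 2 * ((n - (J.card - 1) : ℕ) : ℝ) := by exact_mod_cast this
    linarith
  have hS0 : 0 ≤ ∑ τ, ψ τ (τ j) := Finset.sum_nonneg fun τ _ => h0 _ _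
  have h2 : (((J.erase j)ᶜ).card : ℝ) * ∑ τ, ψ τ (τ j) ≤ ∑ τ, ∑ z, ψ τ z := by
    calc _ = ∑ y ∈ (J.erase j)ᶜ, ∑ τ, ψ τ (τ y) := by
          rw [Finset.sum_congr rfl h1, Finset.sum_const, nsmul_eq_mul]
      _ = ∑ τ : Equiv.Perm (Fin n), ∑ y ∈ (J.erase j)ᶜ, ψ τ (τ y) := Finset.sum_comm
      _ ≤ ∑ τ : Equiv.Perm (Fin n), ∑ y, ψ τ (τ y) := Finset.sum_le_sum fun τ _ =>
          Finset.sum_le_sum_of_subset_of_nonneg (Finset.subset_univ _) fun _ _ _ => h0 _ _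
      _ = _ := Finset.sum_congr rfl fun τ _ => Equiv.sum_comp τ (ψ τ)
  have h3 : (n : ℝ) / 2 * ∑ τ, ψ τ (τ j) ≤ ∑ τ, ∑ z, ψ τ z :=
    (mul_le_mul_of_nonneg_right hcard hS0).trans h2
  have hn' : (0 : ℝ) < n := by exact_mod_cast hn
  calc ∑ τ, ψ τ (τ j) = 2 / n * ((n : ℝ) / 2 * ∑ τ, ψ τ (τ j)) := by field_simp
    _ ≤ _ := by gcongr

theorem sum_mul_apply_le {J : Finset (Fin n)} (hJ : 2 * J.card ≤ n) {j : Fin n} (hj : j ∈ J)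
    {φ : Equiv.Perm (Fin n) → ℝ} (h0 : ∀ τ, 0 ≤ φ τ) (hφ : IndepOf J j φ)
    {u : Fin n → ℝ} (hu : ∀ z, 0 ≤ u z) :
    ∑ τ, φ τ * u (τ j) ≤ 2 / n * (∑ z, u z) * ∑ τ, φ τ := by
  refine (sum_resample_le hJ hj (ψ := fun τ z => φ τ * u z)
    (fun τ z => mul_nonneg (h0 τ) (hu z)) fun τ τ' h => ?_).trans_eq ?_
  · simp only [hφ τ τ' h]
  · simp only [← Finset.mul_sum, ← Finset.sum_mul]; ring

/-- Given `τ a`, each length `i` leaves exactly one position for `τ b`, so resampling `τ b` costs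
the total weight of the lengths over `n`. -/
theorem sum_mul_pairWeight_right_le {J : Finset (Fin n)} (hJ : 2 * J.card ≤ n)
    (σ : Equiv.Perm (Fin n)) (K : ℕ) {u : ℕ → ℝ} (hu : ∀ i, 0 ≤ u i) {a b : Fin n}
    (ha : a ∈ J) (hb : b ∈ J) (hab : a ≠ b)
    {φ : Equiv.Perm (Fin n) → ℝ} (h0 : ∀ τ, 0 ≤ φ τ) (hφ : IndepOf J b φ) :
    ∑ τ, φ τ * pairWeight σ τ K u a b ≤ 2 / n * (∑ i ∈ Finset.Icc 1 K, u i) * ∑ τ, φ τ := by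
  refine (sum_resample_le hJ hb
    (ψ := fun τ z => φ τ * ∑ i ∈ Finset.Icc 1 K, if σ^[i] (τ a) = z then u i else 0)
    (fun τ z => mul_nonneg (h0 τ) (Finset.sum_nonneg fun i _ => by
      split_ifs; exacts [hu i, le_rfl])) fun τ τ' h => ?_).trans_eq ?_
  · simp only [hφ τ τ' h, h a ha hab]
  · rw [mul_assoc, mul_comm (∑ i ∈ Finset.Icc 1 K, u i), Finset.sum_mul]
    congr 1
    refine Finset.sum_congr rfl fun τ _ => ?_
    rw [← Finset.mul_sum, Finset.sum_comm]
    simp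

theorem sum_mul_pairWeight_left_le {J : Finset (Fin n)} (hJ : 2 * J.card ≤ n)
    (σ : Equiv.Perm (Fin n)) (K : ℕ) {u : ℕ → ℝ} (hu : ∀ i, 0 ≤ u i) {a b : Fin n}
    (ha : a ∈ J) (hb : b ∈ J) (hab : a ≠ b)
    {φ : Equiv.Perm (Fin n) → ℝ} (h0 : ∀ τ, 0 ≤ φ τ) (hφ : IndepOf J a φ) :
    ∑ τ, φ τ * pairWeight σ τ K u a b ≤ 2 / n * (∑ i ∈ Finset.Icc 1 K, u i) * ∑ τ, φ τ := by
  refine (sum_resample_le hJ ha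
    (ψ := fun τ z => φ τ * ∑ i ∈ Finset.Icc 1 K, if σ^[i] z = τ b then u i else 0)
    (fun τ z => mul_nonneg (h0 τ) (Finset.sum_nonneg fun i _ => by
      split_ifs; exacts [hu i, le_rfl])) fun τ τ' h => ?_).trans_eq ?_
  · simp only [hφ τ τ' h, h b hb hab.symm]
  · rw [mul_assoc, mul_comm (∑ i ∈ Finset.Icc 1 K, u i), Finset.sum_mul]
    congr 1
    refine Finset.sum_congr rfl fun τ _ => ?_
    rw [← Finset.mul_sum, Finset.sum_comm]
    congr 1
    refine Finset.sum_congr rfl fun i _ => ?_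
    have : ∀ z, (σ^[i] z = τ b) ↔ z = (σ ^ i)⁻¹ (τ b) := fun z => by
      rw [Equiv.Perm.iterate_eq_pow, Equiv.Perm.eq_inv_iff_eq]
    simp [this]

theorem indepOf_const {J : Finset (Fin n)} {j : Fin n} {α : Type*} (c : α) :
    IndepOf J j fun _ => c := fun _ _ _ => rfl

theorem indepOf_comp_apply {J : Finset (Fin n)} {j m : Fin n} (hm : m ∈ J) (hmj : m ≠ j)
    {α : Type*} (u : Fin n → α) : IndepOf J j fun τ => u (τ m) := fun τ τ' h => by
  simp only [h m hm hmj]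

theorem indepOf_pairWeight {J : Finset (Fin n)} {j a b : Fin n} (ha : a ∈ J) (haj : a ≠ j)
    (hb : b ∈ J) (hbj : b ≠ j) (σ : Equiv.Perm (Fin n)) (K : ℕ) (u : ℕ → ℝ) :
    IndepOf J j fun τ => pairWeight σ τ K u a b := fun τ τ' h => by
  simp only [pairWeight, h a ha haj, h b hb hbj]

/-- The number of points on the cycles of size at most `m`. -/
noncomputable def smallPoints (σ : Equiv.Perm (Fin n)) (m : ℕ) : ℝ :=
  ∑ y, if minimalPeriod σ y ≤ m then 1 else 0

theorem smallPoints_nonneg (σ : Equiv.Perm (Fin n)) (m : ℕ) : 0 ≤ smallPoints σ m :=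
  Finset.sum_nonneg fun y _ => by split_ifs <;> norm_num

theorem smallPoints_mono (σ : Equiv.Perm (Fin n)) : Monotone (smallPoints σ) := by
  intro a b hab
  refine Finset.sum_le_sum fun y _ => ?_
  split_ifs with h1 h2
  · exact le_rfl
  · exact absurd (h1.trans hab) h2
  · norm_num
  · exact le_rfl

/-- Double contacts are of second order. -/
theorem sum_doubleContactWeight_le {J : Finset (Fin n)} (hJ : 2 * J.card ≤ n)
    (σ : Equiv.Perm (Fin n)) (K : ℕ) {w : ℕ → ℝ} (hw : ∀ i, 0 ≤ w i) :
    ∑ τ, doubleContactWeight σ τ J K w ≤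
      Fintype.card (Equiv.Perm (Fin n)) * (4 * (J.card : ℝ) ^ 4 / (n : ℝ) ^ 2
        * (K + smallPoints σ (2 * K))
        * (∑ y, w (minimalPeriod σ y) + ∑ i ∈ Finset.Icc 1 K, w i)) := by
  set N : ℝ := ((Fintype.card (Equiv.Perm (Fin n)) : ℕ) : ℝ) with hN
  set v := smallPoints σ (2 * K) with hv
  set S := ∑ y, w (minimalPeriod σ y) with hS
  set U := ∑ i ∈ Finset.Icc 1 K, w i with hU
  have hN0 : 0 ≤ N := Nat.cast_nonneg _
  have hv0 : 0 ≤ v := smallPoints_nonneg _ _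
  have hS0 : 0 ≤ S := Finset.sum_nonneg fun y _ => hw _
  have hU0 : 0 ≤ U := Finset.sum_nonneg fun i _ => hw _
  have hn0 : (0 : ℝ) ≤ n := Nat.cast_nonneg _
  have hone : ∀ i : ℕ, (0 : ℝ) ≤ (fun _ => (1 : ℝ)) i := fun _ => zero_le_one
  have hK1 : ∑ i ∈ Finset.Icc 1 K, (fun _ : ℕ => (1 : ℝ)) i = K := by simp
  have hsum1 : ∑ _τ : Equiv.Perm (Fin n), (1 : ℝ) = N := by simp [hN]
  have hind : ∀ y : Fin n, (0 : ℝ) ≤ if minimalPeriod σ y ≤ 2 * K then 1 else 0 := fun y => by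
    split_ifs <;> norm_num
  have hSj : ∀ j ∈ J, ∑ τ : Equiv.Perm (Fin n), w (minimalPeriod σ (τ j)) ≤ 2 / n * S * N := by
    intro j hj
    have := sum_mul_apply_le hJ hj (φ := fun _ => 1) (fun _ => zero_le_one) (indepOf_const _)
      (u := fun y => w (minimalPeriod σ y)) fun z => hw _
    rw [hsum1] at this
    simpa using this
  have hvj : ∀ j ∈ J, ∑ τ : Equiv.Perm (Fin n),
      (if minimalPeriod σ (τ j) ≤ 2 * K then (1 : ℝ) else 0) ≤ 2 / n * v * N := by
    intro j hj
    have := sum_mul_apply_le hJ hj (φ := fun _ => 1) (fun _ => zero_le_one) (indepOf_const _)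
      (u := fun y => if minimalPeriod σ y ≤ 2 * K then (1 : ℝ) else 0) hind
    rw [hsum1] at this
    simp only [one_mul] at this
    exact this
  have hUj : ∀ j ∈ J, ∀ b ∈ J, j ≠ b → ∑ τ : Equiv.Perm (Fin n), pairWeight σ τ K w j b
      ≤ 2 / n * U * N := by
    intro j hj b hb hjb
    have := sum_mul_pairWeight_right_le hJ σ K hw hj hb hjb (φ := fun _ => 1)
      (fun _ => zero_le_one) (indepOf_const _)
    rw [hsum1] at this
    simpa using this
  set B : ℝ := 4 / (n : ℝ) ^ 2 * N with hB
  have hB0 : 0 ≤ B := by positivity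
  have hA : ∀ j ∈ J, ∑ τ, w (minimalPeriod σ (τ j)) * otherContacts σ τ J K j
      ≤ (J.card * v + J.card ^ 2 * K) * S * B := by
    intro j hj
    have e : ∀ τ, w (minimalPeriod σ (τ j)) * otherContacts σ τ J K j =
        ∑ m ∈ J.erase j, w (minimalPeriod σ (τ j)) *
            (if minimalPeriod σ (τ m) ≤ 2 * K then 1 else 0) +
          ∑ a ∈ J, ∑ b ∈ J.erase a, w (minimalPeriod σ (τ j)) *
            pairWeight σ τ K (fun _ => 1) a b := by
      intro τ
      simp only [otherContacts, mul_add, Finset.mul_sum]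
    simp only [e]
    rw [Finset.sum_add_distrib, Finset.sum_comm, Finset.sum_comm (s := Finset.univ) (t := J)]
    have h1 : ∀ m ∈ J.erase j, ∑ τ : Equiv.Perm (Fin n), w (minimalPeriod σ (τ j)) *
            (if minimalPeriod σ (τ m) ≤ 2 * K then 1 else 0) ≤ v * S * B := by
      intro m hm
      obtain ⟨hmj, hm⟩ := Finset.mem_erase.1 hm
      refine (sum_mul_apply_le hJ hm (φ := fun τ => w (minimalPeriod σ (τ j))) (fun _ => hw _)
        (indepOf_comp_apply hj hmj.symm fun y => w (minimalPeriod σ y))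
        (u := fun y => if minimalPeriod σ y ≤ 2 * K then (1 : ℝ) else 0) hind).trans ?_
      calc _ ≤ 2 / n * v * (2 / n * S * N) :=
            mul_le_mul_of_nonneg_left (hSj j hj) (by positivity)
        _ = _ := by rw [hB]; ring
    have h2 : ∀ a ∈ J, ∑ τ : Equiv.Perm (Fin n), ∑ b ∈ J.erase a, w (minimalPeriod σ (τ j)) *
            pairWeight σ τ K (fun _ => 1) a b ≤ J.card * (K * S * B) := by
      intro a ha
      rw [Finset.sum_comm]
      calc _ ≤ ∑ b ∈ J.erase a, (K * S * B) := by
            refine Finset.sum_le_sum fun b hb => ?_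
            obtain ⟨hba, hb⟩ := Finset.mem_erase.1 hb
            have hfin : 2 / n * K * ∑ τ : Equiv.Perm (Fin n), w (minimalPeriod σ (τ j))
                ≤ K * S * B := by
              calc _ ≤ 2 / n * K * (2 / n * S * N) :=
                    mul_le_mul_of_nonneg_left (hSj j hj) (by positivity)
                _ = _ := by rw [hB]; ring
            -- The endpoint to be resampled must differ from `j`, on which the first factor depends;
            -- since `a ≠ b`, one of the two endpoints qualifies.
            by_cases hbj : b = j
            · have := sum_mul_pairWeight_left_le hJ σ K hone ha hb hba.symm
                (φ := fun τ => w (minimalPeriod σ (τ j))) (fun _ => hw _)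
                (indepOf_comp_apply hj (hbj ▸ hba) fun y => w (minimalPeriod σ y))
              rw [hK1] at this
              exact this.trans hfin
            · have := sum_mul_pairWeight_right_le hJ σ K hone ha hb hba.symm
                (φ := fun τ => w (minimalPeriod σ (τ j))) (fun _ => hw _)
                (indepOf_comp_apply hj (Ne.symm hbj) fun y => w (minimalPeriod σ y))
              rw [hK1] at this
              exact this.trans hfin
        _ ≤ _ := by
            rw [Finset.sum_const, nsmul_eq_mul]
            have : ((J.erase a).card : ℝ) ≤ J.card := by
              exact_mod_cast Finset.card_le_card (Finset.erase_subset _ _)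
            gcongr
    calc _ ≤ ∑ m ∈ J.erase j, v * S * B + ∑ a ∈ J, J.card * (K * S * B) :=
          add_le_add (Finset.sum_le_sum h1) (Finset.sum_le_sum h2)
      _ ≤ J.card * (v * S * B) + J.card * (J.card * (K * S * B)) := by
          rw [Finset.sum_const, Finset.sum_const, nsmul_eq_mul, nsmul_eq_mul]
          have : ((J.erase j).card : ℝ) ≤ J.card := by
            exact_mod_cast Finset.card_le_card (Finset.erase_subset _ _)
          gcongr
      _ = _ := by ring
  have hP : ∀ j ∈ J, ∀ b ∈ J.erase j,
      ∑ τ, pairWeight σ τ K w j b * otherContactsPair σ τ J K j b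
      ≤ (J.card * v + J.card ^ 2 * K) * U * B := by
    intro j hj b hbe
    obtain ⟨hbj, hb⟩ := Finset.mem_erase.1 hbe
    clear hbe
    have hpw : ∀ τ, 0 ≤ pairWeight σ τ K w j b := fun τ => pairWeight_nonneg σ τ K hw _ _
    have e : ∀ τ, pairWeight σ τ K w j b * otherContactsPair σ τ J K j b =
        ∑ m ∈ J, pairWeight σ τ K w j b *
            (if minimalPeriod σ (τ m) ≤ 2 * K then if m = b then 0 else 1 else 0) +
          ∑ a ∈ J, ∑ c ∈ J.erase a, pairWeight σ τ K w j b *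
            (if (a = j ∧ c = b) ∨ (a = b ∧ c = j) then 0
              else pairWeight σ τ K (fun _ => 1) a c) := by
      intro τ
      simp only [otherContactsPair, mul_add, Finset.mul_sum]
    simp only [e]
    rw [Finset.sum_add_distrib, Finset.sum_comm, Finset.sum_comm (s := Finset.univ) (t := J)]
    have h1 : ∀ m ∈ J, ∑ τ : Equiv.Perm (Fin n), pairWeight σ τ K w j b *
            (if minimalPeriod σ (τ m) ≤ 2 * K then if m = b then 0 else 1 else 0)
            ≤ v * U * B := by
      intro m hm
      by_cases hmb : m = b
      · simp only [hmb, if_true, ite_self, mul_zero, Finset.sum_const_zero]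
        positivity
      simp only [hmb, if_false]
      -- The period of `τ j` and the arc from `τ j` share a point. Here the arc is made the
      -- resampled factor, through its free end `τ b`; any other `m` can be resampled itself.
      by_cases hmj : m = j
      · subst hmj
        have := sum_mul_pairWeight_right_le hJ σ K hw hj hb hbj.symm
          (φ := fun τ => if minimalPeriod σ (τ m) ≤ 2 * K then (1 : ℝ) else 0) (fun _ => hind _)
          (indepOf_comp_apply hj hmb fun y => if minimalPeriod σ y ≤ 2 * K then (1 : ℝ) else 0)
        simp only [mul_comm (pairWeight σ _ K w m b)]
        refine this.trans ?_
        calc _ ≤ 2 / n * U * (2 / n * v * N) :=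
              mul_le_mul_of_nonneg_left (hvj m hm) (by positivity)
          _ = _ := by rw [hB]; ring
      · refine (sum_mul_apply_le hJ hm (φ := fun τ => pairWeight σ τ K w j b) hpw
          (indepOf_pairWeight hj (Ne.symm hmj) hb (Ne.symm hmb) σ K w)
          (u := fun y => if minimalPeriod σ y ≤ 2 * K then (1 : ℝ) else 0) hind).trans ?_
        calc _ ≤ 2 / n * v * (2 / n * U * N) :=
              mul_le_mul_of_nonneg_left (hUj j hj b hb hbj.symm) (by positivity)
          _ = _ := by rw [hB]; ring
    have h2 : ∀ a ∈ J, ∑ τ : Equiv.Perm (Fin n), ∑ c ∈ J.erase a, pairWeight σ τ K w j b *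
            (if (a = j ∧ c = b) ∨ (a = b ∧ c = j) then 0
              else pairWeight σ τ K (fun _ => 1) a c) ≤ J.card * (K * U * B) := by
      intro a ha
      rw [Finset.sum_comm]
      calc _ ≤ ∑ c ∈ J.erase a, (K * U * B) := by
            refine Finset.sum_le_sum fun c hc => ?_
            obtain ⟨hca, hc⟩ := Finset.mem_erase.1 hc
            by_cases hsame : (a = j ∧ c = b) ∨ (a = b ∧ c = j)
            · simp only [hsame, if_true, mul_zero, Finset.sum_const_zero]
              positivity
            simp only [hsame, if_false]
            have hfin : 2 / n * K * ∑ τ : Equiv.Perm (Fin n), pairWeight σ τ K w j b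
                ≤ K * U * B := by
              calc _ ≤ 2 / n * K * (2 / n * U * N) :=
                    mul_le_mul_of_nonneg_left (hUj j hj b hb hbj.symm) (by positivity)
                _ = _ := by rw [hB]; ring
            -- Resample `c` if it is neither `j` nor `b`. Otherwise `a` is free, because `{a, c} =
            -- {j, b}` has been excluded.
            by_cases hcjb : c = j ∨ c = b
            · have haj : j ≠ a ∧ b ≠ a := by
                constructor
                · rintro rfl
                  rcases hcjb with rfl | rfl
                  · exact hca rfl
                  · exact hsame (Or.inl ⟨rfl, rfl⟩)
                · rintro rfl
                  rcases hcjb with rfl | rfl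
                  · exact hsame (Or.inr ⟨rfl, rfl⟩)
                  · exact hca rfl
              have := sum_mul_pairWeight_left_le hJ σ K hone ha hc hca.symm
                (φ := fun τ => pairWeight σ τ K w j b) hpw
                (indepOf_pairWeight hj haj.1 hb haj.2 σ K w)
              rw [hK1] at this
              exact this.trans hfin
            · push Not at hcjb
              have := sum_mul_pairWeight_right_le hJ σ K hone ha hc hca.symm
                (φ := fun τ => pairWeight σ τ K w j b) hpw
                (indepOf_pairWeight hj hcjb.1.symm hb hcjb.2.symm σ K w)
              rw [hK1] at this
              exact this.trans hfin
        _ ≤ _ := by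
            rw [Finset.sum_const, nsmul_eq_mul]
            have : ((J.erase a).card : ℝ) ≤ J.card := by
              exact_mod_cast Finset.card_le_card (Finset.erase_subset _ _)
            gcongr
    calc _ ≤ ∑ m ∈ J, v * U * B + ∑ a ∈ J, J.card * (K * U * B) :=
          add_le_add (Finset.sum_le_sum h1) (Finset.sum_le_sum h2)
      _ = _ := by
          rw [Finset.sum_const, Finset.sum_const, nsmul_eq_mul, nsmul_eq_mul]
          ring
  simp only [doubleContactWeight]
  rw [Finset.sum_add_distrib, Finset.sum_comm, Finset.sum_comm (s := Finset.univ) (t := J)]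
  have hP' : ∀ j ∈ J, ∑ τ, ∑ b ∈ J.erase j,
      pairWeight σ τ K w j b * otherContactsPair σ τ J K j b
      ≤ J.card * ((J.card * v + J.card ^ 2 * K) * U * B) := by
    intro j hj
    rw [Finset.sum_comm]
    refine (Finset.sum_le_sum (hP j hj)).trans ?_
    rw [Finset.sum_const, nsmul_eq_mul]
    have : ((J.erase j).card : ℝ) ≤ J.card := by
      exact_mod_cast Finset.card_le_card (Finset.erase_subset _ _)
    gcongr
  refine (add_le_add (Finset.sum_le_sum hA) (Finset.sum_le_sum hP')).trans ?_
  rw [Finset.sum_const, Finset.sum_const, nsmul_eq_mul, nsmul_eq_mul]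
  rcases Nat.eq_zero_or_pos J.card with h0 | h0
  · rw [h0]; simp
  have hJ1 : (1 : ℝ) ≤ J.card := by exact_mod_cast h0
  set q : ℝ := ((J.card : ℕ) : ℝ) with hq
  have hK0 : (0 : ℝ) ≤ K := Nat.cast_nonneg _
  have h23 : q ^ 2 ≤ q ^ 4 := pow_le_pow_right₀ hJ1 (by norm_num)
  have h34 : q ^ 3 ≤ q ^ 4 := pow_le_pow_right₀ hJ1 (by norm_num)
  calc q * ((q * v + q ^ 2 * K) * S * B) + q * (q * ((q * v + q ^ 2 * K) * U * B))
      = (q ^ 2 * (v * S * B) + q ^ 3 * (K * S * B)) + (q ^ 3 * (v * U * B) + q ^ 4 * (K * U * B)) := by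
        ring
    _ ≤ (q ^ 4 * (v * S * B) + q ^ 4 * (K * S * B))
          + (q ^ 4 * (v * U * B) + q ^ 4 * (K * U * B)) := by gcongr
    _ = _ := by rw [hB]; ring

/-- If `τ a` is on a long cycle then `σ^[i] (τ a) ≠ τ a`, so this point is equally likely to be the
image of each of the `n - 1` other indices. Hence the exact probability `(n - smallPoints σ (2 * K))
/ (n * (n - 1))`. -/
theorem sum_firstOrder_pair {σ : Equiv.Perm (Fin n)} {K i : ℕ} (hi1 : 1 ≤ i) (hiK : i ≤ K)
    {a b : Fin n} (hab : a ≠ b) (d : ℝ) :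
    (n : ℝ) * (n - 1) * ∑ τ : Equiv.Perm (Fin n),
      (if 2 * K < minimalPeriod σ (τ a) ∧ σ^[i] (τ a) = τ b then d else 0)
      = Fintype.card (Equiv.Perm (Fin n)) * ((n - smallPoints σ (2 * K)) * d) := by
  have h1 : ∀ y ∈ Finset.univ.erase a, ∑ τ : Equiv.Perm (Fin n),
      (if 2 * K < minimalPeriod σ (τ a) ∧ σ^[i] (τ a) = τ y then d else 0)
      = ∑ τ : Equiv.Perm (Fin n),
      (if 2 * K < minimalPeriod σ (τ a) ∧ σ^[i] (τ a) = τ b then d else 0) := by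
    intro y hy
    rw [← sum_perm_mul_right (Equiv.swap b y) fun τ =>
      (if 2 * K < minimalPeriod σ (τ a) ∧ σ^[i] (τ a) = τ b then d else 0)]
    have : Equiv.swap b y a = a :=
      Equiv.swap_apply_of_ne_of_ne hab (Finset.ne_of_mem_erase hy).symm
    simp [this]
  have h2 : ((n : ℝ) - 1) * ∑ τ : Equiv.Perm (Fin n),
      (if 2 * K < minimalPeriod σ (τ a) ∧ σ^[i] (τ a) = τ b then d else 0)
      = ∑ τ : Equiv.Perm (Fin n), if 2 * K < minimalPeriod σ (τ a) then d else 0 := by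
    have hc : ((n : ℝ) - 1) = ((Finset.univ.erase a).card : ℝ) := by
      rw [Finset.card_erase_of_mem (Finset.mem_univ _), Finset.card_univ, Fintype.card_fin,
        Nat.cast_sub (by have := a.pos; omega), Nat.cast_one]
    rw [hc, ← nsmul_eq_mul, ← Finset.sum_const, ← Finset.sum_congr rfl h1, Finset.sum_comm]
    refine Finset.sum_congr rfl fun τ _ => ?_
    by_cases hbig : 2 * K < minimalPeriod σ (τ a)
    · simp only [hbig, true_and, if_true]
      have hmem : τ⁻¹ (σ^[i] (τ a)) ∈ Finset.univ.erase a := by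
        refine Finset.mem_erase.2 ⟨fun h => ?_, Finset.mem_univ _⟩
        have h3 : σ^[i] (τ a) = τ a := by
          simpa using congrArg τ h
        have h4 : minimalPeriod σ (τ a) ≤ i := IsPeriodicPt.minimalPeriod_le hi1 h3
        omega
      rw [Finset.sum_eq_single_of_mem _ hmem, if_pos (by simp)]
      intro y _ hy
      refine if_neg fun h => hy ?_
      rw [h]; simp
    · simp [hbig]
  rw [mul_assoc, h2, sum_perm_apply a fun y => if 2 * K < minimalPeriod σ y then d else 0]
  congr 1
  have h3 : ∀ y, (if 2 * K < minimalPeriod σ y then d else 0)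
      = d - (if minimalPeriod σ y ≤ 2 * K then 1 else 0) * d := by
    intro y
    by_cases h : minimalPeriod σ y ≤ 2 * K
    · rw [if_neg (not_lt.2 h), if_pos h]; ring
    · rw [if_pos (not_le.1 h), if_neg h]; ring
  rw [Finset.sum_congr rfl fun y _ => h3 y, Finset.sum_sub_distrib, ← Finset.sum_mul]
  simp [smallPoints, sub_mul]

end Averages

end KCycleWalk

/-! ### One step of the walk against one step of the chain -/

namespace KCycleWalk

open Function

section StepEstimate

variable {n : ℕ}

/-- The probability that a given cycle of size `a` is met by one step of the walk, to first order. -/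
noncomputable def deathRate (k n a : ℕ) : ℝ := min 1 ((k : ℝ) * a / n)

theorem deathRate_nonneg (k n a : ℕ) : 0 ≤ deathRate k n a :=
  le_min zero_le_one (by positivity)

theorem deathRate_le_one (k n a : ℕ) : deathRate k n a ≤ 1 := min_le_left _ _

theorem deathRate_mono (k n : ℕ) : Monotone (deathRate k n) := by
  intro a b hab
  refine min_le_min_left _ ?_
  gcongr

theorem deathRate_eq {k n K a : ℕ} (hn : 0 < n) (hK : k * K ≤ n) (ha : a ≤ K) :
    deathRate k n a = k * a / n := by
  refine min_eq_right ?_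
  rw [div_le_one (by exact_mod_cast hn)]
  exact_mod_cast (Nat.mul_le_mul_left k ha).trans hK

/-- The deaths reproduce the generator exactly. A birth has rate `k * (n - v) / (n * (n - 1))`
instead of `k / n`, where `v` counts the points on cycles of size at most `2 * K`; the second term
is the difference. -/
theorem sum_firstOrder {k : ℕ} {γ : Equiv.Perm (Fin n)} (hγ : γ ∈ kCycles k n) (hn : 2 ≤ n)
    (σ : Equiv.Perm (Fin n)) (K : ℕ) (hK : k * K ≤ n) (g : Multiset ℕ → ℝ) :
    ∑ τ, firstOrder σ τ γ K g = Fintype.card (Equiv.Perm (Fin n)) *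
      (gen (deathRate k n) (k / n) K g (smallParts K σ)
        + k / n * ((1 - smallPoints σ (2 * K)) / (n - 1)) *
          ∑ i ∈ Finset.Icc 1 K, (g (i ::ₘ smallParts K σ) - g (smallParts K σ))) := by
  set N : ℝ := ((Fintype.card (Equiv.Perm (Fin n)) : ℕ) : ℝ) with hN
  set s := smallParts K σ with hs
  have hn0 : (n : ℝ) ≠ 0 := by positivity
  have hn1 : (n : ℝ) - 1 ≠ 0 := by
    have : (2 : ℝ) ≤ n := by exact_mod_cast hn
    linarith
  have h1 : ∀ j, ∑ τ : Equiv.Perm (Fin n), (if minimalPeriod σ (τ j) ≤ K then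
      g (s.erase (minimalPeriod σ (τ j))) - g s else 0)
      = N / n * ∑ y, if minimalPeriod σ y ≤ K then g (s.erase (minimalPeriod σ y)) - g s else 0 := by
    intro j
    have := sum_perm_apply j fun y =>
      if minimalPeriod σ y ≤ K then g (s.erase (minimalPeriod σ y)) - g s else 0
    rw [div_mul_eq_mul_div, eq_div_iff hn0, mul_comm, this]
  have h2 : ∀ j ∈ γ.support, ∀ i ∈ Finset.Icc 1 K, ∑ τ : Equiv.Perm (Fin n),
      (if 2 * K < minimalPeriod σ (τ (γ j)) ∧ σ^[i] (τ (γ j)) = τ j then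
          g (i ::ₘ s) - g s else 0)
      = N / (n * (n - 1)) * (n - smallPoints σ (2 * K)) * (g (i ::ₘ s) - g s) := by
    intro j hj i hi
    rw [Finset.mem_Icc] at hi
    have := sum_firstOrder_pair (σ := σ) hi.1 hi.2 (Equiv.Perm.mem_support.1 hj) (g (i ::ₘ s) - g s)
    rw [div_mul_eq_mul_div, div_mul_eq_mul_div, eq_div_iff (mul_ne_zero hn0 hn1), mul_comm, this]
    ring
  have h3 : (s.map fun a => deathRate k n a * (g (s.erase a) - g s)).sum
      = k / n * ∑ y, if minimalPeriod σ y ≤ K then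
          g (s.erase (minimalPeriod σ y)) - g s else 0 := by
    rw [← sum_map_smallParts K σ fun a => g (s.erase a) - g s, ← Multiset.sum_map_mul_left]
    congr 1
    refine Multiset.map_congr rfl fun a ha => ?_
    rw [deathRate_eq (by omega) hK (le_of_mem_smallParts ha)]
    ring
  simp only [firstOrder]
  rw [Finset.sum_comm]
  simp only [Finset.sum_add_distrib]
  rw [Finset.sum_congr rfl fun j _ => h1 j, Finset.sum_const, hγ.2, nsmul_eq_mul]
  have h4 : ∑ j ∈ γ.support, ∑ τ : Equiv.Perm (Fin n), ∑ i ∈ Finset.Icc 1 K,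
      (if 2 * K < minimalPeriod σ (τ (γ j)) ∧ σ^[i] (τ (γ j)) = τ j then
          g (i ::ₘ s) - g s else 0)
      = k * (N / (n * (n - 1)) * (n - smallPoints σ (2 * K)) *
        ∑ i ∈ Finset.Icc 1 K, (g (i ::ₘ s) - g s)) := by
    rw [← hγ.2, ← nsmul_eq_mul, ← Finset.sum_const]
    refine Finset.sum_congr rfl fun j hj => ?_
    rw [Finset.sum_comm, Finset.sum_congr rfl (h2 j hj), Finset.mul_sum]
  rw [h4, gen, h3, ← Finset.mul_sum]
  field_simp
  ring

/-- The one-step transition of the walk acts on Lipschitz functions of the small cycles like the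
comparison chain, up to second order terms. -/
theorem abs_avg_sub_step_le {k : ℕ} (hk : 2 ≤ k) {γ : Equiv.Perm (Fin n)} (hγ : γ ∈ kCycles k n)
    (hn : 2 * k ≤ n) (σ : Equiv.Perm (Fin n)) {K : ℕ} (hK : k * K ≤ n)
    {w : ℕ → ℝ} {g : Multiset ℕ → ℝ} (hg : IsLip w g)
    (hanti : Antitone w) (hwK : ∀ a, K < a → w a = 0) :
    |(∑ τ, g (smallParts K (σ * (τ * γ * τ⁻¹)))) / Fintype.card (Equiv.Perm (Fin n))
        - step (deathRate k n) (k / n) K g (smallParts K σ)|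
      ≤ 16 * (k : ℝ) ^ 4 / (n : ℝ) ^ 2 * (K + smallPoints σ (2 * K) + 1)
        * (∑ y, w (minimalPeriod σ y) + ∑ i ∈ Finset.Icc 1 K, w i) := by
  have hw : ∀ b, 0 ≤ w b := fun b => (abs_nonneg _).trans (hg b 0)
  set N : ℝ := ((Fintype.card (Equiv.Perm (Fin n)) : ℕ) : ℝ) with hN
  set s := smallParts K σ with hs
  set v := smallPoints σ (2 * K) with hv
  set S := ∑ y, w (minimalPeriod σ y) with hS
  set U := ∑ i ∈ Finset.Icc 1 K, w i with hU
  have hN0 : 0 < N := by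
    rw [hN]; exact_mod_cast Fintype.card_pos
  have hv0 : 0 ≤ v := smallPoints_nonneg _ _
  have hS0 : 0 ≤ S := Finset.sum_nonneg fun y _ => hw _
  have hU0 : 0 ≤ U := Finset.sum_nonneg fun i _ => hw _
  have hK0 : (0 : ℝ) ≤ K := Nat.cast_nonneg _
  have hn4 : (4 : ℝ) ≤ n := by exact_mod_cast (by omega : 4 ≤ n)
  have hk2 : (2 : ℝ) ≤ k := by exact_mod_cast hk
  have hkn : (k : ℝ) ≤ n := by exact_mod_cast (by omega : k ≤ n)
  -- the expansion of the walk
  have h1 : ∀ τ : Equiv.Perm (Fin n),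
      |g (smallParts K (σ * (τ * γ * τ⁻¹))) - g s - firstOrder σ τ γ K g|
        ≤ 3 * doubleContactWeight σ τ γ.support K w := fun τ =>
    abs_step_change_sub_firstOrder_le (fun j => by simp) hg hanti hwK
  have h2 : |∑ τ, (g (smallParts K (σ * (τ * γ * τ⁻¹))) - g s - firstOrder σ τ γ K g)|
      ≤ 3 * (N * (4 * (k : ℝ) ^ 4 / (n : ℝ) ^ 2 * (K + v) * (S + U))) := by
    refine (Finset.abs_sum_le_sum_abs _ _).trans ((Finset.sum_le_sum fun τ _ => h1 τ).trans ?_)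
    rw [← Finset.mul_sum]
    have := sum_doubleContactWeight_le (J := γ.support) (by rw [hγ.2]; exact hn) σ K hw
    rw [hγ.2] at this
    exact mul_le_mul_of_nonneg_left this (by norm_num)
  rw [Finset.sum_sub_distrib, Finset.sum_sub_distrib, sum_firstOrder hγ (by omega) σ K hK g,
    Finset.sum_const, Finset.card_univ, nsmul_eq_mul, ← hN, ← hs, ← hv] at h2
  set D := ∑ i ∈ Finset.Icc 1 K, (g (i ::ₘ s) - g s) with hD
  have hDU : |D| ≤ U := (Finset.abs_sum_le_sum_abs _ _).trans (Finset.sum_le_sum fun i _ => hg i s)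
  set M := ∑ τ : Equiv.Perm (Fin n), g (smallParts K (σ * (τ * γ * τ⁻¹))) with hM
  have h3 : |M / N - g s - gen (deathRate k n) (k / n) K g s
      - k / n * ((1 - v) / (n - 1)) * D|
      ≤ 12 * (k : ℝ) ^ 4 / (n : ℝ) ^ 2 * (K + v) * (S + U) := by
    have e : M / N - g s - gen (deathRate k n) (k / n) K g s - k / n * ((1 - v) / (n - 1)) * D
        = (M - N * g s - N * (gen (deathRate k n) (k / n) K g s
            + k / n * ((1 - v) / (n - 1)) * D)) / N := by
      field_simp
      ring
    rw [e, abs_div, abs_of_pos hN0, div_le_iff₀ hN0]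
    refine h2.trans_eq ?_
    ring
  have h4 : |k / n * ((1 - v) / (n - 1)) * D| ≤ 2 * k / (n : ℝ) ^ 2 * (v + 1) * U := by
    rw [abs_mul, abs_mul, abs_div, abs_div, abs_of_nonneg (by linarith : (0 : ℝ) ≤ k),
      abs_of_nonneg (by linarith : (0 : ℝ) ≤ n), abs_of_nonneg (by linarith : (0 : ℝ) ≤ n - 1)]
    have h5 : |1 - v| ≤ v + 1 := by rw [abs_le]; constructor <;> linarith
    have h6 : |1 - v| / ((n : ℝ) - 1) ≤ (v + 1) / (n / 2) := by
      gcongr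
      linarith
    calc (k : ℝ) / n * (|1 - v| / ((n : ℝ) - 1)) * |D| ≤ k / n * ((v + 1) / (n / 2)) * U := by
          gcongr
      _ = _ := by field_simp
  -- the expansion of the comparison chain
  have h7 := abs_step_sub_gen_le (deathRate_nonneg k n) (deathRate_le_one k n)
    (c := (k : ℝ) / n) (by positivity) (div_le_one_of_le₀ hkn (by linarith)) K hg s
  have h8 : (s.map fun a => deathRate k n a * w a).sum = k / n * S := by
    have e := sum_map_smallParts K σ w
    have e2 : ∑ y, (if minimalPeriod σ y ≤ K then w (minimalPeriod σ y) else 0) = S := by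
      refine Finset.sum_congr rfl fun y _ => ?_
      split_ifs with h
      · rfl
      · exact (hwK _ (not_le.1 h)).symm
    rw [← e2, ← e, ← Multiset.sum_map_mul_left]
    congr 1
    refine Multiset.map_congr rfl fun a ha => ?_
    rw [deathRate_eq (by omega) hK (le_of_mem_smallParts ha)]
    ring
  have h9 : (s.map (deathRate k n)).sum ≤ k / n * v := by
    have e := sum_map_smallParts K σ fun _ => 1
    have e2 : (s.map (deathRate k n)).sum = k / n * smallPoints σ K := by
      rw [smallPoints, ← e, ← Multiset.sum_map_mul_left]
      congr 1
      refine Multiset.map_congr rfl fun a ha => ?_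
      rw [deathRate_eq (by omega) hK (le_of_mem_smallParts ha)]
      ring
    rw [e2]
    exact mul_le_mul_of_nonneg_left (smallPoints_mono σ (by omega)) (by positivity)
  rw [h8, ← Finset.mul_sum, ← hU] at h7
  have h10 : 2 * ((k : ℝ) / n * S + k / n * U) * ((s.map (deathRate k n)).sum + k / n * K)
      ≤ 2 * (k : ℝ) ^ 2 / (n : ℝ) ^ 2 * (K + v) * (S + U) := by
    calc _ ≤ 2 * ((k : ℝ) / n * S + k / n * U) * (k / n * v + k / n * K) := by gcongr
      _ = _ := by field_simp; ring
  set X : ℝ := 1 / (n : ℝ) ^ 2 * (K + v + 1) * (S + U) with hX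
  have hX0 : 0 ≤ X := by positivity
  have hk14 : (k : ℝ) ≤ (k : ℝ) ^ 4 := le_self_pow₀ (by linarith) (by norm_num)
  have hk24 : (k : ℝ) ^ 2 ≤ (k : ℝ) ^ 4 := pow_le_pow_right₀ (by linarith) (by norm_num)
  have b3 : 12 * (k : ℝ) ^ 4 / (n : ℝ) ^ 2 * (K + v) * (S + U) ≤ 12 * (k : ℝ) ^ 4 * X := by
    have : (K + v) * (S + U) ≤ (K + v + 1) * (S + U) :=
      mul_le_mul_of_nonneg_right (by linarith) (by positivity)
    calc _ = 12 * (k : ℝ) ^ 4 * (1 / (n : ℝ) ^ 2) * ((K + v) * (S + U)) := by ring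
      _ ≤ 12 * (k : ℝ) ^ 4 * (1 / (n : ℝ) ^ 2) * ((K + v + 1) * (S + U)) := by gcongr
      _ = _ := by rw [hX]; ring
  have b4 : 2 * k / (n : ℝ) ^ 2 * (v + 1) * U ≤ 2 * (k : ℝ) ^ 4 * X := by
    have : (v + 1) * U ≤ (K + v + 1) * (S + U) := by
      gcongr <;> linarith
    calc _ = 2 * (k : ℝ) * (1 / (n : ℝ) ^ 2) * ((v + 1) * U) := by ring
      _ ≤ 2 * (k : ℝ) ^ 4 * (1 / (n : ℝ) ^ 2) * ((K + v + 1) * (S + U)) := by gcongr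
      _ = _ := by rw [hX]; ring
  have b10 : 2 * (k : ℝ) ^ 2 / (n : ℝ) ^ 2 * (K + v) * (S + U) ≤ 2 * (k : ℝ) ^ 4 * X := by
    have : (K + v) * (S + U) ≤ (K + v + 1) * (S + U) :=
      mul_le_mul_of_nonneg_right (by linarith) (by positivity)
    calc _ = 2 * (k : ℝ) ^ 2 * (1 / (n : ℝ) ^ 2) * ((K + v) * (S + U)) := by ring
      _ ≤ 2 * (k : ℝ) ^ 4 * (1 / (n : ℝ) ^ 2) * ((K + v + 1) * (S + U)) := by gcongr
      _ = _ := by rw [hX]; ring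
  -- `16 = 12 + 2 + 2`: double contacts of the walk, the corrected birth rate, and the expansion of
  -- the chain.
  have hfin : 16 * (k : ℝ) ^ 4 / (n : ℝ) ^ 2 * (K + v + 1) * (S + U) = 16 * (k : ℝ) ^ 4 * X := by
    rw [hX]; ring
  rw [hfin]
  have h3' := h3.trans b3
  have h4' := h4.trans b4
  have h7' := h7.trans (h10.trans b10)
  rw [abs_le] at *
  constructor <;> linarith [h3'.1, h3'.2, h4'.1, h4'.2, h7'.1, h7'.2]

end StepEstimate

end KCycleWalk

/-! ### Poisson vector: Chen–Stein identity, near-invariance, convergence of the chain -/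

namespace KCycleWalk

section Poisson

variable {K : ℕ}

instance instIsProbabilityMeasurePoissonVectorLaw (K : ℕ) :
    IsProbabilityMeasure (poissonVectorLaw K) := by
  unfold poissonVectorLaw; infer_instance

theorem poissonMeasure_singleton_succ (r : ℝ≥0) (m : ℕ) :
    ((m + 1 : ℕ) : ℝ≥0∞) * poissonMeasure r {m + 1} = r * poissonMeasure r {m} := by
  rw [poissonMeasure_singleton, poissonMeasure_singleton, ← ENNReal.ofReal_natCast,
    ← ENNReal.ofReal_coe_nnreal, ← ENNReal.ofReal_mul (by positivity),
    ← ENNReal.ofReal_mul (by positivity)]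
  congr 1
  rw [Nat.factorial_succ, pow_succ]
  push_cast
  field_simp

theorem poissonVectorLaw_singleton_add (z : Fin K → ℕ) (i : Fin K) :
    ((z i + 1 : ℕ) : ℝ≥0∞) * poissonVectorLaw K {z + Pi.single i 1}
      = (1 / ((i : ℝ≥0) + 1) : ℝ≥0) * poissonVectorLaw K {z} := by
  rw [poissonVectorLaw, Measure.pi_singleton, Measure.pi_singleton,
    ← Finset.mul_prod_erase Finset.univ _ (Finset.mem_univ i),
    ← Finset.mul_prod_erase Finset.univ (fun j => poissonMeasure _ {z j}) (Finset.mem_univ i),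
    ← mul_assoc, ← mul_assoc]
  congr 1
  · simp only [Pi.add_apply, Pi.single_eq_same]
    exact poissonMeasure_singleton_succ _ _
  · refine Finset.prod_congr rfl fun j hj => ?_
    simp [Pi.single_eq_of_ne (Finset.ne_of_mem_erase hj)]

theorem add_single_injective (i : Fin K) :
    Function.Injective fun z : Fin K → ℕ => z + Pi.single i 1 := fun _ _ h => by simpa using h

theorem mem_range_add_single {i : Fin K} {z : Fin K → ℕ} (h : z i ≠ 0) :
    z ∈ Set.range fun z : Fin K → ℕ => z + Pi.single i 1 := by
  refine ⟨z - Pi.single i 1, ?_⟩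
  ext j
  by_cases hj : j = i
  · subst hj; simp; omega
  · simp [Pi.single_eq_of_ne hj]

/-- The Chen–Stein identity for a vector of independent Poisson variables. -/
theorem lintegral_chen_stein (i : Fin K) (h : (Fin K → ℕ) → ℝ≥0∞) :
    ∫⁻ z, (z i : ℝ≥0∞) * h z ∂poissonVectorLaw K
      = (1 / ((i : ℝ≥0) + 1) : ℝ≥0) * ∫⁻ z, h (z + Pi.single i 1) ∂poissonVectorLaw K := by
  rw [lintegral_countable', lintegral_countable', ← ENNReal.tsum_mul_left,
    ← (add_single_injective i).tsum_eq]
  · refine tsum_congr fun z => ?_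
    have := poissonVectorLaw_singleton_add z i
    simp only [Pi.add_apply, Pi.single_eq_same]
    rw [mul_right_comm, this]
    ring
  · intro z hz
    refine mem_range_add_single fun h0 => hz ?_
    simp [h0]

theorem chen_stein (i : Fin K) {h : (Fin K → ℕ) → ℝ}
    (hh : Integrable (fun z => h (z + Pi.single i 1)) (poissonVectorLaw K)) :
    Integrable (fun z => (z i : ℝ) * h z) (poissonVectorLaw K) ∧
      ∫ z, (z i : ℝ) * h z ∂poissonVectorLaw K
        = 1 / ((i : ℝ) + 1) * ∫ z, h (z + Pi.single i 1) ∂poissonVectorLaw K := by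
  have hint : Integrable (fun z => (z i : ℝ) * h z) (poissonVectorLaw K) := by
    refine ⟨AEStronglyMeasurable.of_discrete, ?_⟩
    have e : ∀ z : Fin K → ℕ, ‖(z i : ℝ) * h z‖ₑ = (z i : ℝ≥0∞) * ‖h z‖ₑ := fun z => by
      rw [enorm_mul]; simp
    rw [HasFiniteIntegral, lintegral_congr e, lintegral_chen_stein i fun z => ‖h z‖ₑ]
    exact ENNReal.mul_lt_top ENNReal.coe_lt_top hh.2
  refine ⟨hint, ?_⟩
  rw [integral_countable hint, integral_countable hh, ← tsum_mul_left,
    ← (add_single_injective i).tsum_eq]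
  · refine tsum_congr fun z => ?_
    have := congrArg ENNReal.toReal (poissonVectorLaw_singleton_add z i)
    rw [ENNReal.toReal_mul, ENNReal.toReal_mul] at this
    simp only [ENNReal.toReal_natCast, ENNReal.coe_toReal] at this
    push_cast at this
    simp only [Pi.add_apply, Pi.single_eq_same, smul_eq_mul, Measure.real]
    push_cast
    linear_combination h (z + Pi.single i 1) * this
  · intro z hz
    refine mem_range_add_single fun h0 => hz ?_
    simp [h0]

/-- The configuration with `z i` particles of size `i + 1`. -/
def config (z : Fin K → ℕ) : Multiset ℕ := ∑ i, Multiset.replicate (z i) ((i : ℕ) + 1)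

theorem config_add_single (z : Fin K → ℕ) (i : Fin K) :
    config (z + Pi.single i 1) = ((i : ℕ) + 1) ::ₘ config z := by
  have e : ∀ j : Fin K, Multiset.replicate ((z + Pi.single i 1 : Fin K → ℕ) j) ((j : ℕ) + 1)
      = Multiset.replicate (z j) ((j : ℕ) + 1) + if j = i then {(i : ℕ) + 1} else 0 := by
    intro j
    by_cases hj : j = i
    · subst hj
      simp only [Pi.add_apply, Pi.single_eq_same, if_true]
      rw [Multiset.replicate_succ, ← Multiset.singleton_add]
      exact add_comm _ _
    · simp [hj]
  rw [config, Finset.sum_congr rfl fun j _ => e j, Finset.sum_add_distrib, Finset.sum_ite_eq']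
  simp only [Finset.mem_univ, if_true]
  rw [add_comm, Multiset.singleton_add, config]

theorem sum_map_config (z : Fin K → ℕ) (u : ℕ → ℝ) :
    ((config z).map u).sum = ∑ i : Fin K, (z i : ℝ) * u (i + 1) := by
  rw [config, ← Multiset.coe_mapAddMonoidHom, map_sum, Multiset.sum_sum]
  simp

theorem count_config (z : Fin K → ℕ) (i : Fin K) : (config z).count ((i : ℕ) + 1) = z i := by
  rw [config, Multiset.count_sum', Finset.sum_eq_single_of_mem i (Finset.mem_univ i)]
  · simp
  · intro j _ hj
    rw [Multiset.count_replicate, if_neg]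
    intro h
    exact hj (Fin.ext (by omega))

theorem sum_Icc_eq_sum_fin (K : ℕ) (F : ℕ → ℝ) :
    ∑ i ∈ Finset.Icc 1 K, F i = ∑ i : Fin K, F (i + 1) := by
  rw [Fin.sum_univ_eq_sum_range fun i => F (i + 1)]
  induction K with
  | zero => simp
  | succ K ih => rw [Finset.sum_Icc_succ_top (by omega), Finset.sum_range_succ, ih]

theorem integrable_of_bounded {B : ℝ} {h : (Fin K → ℕ) → ℝ} (hB : ∀ z, |h z| ≤ B) :
    Integrable h (poissonVectorLaw K) :=
  Integrable.of_bound AEStronglyMeasurable.of_discrete B (ae_of_all _ hB)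

theorem integrable_coord (i : Fin K) :
    Integrable (fun z : Fin K → ℕ => (z i : ℝ)) (poissonVectorLaw K) := by
  simpa using (chen_stein i (h := fun _ => 1) (integrable_const _)).1

theorem integral_coord (i : Fin K) :
    ∫ z, (z i : ℝ) ∂poissonVectorLaw K = 1 / ((i : ℝ) + 1) := by
  simpa using (chen_stein i (h := fun _ => 1) (integrable_const _)).2

/-- The Poisson vector is stationary for the immigration-death generator. -/
theorem integral_gen_eq_zero {p : ℕ → ℝ} {c : ℝ}
    (hpc : ∀ i : Fin K, p (i + 1) = c * ((i : ℝ) + 1)) {B : ℝ} {g : Multiset ℕ → ℝ}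
    (hB : ∀ s, |g s| ≤ B) :
    Integrable (fun z => gen p c K g (config z)) (poissonVectorLaw K) ∧
      ∫ z, gen p c K g (config z) ∂poissonVectorLaw K = 0 := by
  have e : ∀ z : Fin K → ℕ, gen p c K g (config z) =
      ∑ i : Fin K, (c * (g (((i : ℕ) + 1) ::ₘ config z) - g (config z)) +
        (z i : ℝ) * (p (i + 1) * (g ((config z).erase (i + 1)) - g (config z)))) := by
    intro z
    rw [gen, sum_map_config, sum_Icc_eq_sum_fin K fun i => c * (g (i ::ₘ config z) - g (config z)),
      Finset.sum_add_distrib]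
  have hg : ∀ s u, |g s - g u| ≤ 2 * B := fun s u =>
    (abs_sub _ _).trans (by linarith [hB s, hB u])
  have h1 : ∀ i : Fin K, Integrable (fun z : Fin K → ℕ =>
      c * (g (((i : ℕ) + 1) ::ₘ config z) - g (config z))) (poissonVectorLaw K) := fun i =>
    (integrable_of_bounded fun z => hg _ _).const_mul c
  have h2 : ∀ i : Fin K, Integrable (fun z : Fin K → ℕ => (fun z : Fin K → ℕ =>
      p (i + 1) * (g ((config z).erase (i + 1)) - g (config z))) (z + Pi.single i 1))
      (poissonVectorLaw K) := fun i =>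
    (integrable_of_bounded fun z => hg _ _).const_mul _
  -- Chen–Stein turns deaths in size `i + 1` into minus the births: the rate `c * (i + 1)` per
  -- particle cancels the mean `1 / (i + 1)`.
  have h3 := fun i : Fin K => chen_stein i (h := fun z : Fin K → ℕ =>
      p (i + 1) * (g ((config z).erase (i + 1)) - g (config z))) (h2 i)
  simp only [e]
  refine ⟨integrable_finsetSum _ fun i _ => (h1 i).add (h3 i).1, ?_⟩
  have h5 := integral_finsetSum Finset.univ fun i _ => (h1 i).add (h3 i).1
  simp only [Pi.add_apply] at h5
  rw [h5]
  refine Finset.sum_eq_zero fun i _ => ?_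
  rw [integral_add (h1 i) (h3 i).1, (h3 i).2]
  simp only [config_add_single, Multiset.erase_cons_head]
  rw [integral_const_mul, integral_const_mul, hpc i]
  have h4 : ∫ z : Fin K → ℕ, (g (config z) - g (((i : ℕ) + 1) ::ₘ config z)) ∂poissonVectorLaw K
      = - ∫ z : Fin K → ℕ, (g (((i : ℕ) + 1) ::ₘ config z) - g (config z)) ∂poissonVectorLaw K := by
    rw [← integral_neg]
    simp
  rw [h4]
  have : (i : ℝ) + 1 ≠ 0 := by positivity
  field_simp
  ring

/-- Second moments for the quadratic remainder of the chain. Each factor has mean `2`, and the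
variance of `(i + 1) * z i` is `i + 1`. -/
theorem integral_pair (i j : Fin K) :
    Integrable (fun z : Fin K → ℕ => (((i : ℝ) + 1) * z i + 1) * (((j : ℝ) + 1) * z j + 1))
        (poissonVectorLaw K) ∧
      ∫ z : Fin K → ℕ, (((i : ℝ) + 1) * z i + 1) * (((j : ℝ) + 1) * z j + 1) ∂poissonVectorLaw K
        = 4 + if i = j then (i : ℝ) + 1 else 0 := by
  have hb : Integrable (fun z : Fin K → ℕ => ((j : ℝ) + 1) * (z j : ℝ) + 1) (poissonVectorLaw K) :=
    ((integrable_coord j).const_mul _).add (integrable_const _)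
  have hb' : ∫ z : Fin K → ℕ, (((j : ℝ) + 1) * (z j : ℝ) + 1) ∂poissonVectorLaw K = 2 := by
    rw [integral_add ((integrable_coord j).const_mul _) (integrable_const _), integral_const_mul,
      integral_coord]
    have : (j : ℝ) + 1 ≠ 0 := by positivity
    field_simp
    simp; norm_num
  have hs : ∀ z : Fin K → ℕ, ((j : ℝ) + 1) * ((z + Pi.single i 1 : Fin K → ℕ) j : ℝ) + 1
      = (((j : ℝ) + 1) * (z j : ℝ) + 1) + if i = j then (i : ℝ) + 1 else 0 := by
    intro z
    by_cases hij : i = j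
    · subst hij; simp; ring
    · simp [hij]
  have hc := chen_stein i (h := fun z => ((j : ℝ) + 1) * (z j : ℝ) + 1)
    (by simp only [hs]; exact hb.add (integrable_const _))
  simp only [hs] at hc
  rw [integral_add hb (integrable_const _), hb'] at hc
  have e : ∀ z : Fin K → ℕ, (((i : ℝ) + 1) * z i + 1) * (((j : ℝ) + 1) * z j + 1)
      = ((i : ℝ) + 1) * ((z i : ℝ) * (((j : ℝ) + 1) * z j + 1)) + (((j : ℝ) + 1) * z j + 1) :=
    fun z => by ring
  simp only [e]
  refine ⟨(hc.1.const_mul _).add hb, ?_⟩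
  rw [integral_add (hc.1.const_mul _) hb, integral_const_mul, hc.2, hb']
  have : (i : ℝ) + 1 ≠ 0 := by positivity
  field_simp
  simp; ring

/-- The generator integrates to zero, so only the remainder of `abs_step_sub_gen_le` is left. Its
Poisson mean has coefficients `2 * c ^ 2 * (4 * K + i + 1) ≤ 10 * c ^ 2 * K`. -/
theorem abs_integral_step_sub_le {p : ℕ → ℝ} (hp0 : ∀ a, 0 ≤ p a) (hp1 : ∀ a, p a ≤ 1)
    {c : ℝ} (hc0 : 0 ≤ c) (hc1 : c ≤ 1) (hpc : ∀ i : Fin K, p (i + 1) = c * ((i : ℝ) + 1))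
    {B : ℝ} {w : ℕ → ℝ} {g : Multiset ℕ → ℝ} (hB : ∀ s, |g s| ≤ B) (hg : IsLip w g) :
    |∫ z, step p c K g (config z) ∂poissonVectorLaw K - ∫ z, g (config z) ∂poissonVectorLaw K|
      ≤ 10 * c ^ 2 * K * ∑ i ∈ Finset.Icc 1 K, w i := by
  have hw : ∀ b, 0 ≤ w b := fun b => (abs_nonneg _).trans (hg b 0)
  obtain ⟨hgi, hg0⟩ := integral_gen_eq_zero hpc hB
  have i1 : Integrable (fun z : Fin K → ℕ => step p c K g (config z)) (poissonVectorLaw K) :=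
    integrable_of_bounded fun z => abs_step_le hp0 hp1 hc0 hc1 K hB _
  have i2 : Integrable (fun z : Fin K → ℕ => g (config z)) (poissonVectorLaw K) :=
    integrable_of_bounded fun z => hB _
  have i3 := (i1.sub i2).sub hgi
  have e1 : ∫ z, step p c K g (config z) ∂poissonVectorLaw K
      - ∫ z, g (config z) ∂poissonVectorLaw K
      = ∫ z : Fin K → ℕ, (step p c K g (config z) - g (config z) - gen p c K g (config z))
          ∂poissonVectorLaw K := by
    have := integral_sub (i1.sub i2) hgi
    simp only [Pi.sub_apply] at this
    rw [this, integral_sub i1 i2, hg0, sub_zero]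
  have herr : ∀ z : Fin K → ℕ,
      |step p c K g (config z) - g (config z) - gen p c K g (config z)|
      ≤ ∑ i : Fin K, ∑ j : Fin K, 2 * c ^ 2 * w (i + 1) *
          ((((i : ℝ) + 1) * z i + 1) * (((j : ℝ) + 1) * z j + 1)) := by
    intro z
    refine (abs_step_sub_gen_le hp0 hp1 hc0 hc1 K hg (config z)).trans_eq ?_
    rw [sum_map_config, sum_map_config, sum_Icc_eq_sum_fin K fun i => c * w i]
    have e2 : (∑ i : Fin K, (z i : ℝ) * p (i + 1)) + c * K
        = ∑ j : Fin K, c * (((j : ℝ) + 1) * z j + 1) := by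
      have e4 : c * (K : ℝ) = ∑ _j : Fin K, c := by simp [mul_comm]
      rw [e4, ← Finset.sum_add_distrib]
      refine Finset.sum_congr rfl fun j _ => ?_
      rw [hpc]; ring
    have e3 : ((∑ i : Fin K, (z i : ℝ) * (p (i + 1) * w (i + 1))) + ∑ i : Fin K, c * w (i + 1))
        = ∑ i : Fin K, c * w (i + 1) * (((i : ℝ) + 1) * z i + 1) := by
      rw [← Finset.sum_add_distrib]
      refine Finset.sum_congr rfl fun i _ => ?_
      rw [hpc]; ring
    rw [e2, e3, mul_assoc, Finset.sum_mul_sum, Finset.mul_sum]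
    refine Finset.sum_congr rfl fun i _ => ?_
    rw [Finset.mul_sum]
    refine Finset.sum_congr rfl fun j _ => ?_
    ring
  have hint : ∀ i j : Fin K, Integrable (fun z : Fin K → ℕ => 2 * c ^ 2 * w (i + 1) *
          ((((i : ℝ) + 1) * z i + 1) * (((j : ℝ) + 1) * z j + 1))) (poissonVectorLaw K) :=
    fun i j => (integral_pair i j).1.const_mul _
  rw [e1]
  refine (abs_integral_le_integral_abs).trans ((integral_mono i3.abs
    (integrable_finsetSum _ fun i _ => integrable_finsetSum _ fun j _ => hint i j) herr).trans ?_)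
  rw [integral_finsetSum _ fun i _ => integrable_finsetSum _ fun j _ => hint i j,
    sum_Icc_eq_sum_fin, Finset.mul_sum]
  refine Finset.sum_le_sum fun i _ => ?_
  rw [integral_finsetSum _ fun j _ => hint i j]
  simp only [integral_const_mul, (integral_pair i _).2]
  rw [← Finset.mul_sum, Finset.sum_add_distrib, Finset.sum_ite_eq]
  simp only [Finset.sum_const, Finset.card_univ, Fintype.card_fin, nsmul_eq_mul, Finset.mem_univ,
    if_true]
  have hi : (i : ℝ) + 1 ≤ K := by exact_mod_cast i.2
  calc 2 * c ^ 2 * w (i + 1) * (K * 4 + ((i : ℝ) + 1))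
      ≤ 2 * c ^ 2 * w (i + 1) * (K * 4 + K) := by
        have := hw (i + 1)
        gcongr
    _ = _ := by ring

theorem sum_range_pow_le {q : ℝ} (hq0 : 0 < q) (hq1 : q ≤ 1) (m : ℕ) :
    ∑ r ∈ Finset.range m, (1 - q) ^ r ≤ 1 / q := by
  have h := geom_sum_mul (1 - q) m
  rw [le_div_iff₀ hq0]
  have h2 : 0 ≤ (1 - q) ^ m := pow_nonneg (by linarith) m
  linarith

theorem sum_Icc_inv_le (K : ℕ) : ∑ i ∈ Finset.Icc 1 K, 1 / (i : ℝ) ≤ 1 + Real.log K := by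
  have := harmonic_le_one_add_log K
  rw [harmonic_eq_sum_Icc] at this
  push_cast at this
  simpa using this

/-- The weights of the comparison chain, `m` steps before the end: a particle above the level `K`
does not count. -/
noncomputable def weight (p : ℕ → ℝ) (K m a : ℕ) : ℝ := (1 - p a) ^ m * if a ≤ K then 2 else 0

theorem weight_nonneg {p : ℕ → ℝ} (hp1 : ∀ a, p a ≤ 1) (K m a : ℕ) : 0 ≤ weight p K m a :=
  mul_nonneg (pow_nonneg (sub_nonneg.2 (hp1 a)) m) (by split_ifs <;> norm_num)

theorem weight_antitone {p : ℕ → ℝ} (hp1 : ∀ a, p a ≤ 1) (hmono : Monotone p) (K m : ℕ) :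
    Antitone (weight p K m) := by
  intro a b hab
  have h1 : (1 - p b) ^ m ≤ (1 - p a) ^ m :=
    pow_le_pow_left₀ (sub_nonneg.2 (hp1 b)) (by linarith [hmono hab]) m
  have h2 : (if b ≤ K then (2 : ℝ) else 0) ≤ if a ≤ K then 2 else 0 := by
    split_ifs with h3 h4
    · exact le_rfl
    · omega
    · norm_num
    · exact le_rfl
  exact mul_le_mul h1 h2 (by split_ifs <;> norm_num) (pow_nonneg (sub_nonneg.2 (hp1 a)) m)

theorem weight_eq_zero {p : ℕ → ℝ} {K m a : ℕ} (h : K < a) : weight p K m a = 0 := by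
  rw [weight, if_neg (not_le.2 h), mul_zero]

theorem weight_eq {p : ℕ → ℝ} {K m a : ℕ} (h : a ≤ K) : weight p K m a = 2 * (1 - p a) ^ m := by
  rw [weight, if_pos h, mul_comm]

/-- Telescoping over the steps. For each size `i` the weights sum to at most `2 / (c * i)`, which
removes one factor `c` and leaves a harmonic sum; the bound does not depend on `m`. -/
theorem abs_integral_iterate_step_sub_le {p : ℕ → ℝ} (hp0 : ∀ a, 0 ≤ p a) (hp1 : ∀ a, p a ≤ 1)
    {c : ℝ} (hc0 : 0 < c) (hc1 : c ≤ 1) (hpc : ∀ i ∈ Finset.Icc 1 K, p i = c * i)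
    {f : Multiset ℕ → ℝ} (hB : ∀ s, |f s| ≤ 1) (hf : IsLip (weight p K 0) f) (m : ℕ) :
    |∫ z, (step p c K)^[m] f (config z) ∂poissonVectorLaw K
        - ∫ z, f (config z) ∂poissonVectorLaw K|
      ≤ 20 * c * K * (1 + Real.log K) := by
  have hpc' : ∀ i : Fin K, p (i + 1) = c * ((i : ℝ) + 1) := fun i => by
    rw [hpc _ (Finset.mem_Icc.2 ⟨by omega, i.2⟩)]; push_cast; ring
  have hlip : ∀ m, IsLip (weight p K m) ((step p c K)^[m] f) := fun m => by
    have := hf.iterate_step hp0 hp1 hc0.le hc1 K m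
    convert this using 2 with a
    simp [weight]
  have h1 : ∀ m, |∫ z, (step p c K)^[m] f (config z) ∂poissonVectorLaw K
        - ∫ z, f (config z) ∂poissonVectorLaw K|
      ≤ ∑ r ∈ Finset.range m, 10 * c ^ 2 * K * ∑ i ∈ Finset.Icc 1 K, weight p K r i := by
    intro m
    induction m with
    | zero => simp
    | succ m ih =>
      rw [Finset.sum_range_succ, Function.iterate_succ_apply']
      have h2 := abs_integral_step_sub_le hp0 hp1 hc0.le hc1 hpc'
        (abs_iterate_step_le hp0 hp1 hc0.le hc1 K hB m) (hlip m)
      exact (abs_sub_le _ _ _).trans (by linarith)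
  refine (h1 m).trans ?_
  rw [← Finset.mul_sum, Finset.sum_comm]
  have h3 : ∀ i ∈ Finset.Icc 1 K, ∑ r ∈ Finset.range m, weight p K r i ≤ 2 / c * (1 / i) := by
    intro i hi
    have hi' := Finset.mem_Icc.1 hi
    have hpi : 0 < p i := by
      rw [hpc i hi]
      have : (0 : ℝ) < i := by exact_mod_cast hi'.1
      positivity
    calc ∑ r ∈ Finset.range m, weight p K r i = 2 * ∑ r ∈ Finset.range m, (1 - p i) ^ r := by
          rw [Finset.mul_sum]
          exact Finset.sum_congr rfl fun r _ => weight_eq hi'.2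
      _ ≤ 2 * (1 / p i) := by
          have := sum_range_pow_le hpi (hp1 i) m
          linarith
      _ = _ := by rw [hpc i hi]; field_simp
  calc 10 * c ^ 2 * K * ∑ i ∈ Finset.Icc 1 K, ∑ r ∈ Finset.range m, weight p K r i
      ≤ 10 * c ^ 2 * K * ∑ i ∈ Finset.Icc 1 K, 2 / c * (1 / (i : ℝ)) := by
        have := Finset.sum_le_sum h3
        gcongr
    _ = 20 * c * K * ∑ i ∈ Finset.Icc 1 K, 1 / (i : ℝ) := by
        rw [← Finset.mul_sum]; field_simp; ring
    _ ≤ _ := by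
        have := sum_Icc_inv_le K
        gcongr

/-- The comparison chain converges to the Poisson vector. -/
theorem abs_iterate_step_sub_integral_le {p : ℕ → ℝ} (hp0 : ∀ a, 0 ≤ p a) (hp1 : ∀ a, p a ≤ 1)
    {c : ℝ} (hc0 : 0 < c) (hc1 : c ≤ 1) (hpc : ∀ i ∈ Finset.Icc 1 K, p i = c * i)
    {f : Multiset ℕ → ℝ} (hB : ∀ s, |f s| ≤ 1) (hf : IsLip (weight p K 0) f) (m : ℕ)
    (s : Multiset ℕ) :
    |(step p c K)^[m] f s - ∫ z, f (config z) ∂poissonVectorLaw K|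
      ≤ (s.map (weight p K m)).sum + ∑ i ∈ Finset.Icc 1 K, weight p K m i / i
        + 20 * c * K * (1 + Real.log K) := by
  have hlip : IsLip (weight p K m) ((step p c K)^[m] f) := by
    have := hf.iterate_step hp0 hp1 hc0.le hc1 K m
    convert this using 2 with a
    simp [weight]
  have h1 := abs_integral_iterate_step_sub_le hp0 hp1 hc0 hc1 hpc hB hf m
  set g := (step p c K)^[m] f with hg
  have hgB : ∀ s, |g s| ≤ 1 := abs_iterate_step_le hp0 hp1 hc0.le hc1 K hB m
  have i1 : Integrable (fun z : Fin K → ℕ => g (config z)) (poissonVectorLaw K) :=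
    integrable_of_bounded fun z => hgB _
  -- Both configurations are compared with the empty one: after `m` steps what matters is the
  -- expected number of surviving initial particles.
  have hz : ∀ s u, |g s - g u| ≤ (s.map (weight p K m)).sum + (u.map (weight p K m)).sum := by
    intro s u
    have h2 := hlip.abs_sub_add_le 0 s
    have h3 := hlip.abs_sub_add_le 0 u
    rw [add_zero] at h2 h3
    rw [abs_le] at *
    constructor <;> linarith [h2.1, h2.2, h3.1, h3.2]
  have i2 : ∀ i : Fin K, Integrable (fun z : Fin K → ℕ => (z i : ℝ) * weight p K m (i + 1))
      (poissonVectorLaw K) := fun i => (integrable_coord i).mul_const _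
  have h4 : |g s - ∫ z, g (config z) ∂poissonVectorLaw K|
      ≤ (s.map (weight p K m)).sum + ∑ i ∈ Finset.Icc 1 K, weight p K m i / i := by
    have e : g s - ∫ z, g (config z) ∂poissonVectorLaw K
        = ∫ z : Fin K → ℕ, (g s - g (config z)) ∂poissonVectorLaw K := by
      rw [integral_sub (integrable_const _) i1]; simp
    rw [e]
    refine abs_integral_le_integral_abs.trans ((integral_mono
      ((integrable_const _).sub i1).abs
      (g := fun z : Fin K → ℕ => (s.map (weight p K m)).sum
        + ∑ i : Fin K, (z i : ℝ) * weight p K m (i + 1))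
      ((integrable_const _).add (integrable_finsetSum _ fun i _ => i2 i)) fun z => ?_).trans ?_)
    · have := hz s (config z)
      rwa [sum_map_config] at this
    · rw [integral_add (integrable_const _) (integrable_finsetSum _ fun i _ => i2 i),
        integral_finsetSum _ fun i _ => i2 i, sum_Icc_eq_sum_fin]
      simp only [integral_mul_const, integral_coord]
      refine le_of_eq ?_
      congr 1
      · simp
      · refine Finset.sum_congr rfl fun i _ => ?_
        push_cast
        ring
  exact (abs_sub_le _ _ _).trans (add_le_add h4 h1)

end Poisson

end KCycleWalk

/-! ### Independence, the Markov property and the exchange of steps -/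

namespace KCycleWalk

section Independence

variable {Ω : Type*} [MeasurableSpace Ω] {μ : Measure Ω} [IsProbabilityMeasure μ]
  {α β δ : Type*} [MeasurableSpace α] [MeasurableSpace β] [MeasurableSpace δ]

/-- Both hypotheses together say that the joint law of `X`, `Y`, `Z` is a triple product; it only
has to be reassociated. -/
theorem indepFun_prodMk_left {X : Ω → α} {Y : Ω → β} {Z : Ω → δ} (hX : Measurable X)
    (hY : Measurable Y) (hZ : Measurable Z) (h1 : IndepFun X (fun ω => (Y ω, Z ω)) μ)
    (h2 : IndepFun Y Z μ) : IndepFun (fun ω => (X ω, Y ω)) Z μ := by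
  have h3 : IndepFun X Y μ := h1.comp (φ := id) (ψ := Prod.fst) measurable_id measurable_fst
  have : IsProbabilityMeasure (μ.map X) := Measure.isProbabilityMeasure_map hX.aemeasurable
  have : IsProbabilityMeasure (μ.map Y) := Measure.isProbabilityMeasure_map hY.aemeasurable
  have : IsProbabilityMeasure (μ.map Z) := Measure.isProbabilityMeasure_map hZ.aemeasurable
  rw [indepFun_iff_map_prod_eq_prod_map_map (hX.prodMk hY).aemeasurable hZ.aemeasurable,
    h3.map_prod_eq_prod_map_map hX.aemeasurable hY.aemeasurable]
  apply MeasurableEquiv.prodAssoc.map_measurableEquiv_injective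
  rw [Measure.prodAssoc_prod, ← h2.map_prod_eq_prod_map_map hY.aemeasurable hZ.aemeasurable,
    ← h1.map_prod_eq_prod_map_map hX.aemeasurable (hY.prodMk hZ).aemeasurable,
    Measure.map_map MeasurableEquiv.prodAssoc.measurable ((hX.prodMk hY).prodMk hZ)]
  rfl

theorem integral_indep_eq {X : Ω → α} {Z : Ω → δ} (hX : Measurable X) (hZ : Measurable Z)
    (h : IndepFun X Z μ) {Ψ : α × δ → ℝ} (hΨ : Measurable Ψ) {B : ℝ} (hB : ∀ x, |Ψ x| ≤ B) :
    ∫ ω, Ψ (X ω, Z ω) ∂μ = ∫ ω, ∫ z, Ψ (X ω, z) ∂(μ.map Z) ∂μ := by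
  have : IsProbabilityMeasure (μ.map X) := Measure.isProbabilityMeasure_map hX.aemeasurable
  have : IsProbabilityMeasure (μ.map Z) := Measure.isProbabilityMeasure_map hZ.aemeasurable
  have hint : Integrable Ψ ((μ.map X).prod (μ.map Z)) :=
    Integrable.of_bound hΨ.aestronglyMeasurable B (ae_of_all _ hB)
  calc ∫ ω, Ψ (X ω, Z ω) ∂μ = ∫ x, Ψ x ∂(μ.map fun ω => (X ω, Z ω)) :=
        (integral_map (hX.prodMk hZ).aemeasurable hΨ.aestronglyMeasurable).symm
    _ = ∫ x, Ψ x ∂((μ.map X).prod (μ.map Z)) := by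
        rw [h.map_prod_eq_prod_map_map hX.aemeasurable hZ.aemeasurable]
    _ = ∫ x, ∫ z, Ψ (x, z) ∂(μ.map Z) ∂(μ.map X) := integral_prod _ hint
    _ = _ := by
        rw [integral_map hX.aemeasurable]
        exact hΨ.stronglyMeasurable.integral_prod_right'.aestronglyMeasurable

theorem integral_indep_eq_symm {X : Ω → α} {Z : Ω → δ} (hX : Measurable X) (hZ : Measurable Z)
    (h : IndepFun X Z μ) {Ψ : α × δ → ℝ} (hΨ : Measurable Ψ) {B : ℝ} (hB : ∀ x, |Ψ x| ≤ B) :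
    ∫ ω, Ψ (X ω, Z ω) ∂μ = ∫ z, ∫ ω, Ψ (X ω, z) ∂μ ∂(μ.map Z) := by
  have : IsProbabilityMeasure (μ.map X) := Measure.isProbabilityMeasure_map hX.aemeasurable
  have : IsProbabilityMeasure (μ.map Z) := Measure.isProbabilityMeasure_map hZ.aemeasurable
  have hint : Integrable Ψ ((μ.map X).prod (μ.map Z)) :=
    Integrable.of_bound hΨ.aestronglyMeasurable B (ae_of_all _ hB)
  calc ∫ ω, Ψ (X ω, Z ω) ∂μ = ∫ x, Ψ x ∂(μ.map fun ω => (X ω, Z ω)) :=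
        (integral_map (hX.prodMk hZ).aemeasurable hΨ.aestronglyMeasurable).symm
    _ = ∫ x, Ψ x ∂((μ.map X).prod (μ.map Z)) := by
        rw [h.map_prod_eq_prod_map_map hX.aemeasurable hZ.aemeasurable]
    _ = ∫ z, ∫ x, Ψ (x, z) ∂(μ.map X) ∂(μ.map Z) := integral_prod_symm _ hint
    _ = _ := by
        refine integral_congr_ae (ae_of_all _ fun z => ?_)
        exact integral_map hX.aemeasurable
          (hΨ.comp (measurable_id.prodMk measurable_const)).aestronglyMeasurable

end Independence

section Walk

variable {n : ℕ}

instance instDiscreteMeasurableSpacePermFin (n : ℕ) :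
    DiscreteMeasurableSpace (Equiv.Perm (Fin n)) := ⟨fun _ => trivial⟩

/-- The position after `m` steps of the walk that starts at `a` and has the steps `η`. -/
def position (a : Equiv.Perm (Fin n)) (η : ℕ → Equiv.Perm (Fin n)) (m : ℕ) :
    Equiv.Perm (Fin n) :=
  a * ((List.range m).map η).prod

theorem position_zero (a : Equiv.Perm (Fin n)) (η : ℕ → Equiv.Perm (Fin n)) :
    position a η 0 = a := by simp [position]

theorem position_succ (a : Equiv.Perm (Fin n)) (η : ℕ → Equiv.Perm (Fin n)) (m : ℕ) :
    position a η (m + 1) = position a η m * η m := by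
  simp [position, List.range_succ, mul_assoc]

theorem position_congr (a : Equiv.Perm (Fin n)) {η η' : ℕ → Equiv.Perm (Fin n)} {m : ℕ}
    (h : ∀ i < m, η i = η' i) : position a η m = position a η' m := by
  rw [position, position]
  congr 2
  exact List.map_congr_left fun i hi => h i (List.mem_range.1 hi)

theorem measurable_position (m : ℕ) :
    Measurable fun x : Equiv.Perm (Fin n) × (ℕ → Equiv.Perm (Fin n)) =>
      position x.1 x.2 m := by
  induction m with
  | zero => simpa only [position_zero] using measurable_fst
  | succ m ih =>
    simp only [position_succ]
    exact (measurable_of_countable fun y : Equiv.Perm (Fin n) × Equiv.Perm (Fin n) =>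
      y.1 * y.2).comp (ih.prodMk ((measurable_pi_apply m).comp measurable_snd))

/-- A uniform `k`-cycle is a uniformly random conjugate of a fixed one. A random step thus becomes a
fixed cyclic pattern placed at random points `τ j`. -/
theorem integral_uniformOn_kCycles {k : ℕ} {γ₀ : Equiv.Perm (Fin n)} (hγ₀ : γ₀ ∈ kCycles k n)
    (F : Equiv.Perm (Fin n) → ℝ) :
    ∫ c, F c ∂uniformOn (kCycles k n) =
      (∑ τ, F (τ * γ₀ * τ⁻¹)) / Fintype.card (Equiv.Perm (Fin n)) := by
  classical
  obtain ⟨C, hCs⟩ : ∃ C : Finset (Equiv.Perm (Fin n)), kCycles k n = ↑C :=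
    ⟨_, (Set.toFinite (kCycles k n)).coe_toFinset.symm⟩
  have hCmem : ∀ γ, γ ∈ C ↔ γ ∈ kCycles k n := fun γ => by rw [hCs, Finset.mem_coe]
  have hC0 : (C.card : ℝ) ≠ 0 := by
    have : 0 < C.card := Finset.card_pos.2 ⟨γ₀, (hCmem _).2 hγ₀⟩
    positivity
  have hN0 : (Fintype.card (Equiv.Perm (Fin n)) : ℝ) ≠ 0 := by
    have : 0 < Fintype.card (Equiv.Perm (Fin n)) := Fintype.card_pos
    positivity
  have h1 := sum_conj_eq hγ₀ hCmem F
  have h2 : ∫ c, F c ∂uniformOn (kCycles k n) = (C.card : ℝ)⁻¹ * ∑ γ ∈ C, F γ := by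
    rw [hCs, uniformOn, ProbabilityTheory.cond, integral_smul_measure,
      setIntegral_finset _ (Integrable.of_finite).integrableOn]
    simp [Measure.real]
  rw [h2, eq_div_iff hN0, inv_mul_eq_div, div_mul_eq_mul_div, div_eq_iff hC0, mul_comm _ (C.card : ℝ),
    h1, mul_comm]

variable {Ω : Type*} [MeasurableSpace Ω] {μ : Measure Ω} [IsProbabilityMeasure μ]
  {π₀ : Ω → Equiv.Perm (Fin n)} {γ : ℕ → Ω → Equiv.Perm (Fin n)}

theorem measurable_walk (hπ₀ : Measurable π₀) (hγ : ∀ m, Measurable (γ m)) (m : ℕ) :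
    Measurable fun ω => position (π₀ ω) (fun i => γ i ω) m :=
  (measurable_position m).comp (hπ₀.prodMk (measurable_pi_lambda _ hγ))

/-- The steps before time `m`. -/
def pastSteps (m : ℕ) (η : ℕ → Equiv.Perm (Fin n)) : ℕ → Equiv.Perm (Fin n) :=
  fun i => if i < m then η i else 1

theorem indepFun_past (hπ₀ : Measurable π₀) (hγ : ∀ m, Measurable (γ m)) (hind : iIndepFun γ μ)
    (hind₀ : IndepFun π₀ (fun ω i => γ i ω) μ) (m : ℕ) :
    IndepFun (fun ω => (π₀ ω, pastSteps m fun i => γ i ω)) (γ m) μ := by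
  have hpast : Measurable fun η : ℕ → Equiv.Perm (Fin n) => pastSteps m η := by
    refine measurable_pi_lambda _ fun i => ?_
    by_cases h : i < m
    · simpa only [pastSteps, h, if_true] using measurable_pi_apply i
    · simpa only [pastSteps, h, if_false] using measurable_const
  have hγ' : Measurable fun ω i => γ i ω := measurable_pi_lambda _ hγ
  refine indepFun_prodMk_left hπ₀ (hpast.comp hγ') (hγ m) ?_ ?_
  · exact hind₀.comp (φ := id) (ψ := fun η => (pastSteps m η, η m)) measurable_id
      (hpast.prodMk (measurable_pi_apply m))
  · have h1 := hind.indepFun_finset (Finset.range m) {m} (by simp) hγ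
    have m1 : Measurable fun (b : Finset.range m → Equiv.Perm (Fin n)) (i : ℕ) =>
        if h : i ∈ Finset.range m then b ⟨i, h⟩ else 1 :=
      measurable_pi_lambda _ fun i => by
        by_cases h : i ∈ Finset.range m
        · simpa only [h, dif_pos] using measurable_pi_apply _
        · simpa only [h, dif_neg, not_false_eq_true] using measurable_const
    have m2 : Measurable fun b : ({m} : Finset ℕ) → Equiv.Perm (Fin n) =>
        b ⟨m, Finset.mem_singleton_self m⟩ := measurable_pi_apply _
    have h2 := h1.comp m1 m2
    convert h2 using 1
    · ext1 ω
      funext i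
      simp [pastSteps]
    · rfl

/-- The Markov property of the walk, on the event that it has stayed in a set so far. -/
theorem setIntegral_step (hπ₀ : Measurable π₀) (hγ : ∀ m, Measurable (γ m)) (hind : iIndepFun γ μ)
    (hind₀ : IndepFun π₀ (fun ω i => γ i ω) μ) {k : ℕ}
    (hlaw : ∀ m, HasLaw (γ m) (uniformOn (kCycles k n)) μ) (G : Set (Equiv.Perm (Fin n)))
    (m : ℕ) (g : Equiv.Perm (Fin n) → ℝ) :
    ∫ ω in {ω | ∀ r < m + 1, position (π₀ ω) (fun i => γ i ω) r ∈ G},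
        g (position (π₀ ω) (fun i => γ i ω) (m + 1)) ∂μ
      = ∫ ω in {ω | ∀ r < m + 1, position (π₀ ω) (fun i => γ i ω) r ∈ G},
        (∫ c, g (position (π₀ ω) (fun i => γ i ω) m * c) ∂uniformOn (kCycles k n)) ∂μ := by
  classical
  have hmeas : MeasurableSet {ω | ∀ r < m + 1, position (π₀ ω) (fun i => γ i ω) r ∈ G} := by
    have : {ω | ∀ r < m + 1, position (π₀ ω) (fun i => γ i ω) r ∈ G}
        = ⋂ r, ⋂ (_ : r < m + 1), {ω | position (π₀ ω) (fun i => γ i ω) r ∈ G} := by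
      ext ω; simp
    rw [this]
    exact MeasurableSet.iInter fun r => MeasurableSet.iInter fun _ =>
      measurable_walk hπ₀ hγ r (MeasurableSet.of_discrete (s := G))
  have hγ' : Measurable fun ω i => γ i ω := measurable_pi_lambda _ hγ
  have hpast : Measurable fun η : ℕ → Equiv.Perm (Fin n) => pastSteps m η := by
    refine measurable_pi_lambda _ fun i => ?_
    by_cases h : i < m
    · simpa only [pastSteps, h, if_true] using measurable_pi_apply i
    · simpa only [pastSteps, h, if_false] using measurable_const
  have hpos : ∀ ω, ∀ r < m + 1, position (π₀ ω) (pastSteps m fun i => γ i ω) r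
      = position (π₀ ω) (fun i => γ i ω) r := fun ω r hr =>
    position_congr _ fun i hi => if_pos (by omega)
  set Ψ : (Equiv.Perm (Fin n) × (ℕ → Equiv.Perm (Fin n))) × Equiv.Perm (Fin n) → ℝ := fun x =>
    if ∀ r < m + 1, position x.1.1 x.1.2 r ∈ G then g (position x.1.1 x.1.2 m * x.2) else 0 with hΨ
  have hΨm : Measurable Ψ := by
    refine Measurable.ite ?_ ?_ measurable_const
    · have : {x : (Equiv.Perm (Fin n) × (ℕ → Equiv.Perm (Fin n))) × Equiv.Perm (Fin n) |
          ∀ r < m + 1, position x.1.1 x.1.2 r ∈ G}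
          = ⋂ r, ⋂ (_ : r < m + 1), {x | position x.1.1 x.1.2 r ∈ G} := by
        ext x; simp
      rw [this]
      exact MeasurableSet.iInter fun r => MeasurableSet.iInter fun _ =>
        ((measurable_position r).comp measurable_fst) (MeasurableSet.of_discrete (s := G))
    · exact (measurable_of_countable fun y : Equiv.Perm (Fin n) × Equiv.Perm (Fin n) =>
        g (y.1 * y.2)).comp (((measurable_position m).comp measurable_fst).prodMk measurable_snd)
  obtain ⟨B, hB⟩ : ∃ B, ∀ σ, |g σ| ≤ B :=
    ⟨∑ σ, |g σ|, fun σ => Finset.single_le_sum (f := fun σ => |g σ|)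
      (fun _ _ => abs_nonneg _) (Finset.mem_univ σ)⟩
  have hΨB : ∀ x, |Ψ x| ≤ B := fun x => by
    simp only [hΨ]
    split_ifs
    · exact hB _
    · simpa using (abs_nonneg _).trans (hB 1)
  have key := integral_indep_eq (μ := μ) (hπ₀.prodMk (hpast.comp hγ')) (hγ m)
    (indepFun_past hπ₀ hγ hind hind₀ m) hΨm hΨB
  rw [← integral_indicator hmeas, ← integral_indicator hmeas]
  refine Eq.trans ?_ (key.trans ?_)
  · refine integral_congr_ae (ae_of_all _ fun ω => ?_)
    simp only [Set.indicator_apply, Set.mem_ofPred_eq, hΨ, position_succ]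
    have e : (∀ r < m + 1, position (π₀ ω) (pastSteps m fun i => γ i ω) r ∈ G)
        ↔ ∀ r < m + 1, position (π₀ ω) (fun i => γ i ω) r ∈ G :=
      forall₂_congr fun r hr => by rw [hpos ω r hr]
    simp only [Function.comp, e, hpos ω m (by omega)]
  · refine integral_congr_ae (ae_of_all _ fun ω => ?_)
    have e : (∀ r < m + 1, position (π₀ ω) (pastSteps m fun i => γ i ω) r ∈ G)
        ↔ ∀ r < m + 1, position (π₀ ω) (fun i => γ i ω) r ∈ G :=
      forall₂_congr fun r hr => by rw [hpos ω r hr]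
    simp only [Set.indicator_apply, Set.mem_ofPred_eq, hΨ, Function.comp, e, hpos ω m (by omega),
      (hlaw m).map_eq]
    split_ifs
    · rfl
    · simp

/-- Comparison of the walk, as long as it stays in `G`, with a chain that has almost the same
transitions. -/
theorem abs_integral_walk_sub_le (hπ₀ : Measurable π₀) (hγ : ∀ m, Measurable (γ m))
    (hind : iIndepFun γ μ) (hind₀ : IndepFun π₀ (fun ω i => γ i ω) μ) {k : ℕ}
    (hlaw : ∀ m, HasLaw (γ m) (uniformOn (kCycles k n)) μ) (G : Set (Equiv.Perm (Fin n)))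
    {h : ℕ → Equiv.Perm (Fin n) → ℝ} (hh : ∀ r σ, |h r σ| ≤ 1) {ε : ℕ → ℝ} (hε0 : ∀ r, 0 ≤ ε r)
    (hε : ∀ r, ∀ σ ∈ G, |∫ c, h r (σ * c) ∂uniformOn (kCycles k n) - h (r + 1) σ| ≤ ε r) (m : ℕ) :
    |∫ ω, h 0 (position (π₀ ω) (fun i => γ i ω) m) ∂μ - ∫ ω, h m (π₀ ω) ∂μ|
      ≤ 2 * μ.real {ω | ∃ r < m, position (π₀ ω) (fun i => γ i ω) r ∉ G}
        + ∑ r ∈ Finset.range m, ε r := by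
  set Y : ℕ → Ω → Equiv.Perm (Fin n) := fun r ω => position (π₀ ω) (fun i => γ i ω) r with hY
  have hYm : ∀ r, Measurable (Y r) := measurable_walk hπ₀ hγ
  have hYi : ∀ r (φ : Equiv.Perm (Fin n) → ℝ), Integrable (fun ω => φ (Y r ω)) μ := by
    intro r φ
    refine Integrable.of_bound
      ((measurable_of_countable φ).comp (hYm r)).aestronglyMeasurable (∑ σ, |φ σ|)
      (ae_of_all _ fun ω => ?_)
    exact Finset.single_le_sum (f := fun σ => |φ σ|) (fun _ _ => abs_nonneg _) (Finset.mem_univ _)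
  set A : ℕ → Set Ω := fun s => {ω | ∀ r < s, Y r ω ∈ G} with hA
  have hAm : ∀ s, MeasurableSet (A s) := by
    intro s
    have : A s = ⋂ r, ⋂ (_ : r < s), {ω | Y r ω ∈ G} := by ext ω; simp [hA]
    rw [this]
    exact MeasurableSet.iInter fun r => MeasurableSet.iInter fun _ =>
      hYm r (MeasurableSet.of_discrete (s := G))
  have hAanti : ∀ s, A (s + 1) ⊆ A s := fun s ω hω r hr => hω r (by omega)
  have habs : ∀ (s : Set Ω), MeasurableSet s → ∀ r j,
      |∫ ω in s, h j (Y r ω) ∂μ| ≤ μ.real s := by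
    intro s hs r j
    have := norm_setIntegral_le_of_norm_le_const (μ := μ) (s := s) (C := 1)
      (f := fun ω => h j (Y r ω)) (measure_lt_top _ _) (fun ω _ => hh _ _)
    simpa using this
  -- The offset `j` is free because the last step is peeled off: `h j` at position `s + 1` becomes
  -- `h (j + 1)` at position `s`. `A s` constrains only positions before `s`, so `A (s + 1)` puts
  -- the starting point of that step in `G`, and shrinking the event costs exactly the mass that
  -- telescopes in `1 - μ.real (A s)`.
  have key : ∀ s j, |∫ ω in A s, h j (Y s ω) ∂μ - ∫ ω, h (j + s) (π₀ ω) ∂μ|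
      ≤ (1 - μ.real (A s)) + ∑ r ∈ Finset.range s, ε (j + r) := by
    intro s
    induction s with
    | zero =>
      intro j
      have : A 0 = Set.univ := by ext ω; simp [hA]
      simp [this, hY, position_zero]
    | succ s ih =>
      intro j
      have h1 : ∫ ω in A (s + 1), h j (Y (s + 1) ω) ∂μ
          = ∫ ω in A (s + 1), (∫ c, h j (Y s ω * c) ∂uniformOn (kCycles k n)) ∂μ :=
        setIntegral_step hπ₀ hγ hind hind₀ hlaw G s (h j)
      have i1 := (hYi s fun σ => ∫ c, h j (σ * c) ∂uniformOn (kCycles k n)).integrableOn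
        (s := A (s + 1))
      have i2 := (hYi s (h (j + 1))).integrableOn (s := A (s + 1))
      have h2 : |∫ ω in A (s + 1), (∫ c, h j (Y s ω * c) ∂uniformOn (kCycles k n)) ∂μ
          - ∫ ω in A (s + 1), h (j + 1) (Y s ω) ∂μ| ≤ ε j := by
        rw [← integral_sub i1 i2]
        have := norm_setIntegral_le_of_norm_le_const (μ := μ) (s := A (s + 1)) (C := ε j)
          (f := fun ω => (∫ c, h j (Y s ω * c) ∂uniformOn (kCycles k n)) - h (j + 1) (Y s ω))
          (measure_lt_top _ _) (fun ω hω => hε j _ (hω s (by omega)))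
        rw [Real.norm_eq_abs] at this
        refine this.trans (mul_le_of_le_one_right (hε0 j) measureReal_le_one)
      have h3 : |∫ ω in A (s + 1), h (j + 1) (Y s ω) ∂μ - ∫ ω in A s, h (j + 1) (Y s ω) ∂μ|
          ≤ μ.real (A s) - μ.real (A (s + 1)) := by
        rw [abs_sub_comm, ← setIntegral_sdiff (hAm _) (hYi s (h (j + 1))).integrableOn (hAanti s),
          ← measureReal_sdiff (hAanti s) (hAm _)]
        exact habs _ ((hAm s).diff (hAm _)) _ _
      have h4 := ih (j + 1)
      rw [Finset.sum_range_succ', add_zero]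
      have e1 : j + 1 + s = j + (s + 1) := by ring
      have e2 : ∑ r ∈ Finset.range s, ε (j + 1 + r) = ∑ r ∈ Finset.range s, ε (j + (r + 1)) :=
        Finset.sum_congr rfl fun r _ => by congr 1; ring
      rw [e1, e2] at h4
      rw [h1]
      rw [abs_le] at *
      constructor <;> linarith [h2.1, h2.2, h3.1, h3.2, h4.1, h4.2]
  have h5 := key m 0
  simp only [zero_add] at h5
  have h6 : |∫ ω, h 0 (Y m ω) ∂μ - ∫ ω in A m, h 0 (Y m ω) ∂μ| ≤ 1 - μ.real (A m) := by
    rw [← integral_add_compl (hAm m) (hYi m (h 0)), add_sub_cancel_left,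
      ← probReal_compl_eq_one_sub (hAm m)]
    exact habs _ (hAm m).compl _ _
  have h7 : μ.real {ω | ∃ r < m, Y r ω ∉ G} = 1 - μ.real (A m) := by
    rw [← probReal_compl_eq_one_sub (hAm m)]
    congr 1
    ext ω
    simp [hA]
  rw [h7]
  rw [abs_le] at *
  constructor <;> linarith [h5.1, h5.2, h6.1, h6.2]

end Walk

/-! ### The Poisson clock -/

section PoissonClock

theorem integral_pow_poissonMeasure (r : ℝ≥0) (q : ℝ) :
    ∫ m, q ^ m ∂poissonMeasure r = Real.exp (-(r * (1 - q))) := by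
  rw [integral_poissonMeasure]
  have e : ∀ m : ℕ, (Real.exp (-r) * (r : ℝ) ^ m / (m.factorial : ℝ)) • q ^ m
      = Real.exp (-r) * (((r : ℝ) * q) ^ m / (m.factorial : ℝ)) := fun m => by
    rw [smul_eq_mul, mul_pow]; ring
  simp only [e]
  have h : ∑' m : ℕ, ((r : ℝ) * q) ^ m / (m.factorial : ℝ) = Real.exp (r * q) := by
    rw [Real.exp_eq_exp_ℝ, NormedSpace.exp_eq_tsum_div]
  rw [tsum_mul_left, h, ← Real.exp_add]
  congr 1
  ring

theorem poissonMeasure_two_le (r : ℝ≥0) : (poissonMeasure r).real {m | 2 ≤ m} ≤ (r : ℝ) ^ 2 := by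
  have h1 : {m : ℕ | 2 ≤ m} = ({0, 1} : Set ℕ)ᶜ := by
    ext m; simp; omega
  have h2 : (poissonMeasure r).real ({0, 1} : Set ℕ) = Real.exp (-r) + Real.exp (-r) * r := by
    rw [Set.insert_eq, measureReal_union (by simp) (by simp), poissonMeasure_real_singleton,
      poissonMeasure_real_singleton]
    simp
  rw [h1, probReal_compl_eq_one_sub (by simp), h2]
  have h3 : 1 - (r : ℝ) ≤ Real.exp (-r) := by linarith [Real.add_one_le_exp (-(r : ℝ))]
  have h4 : (0 : ℝ) ≤ r := r.2
  nlinarith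

variable {Ω : Type*} [MeasurableSpace Ω] {μ : Measure Ω} {N : ℝ≥0 → Ω → ℕ}

theorem IsPoissonProcess.hasLaw (hN : IsPoissonProcess N μ) (t : ℝ≥0) :
    HasLaw (N t) (poissonMeasure t) μ := by
  have h := hN.law 0 t zero_le
  rw [tsub_zero] at h
  refine h.congr ?_
  filter_upwards [hN.zero] with ω hω
  rw [hω, tsub_zero]

theorem exists_crossing {f : ℕ → ℕ} {s M : ℕ} (h0 : f 0 ≤ s) (hM : s < f M) :
    ∃ r < M, f r ≤ s ∧ s < f (r + 1) := by
  induction M with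
  | zero => omega
  | succ M ih =>
    by_cases h : s < f M
    · obtain ⟨r, hr, h⟩ := ih h
      exact ⟨r, by omega, h⟩
    · exact ⟨M, by omega, by omega, hM⟩

/-- Almost surely the Poisson process visits every state below `N t` before time `t`. -/
theorem IsPoissonProcess.measure_exists_state_le [IsProbabilityMeasure μ] (hN : IsPoissonProcess N μ) (t : ℝ≥0)
    (P : ℕ → Ω → Prop) :
    μ {ω | ∃ s < N t ω, P s ω} ≤ μ {ω | ∃ r < t, P (N r ω) ω} := by
  -- Cut the time interval into `M + 1` equal pieces. A state can be missed at the grid times only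
  -- if some piece has at least two jumps, and these events have total probability at most `t ^ 2 /
  -- (M + 1)`, which vanishes as `M` grows.
  have key : ∀ M : ℕ, μ {ω | ∃ s < N t ω, P s ω} ≤
      μ {ω | ∃ r < t, P (N r ω) ω} + ENNReal.ofReal ((t : ℝ) ^ 2 / (M + 1 : ℕ)) := by
    intro M
    set T : ℕ → ℝ≥0 := fun r => t * (r / (M + 1 : ℕ)) with hT
    have hTmono : ∀ r, T r ≤ T (r + 1) := fun r => by
      simp only [hT]; gcongr; omega
    have hTdiff : ∀ r, T (r + 1) - T r = t / (M + 1 : ℕ) := fun r => by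
      rw [tsub_eq_iff_eq_add_of_le (hTmono r)]
      simp only [hT]
      push_cast
      ring
    have hTM : T (M + 1) = t := by
      simp only [hT]
      rw [div_self (by positivity), mul_one]
    have hTle : ∀ r < M + 1, T r ≤ t := fun r hr => by
      simp only [hT]
      refine mul_le_of_le_one_right zero_le (div_le_one_of_le₀ ?_ zero_le)
      exact_mod_cast hr.le
    set E : ℕ → Set Ω := fun r => {ω | 2 ≤ N (T (r + 1)) ω - N (T r) ω} with hE
    have hEle : ∀ r, μ (E r) ≤ ENNReal.ofReal (((t : ℝ) / (M + 1 : ℕ)) ^ 2) := by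
      intro r
      have h1 := (hN.law (T r) (T (r + 1)) (hTmono r)).measure_eq (p := fun m => 2 ≤ m)
        (MeasurableSet.of_discrete)
      rw [hTdiff] at h1
      rw [hE, h1]
      refine (ENNReal.le_ofReal_iff_toReal_le (measure_ne_top _ _) (by positivity)).2 ?_
      have := poissonMeasure_two_le (t / (M + 1 : ℕ))
      push_cast at this ⊢
      exact this
    have hsub : {ω | ∃ s < N t ω, P s ω} ⊆ {ω | ∃ r < t, P (N r ω) ω} ∪
        ((⋃ r ∈ Finset.range (M + 1), E r) ∪ {ω | ¬ (N 0 ω = 0 ∧ Monotone fun t => N t ω)}) := by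
      rintro ω ⟨s, hs, hPs⟩
      by_cases hgood : N 0 ω = 0 ∧ Monotone fun t => N t ω
      swap
      · exact Or.inr (Or.inr hgood)
      by_cases hex : ∃ r < M + 1, 2 ≤ N (T (r + 1)) ω - N (T r) ω
      · obtain ⟨r, hr, h⟩ := hex
        exact Or.inr (Or.inl (Set.mem_biUnion (Finset.mem_coe.2 (Finset.mem_range.2 hr)) h))
      push Not at hex
      left
      obtain ⟨r, hr, h1, h2⟩ := exists_crossing (f := fun r => N (T r) ω) (s := s) (M := M + 1)
        (by simp [hT, hgood.1]) (by simpa only [hTM] using hs)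
      have h3 := hex r hr
      have h4 : N (T r) ω = s := by
        change N (T r) ω ≤ s at h1
        change s < N (T (r + 1)) ω at h2
        omega
      -- The grid time is not `t` itself, since the process is at `s < N t` there.
      refine ⟨T r, lt_of_le_of_ne (hTle r hr) fun he => ?_, by rw [h4]; exact hPs⟩
      rw [he] at h4
      omega
    have hnull : μ {ω | ¬ (N 0 ω = 0 ∧ Monotone fun t => N t ω)} = 0 := by
      have : ∀ᵐ ω ∂μ, N 0 ω = 0 ∧ Monotone fun t => N t ω := by
        filter_upwards [hN.zero, hN.paths] with ω h1 h2 using ⟨h1, h2.1⟩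
      exact this
    refine (measure_mono hsub).trans ((measure_union_le _ _).trans ?_)
    gcongr
    refine (measure_union_le _ _).trans ?_
    rw [hnull, add_zero]
    refine (measure_biUnion_finset_le _ _).trans ((Finset.sum_le_sum fun r _ => hEle r).trans ?_)
    rw [Finset.sum_const, Finset.card_range, nsmul_eq_mul, ← ENNReal.ofReal_natCast,
      ← ENNReal.ofReal_mul (by positivity)]
    refine ENNReal.ofReal_le_ofReal (le_of_eq ?_)
    field_simp
  have hlim : Tendsto (fun M : ℕ => μ {ω | ∃ r < t, P (N r ω) ω}
      + ENNReal.ofReal ((t : ℝ) ^ 2 / (M + 1 : ℕ))) atTop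
      (𝓝 (μ {ω | ∃ r < t, P (N r ω) ω} + ENNReal.ofReal 0)) := by
    refine Tendsto.const_add _ (ENNReal.tendsto_ofReal ?_)
    exact (tendsto_const_div_atTop_nhds_zero_nat ((t : ℝ) ^ 2)).comp (tendsto_add_atTop_nat 1)
  rw [ENNReal.ofReal_zero, add_zero] at hlim
  exact ge_of_tendsto' hlim key

end PoissonClock

end KCycleWalk

/-! ### Dyadic strips -/

namespace KCycleWalk

section Strips

open Function

variable {n : ℕ}

theorem sum_Ico_pow_le {b w : ℕ → ℝ} (hb : ∀ i, 0 ≤ b i) (hw : Antitone w) (m : ℕ) :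
    ∑ i ∈ Finset.Ico 1 (2 ^ m), b i * w i ≤
      ∑ j ∈ Finset.range m, (∑ i ∈ Finset.Ico (2 ^ j) (2 ^ (j + 1)), b i) * w (2 ^ j) := by
  induction m with
  | zero => simp
  | succ m ih =>
    rw [Finset.sum_range_succ, ← Finset.sum_Ico_consecutive _ (Nat.one_le_two_pow (n := m))
      (Nat.pow_le_pow_right two_pos m.le_succ)]
    refine add_le_add ih ?_
    rw [Finset.sum_mul]
    refine Finset.sum_le_sum fun i hi => mul_le_mul_of_nonneg_left ?_ (hb i)
    exact hw (Finset.mem_Ico.1 hi).1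

/-- Dyadic condensation. -/
theorem sum_Icc_two_pow_le {b w : ℕ → ℝ} (hb : ∀ i, 0 ≤ b i) (hw0 : ∀ i, 0 ≤ w i)
    (hw : Antitone w) (l : ℕ) :
    ∑ i ∈ Finset.Icc 1 (2 ^ l), b i * w i ≤
      ∑ j ∈ Finset.range (l + 1), (∑ i ∈ Finset.Ico (2 ^ j) (2 ^ (j + 1)), b i) * w (2 ^ j) := by
  refine le_trans (Finset.sum_le_sum_of_subset_of_nonneg ?_ fun i _ _ =>
    mul_nonneg (hb i) (hw0 i)) (sum_Ico_pow_le hb hw (l + 1))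
  intro i hi
  rw [Finset.mem_Icc] at hi
  rw [Finset.mem_Ico, pow_succ]
  have := Nat.one_le_two_pow (n := l)
  omega

theorem sum_map_smallParts_eq (K : ℕ) (σ : Equiv.Perm (Fin n)) (u : ℕ → ℝ) :
    ((smallParts K σ).map u).sum = ∑ i ∈ Finset.Icc 1 K, (cycleCount σ i : ℝ) * u i := by
  rw [Finset.sum_multiset_map_count]
  have h : (smallParts K σ).toFinset ⊆ Finset.Icc 1 K := fun a ha => by
    rw [Multiset.mem_toFinset] at ha
    exact Finset.mem_Icc.2 ⟨pos_of_mem_smallParts ha, le_of_mem_smallParts ha⟩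
  rw [Finset.sum_subset h fun a _ ha => ?_]
  · refine Finset.sum_congr rfl fun i hi => ?_
    rw [count_smallParts (Finset.mem_Icc.1 hi).2, nsmul_eq_mul]
  · rw [Multiset.mem_toFinset] at ha
    rw [Multiset.count_eq_zero_of_notMem ha, zero_nsmul]

theorem sum_strip_mul_le (σ : Equiv.Perm (Fin n)) (j : ℕ) :
    ∑ i ∈ Finset.Ico (2 ^ j) (2 ^ (j + 1)), (cycleCount σ i : ℝ) * i ≤
      2 ^ (j + 1) * (stripCount σ j : ℝ) := by
  rw [stripCount]
  push_cast
  rw [Finset.mul_sum]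
  refine Finset.sum_le_sum fun i hi => ?_
  rw [mul_comm]
  refine mul_le_mul_of_nonneg_right ?_ (Nat.cast_nonneg _)
  exact_mod_cast (Finset.mem_Ico.1 hi).2.le

theorem sum_Ico_two_pow_one (j : ℕ) :
    ∑ _i ∈ Finset.Ico (2 ^ j : ℕ) (2 ^ (j + 1)), (1 : ℝ) = 2 ^ j := by
  rw [Finset.sum_const, Nat.card_Ico, pow_succ]
  have : 2 ^ j * 2 - 2 ^ j = 2 ^ j := by omega
  rw [this]; simp

theorem sum_Ico_two_pow_inv_le (j : ℕ) :
    ∑ i ∈ Finset.Ico (2 ^ j : ℕ) (2 ^ (j + 1)), 1 / (i : ℝ) ≤ 1 := by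
  calc ∑ i ∈ Finset.Ico (2 ^ j : ℕ) (2 ^ (j + 1)), 1 / (i : ℝ)
      ≤ ∑ _i ∈ Finset.Ico (2 ^ j : ℕ) (2 ^ (j + 1)), 1 * (1 / (2 : ℝ) ^ j) := by
        refine Finset.sum_le_sum fun i hi => ?_
        rw [one_mul]
        refine one_div_le_one_div_of_le (by positivity) ?_
        exact_mod_cast (Finset.mem_Ico.1 hi).1
    _ = 1 := by
        rw [← Finset.sum_mul, sum_Ico_two_pow_one]
        field_simp

variable {w : ℕ → ℝ}

theorem sum_map_smallParts_le_strips (hw0 : ∀ i, 0 ≤ w i) (hw : Antitone w) (l : ℕ)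
    (σ : Equiv.Perm (Fin n)) :
    ((smallParts (2 ^ l) σ).map w).sum ≤
      ∑ j ∈ Finset.range (l + 1), (stripCount σ j : ℝ) * w (2 ^ j) := by
  rw [sum_map_smallParts_eq]
  refine (sum_Icc_two_pow_le (fun i => Nat.cast_nonneg _) hw0 hw l).trans_eq ?_
  refine Finset.sum_congr rfl fun j _ => ?_
  rw [stripCount]; push_cast; rfl

theorem sum_div_le_strips (hw0 : ∀ i, 0 ≤ w i) (hw : Antitone w) (l : ℕ) :
    ∑ i ∈ Finset.Icc 1 (2 ^ l), w i / i ≤ ∑ j ∈ Finset.range (l + 1), w (2 ^ j) := by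
  have h := sum_Icc_two_pow_le (b := fun i => 1 / (i : ℝ)) (fun i => by positivity) hw0 hw l
  refine le_trans (le_of_eq (Finset.sum_congr rfl fun i _ => by ring)) (h.trans ?_)
  exact Finset.sum_le_sum fun j _ => mul_le_of_le_one_left (hw0 _) (sum_Ico_two_pow_inv_le j)

theorem sum_le_strips (hw0 : ∀ i, 0 ≤ w i) (hw : Antitone w) (l : ℕ) :
    ∑ i ∈ Finset.Icc 1 (2 ^ l), w i ≤ ∑ j ∈ Finset.range (l + 1), 2 ^ j * w (2 ^ j) := by
  have h := sum_Icc_two_pow_le (b := fun _ => (1 : ℝ)) (fun i => zero_le_one) hw0 hw l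
  simpa only [one_mul, sum_Ico_two_pow_one] using h

theorem sum_minimalPeriod_le_strips (hw0 : ∀ i, 0 ≤ w i) (hw : Antitone w) {l : ℕ}
    (hwK : ∀ a, 2 ^ l < a → w a = 0) {L : ℝ} {σ : Equiv.Perm (Fin n)}
    (hσ : ∀ j ≤ l, (stripCount σ j : ℝ) ≤ L) :
    ∑ y, w (minimalPeriod σ y) ≤ ∑ j ∈ Finset.range (l + 1), 2 * L * (2 ^ j * w (2 ^ j)) := by
  have e : ∑ y, w (minimalPeriod σ y) = ∑ i ∈ Finset.Icc 1 (2 ^ l), ((cycleCount σ i : ℝ) * i) * w i := by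
    have h1 := sum_map_smallParts (2 ^ l) σ w
    rw [sum_map_smallParts_eq] at h1
    rw [Finset.sum_congr rfl fun i _ => mul_assoc _ _ _, h1]
    refine Finset.sum_congr rfl fun y _ => ?_
    split_ifs with h
    · rfl
    · exact hwK _ (not_le.1 h)
  rw [e]
  refine (sum_Icc_two_pow_le (fun i => by positivity) hw0 hw l).trans ?_
  refine Finset.sum_le_sum fun j hj => ?_
  have h2 := hσ j (by have := Finset.mem_range.1 hj; omega)
  calc _ ≤ (2 ^ (j + 1) * L) * w (2 ^ j) := by
        refine mul_le_mul_of_nonneg_right ((sum_strip_mul_le σ j).trans ?_) (hw0 _)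
        gcongr
    _ = _ := by ring

theorem smallPoints_le_strips {l : ℕ} {L : ℝ} {σ : Equiv.Perm (Fin n)}
    (hσ : ∀ j ≤ l, (stripCount σ j : ℝ) ≤ L) :
    smallPoints σ (2 ^ l) ≤ 4 * 2 ^ l * L := by
  have hL : 0 ≤ L := (Nat.cast_nonneg _).trans (hσ 0 (Nat.zero_le _))
  have e : smallPoints σ (2 ^ l) = ∑ i ∈ Finset.Icc 1 (2 ^ l), ((cycleCount σ i : ℝ) * i) * 1 := by
    have h1 := sum_map_smallParts (2 ^ l) σ fun _ => 1
    rw [sum_map_smallParts_eq] at h1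
    rw [Finset.sum_congr rfl fun i _ => mul_assoc _ _ _, h1, smallPoints]
  rw [e]
  refine (sum_Icc_two_pow_le (w := fun _ => 1) (fun i => by positivity) (fun _ => zero_le_one)
    antitone_const l).trans ?_
  calc _ ≤ ∑ j ∈ Finset.range (l + 1), 2 * L * 2 ^ j := by
        refine Finset.sum_le_sum fun j hj => ?_
        have h2 := hσ j (by have := Finset.mem_range.1 hj; omega)
        rw [mul_one]
        calc _ ≤ 2 ^ (j + 1) * (stripCount σ j : ℝ) := sum_strip_mul_le σ j
          _ ≤ 2 ^ (j + 1) * L := by gcongr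
          _ = _ := by ring
    _ = 2 * L * (2 ^ (l + 1) - 1) := by
        rw [← Finset.mul_sum, geom_sum_eq (by norm_num)]
        norm_num
    _ ≤ _ := by rw [pow_succ]; nlinarith

end Strips

section StepError

variable {n : ℕ}

/-- The strip bound makes both factors of the one-step error dyadic sums. The number of points on
cycles of size up to `2 * 2 ^ l` enters, which is why strip `l + 1` must be controlled too. -/
theorem uniformOn_kCycles_step_error {k l : ℕ} (hk : 2 ≤ k) (hn : 2 * k ≤ n) (hK : k * 2 ^ l ≤ n)
    (hne : (kCycles k n).Nonempty) {w : ℕ → ℝ} {g : Multiset ℕ → ℝ} (hg : IsLip w g)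
    (hw : Antitone w) (hwK : ∀ a, 2 ^ l < a → w a = 0) {L : ℝ} {σ : Equiv.Perm (Fin n)}
    (hσ : ∀ j ≤ l + 1, (stripCount σ j : ℝ) ≤ L) :
    |∫ c, g (smallParts (2 ^ l) (σ * c)) ∂uniformOn (kCycles k n)
        - step (deathRate k n) (k / n) (2 ^ l) g (smallParts (2 ^ l) σ)|
      ≤ 16 * (k : ℝ) ^ 4 / (n : ℝ) ^ 2 * (2 ^ l * (8 * L + 2)) *
        ((2 * L + 1) * ∑ j ∈ Finset.range (l + 1), 2 ^ j * w (2 ^ j)) := by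
  have hw0 : ∀ i, 0 ≤ w i := fun i => (abs_nonneg _).trans (hg i 0)
  obtain ⟨γ₀, hγ₀⟩ := hne
  rw [integral_uniformOn_kCycles hγ₀]
  refine (abs_avg_sub_step_le hk hγ₀ hn σ hK hg hw hwK).trans ?_
  have h1 := smallPoints_le_strips hσ
  have h2 := sum_minimalPeriod_le_strips hw0 hw hwK (fun j hj => hσ j (by omega))
  have h3 := sum_le_strips hw0 hw l
  have h4 : (1 : ℝ) ≤ 2 ^ l := one_le_pow₀ (by norm_num)
  have h5 := smallPoints_nonneg σ (2 * 2 ^ l)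
  rw [← Finset.mul_sum] at h2
  rw [pow_succ, mul_comm (2 ^ l) 2] at h1
  refine mul_le_mul (mul_le_mul_of_nonneg_left ?_ (by positivity)) ?_ ?_ ?_
  · push_cast
    rw [pow_succ] at h1
    nlinarith
  · linarith
  · exact add_nonneg (Finset.sum_nonneg fun _ _ => hw0 _) (Finset.sum_nonneg fun _ _ => hw0 _)
  · have hL : 0 ≤ L := (Nat.cast_nonneg _).trans (hσ 0 (Nat.zero_le _))
    positivity

end StepError

end KCycleWalk

/-! ### The walk after a fixed number of steps -/

namespace KCycleWalk

section FixedTime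

variable {n : ℕ} {Ω : Type*} [MeasurableSpace Ω] {μ : Measure Ω} [IsProbabilityMeasure μ]
  {π₀ : Ω → Equiv.Perm (Fin n)} {γ : ℕ → Ω → Equiv.Perm (Fin n)}

/-- The permutations none of whose dyadic strips up to `l + 1` has more than `L` cycles. -/
def balanced (n l : ℕ) (L : ℝ) : Set (Equiv.Perm (Fin n)) :=
  {σ | ∀ j ≤ l + 1, (stripCount σ j : ℝ) ≤ L}

theorem sum_weight_le {p : ℕ → ℝ} (hp1 : ∀ a, p a ≤ 1) {K a : ℕ} (hpa : 0 < p a) (m : ℕ) :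
    ∑ r ∈ Finset.range m, weight p K r a ≤ 2 / p a := by
  have h : ∀ r, weight p K r a ≤ 2 * (1 - p a) ^ r := fun r => by
    rw [weight, mul_comm]
    refine mul_le_mul_of_nonneg_right ?_ (pow_nonneg (sub_nonneg.2 (hp1 a)) r)
    split_ifs <;> norm_num
  refine (Finset.sum_le_sum fun r _ => h r).trans ?_
  rw [← Finset.mul_sum, div_eq_mul_one_div]
  exact mul_le_mul_of_nonneg_left (sum_range_pow_le hpa (hp1 a) m) zero_le_two

theorem iterate_step_isLip {p : ℕ → ℝ} (hp0 : ∀ a, 0 ≤ p a) (hp1 : ∀ a, p a ≤ 1)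
    {c : ℝ} (hc0 : 0 ≤ c) (hc1 : c ≤ 1) {K : ℕ} {f : Multiset ℕ → ℝ}
    (hf : IsLip (weight p K 0) f) (m : ℕ) : IsLip (weight p K m) ((step p c K)^[m] f) := by
  have := hf.iterate_step hp0 hp1 hc0 hc1 K m
  convert this using 2 with a
  simp [weight]

/-- The total error of the comparison of the first `m` steps with the comparison chain. -/
theorem sum_step_error_le {k l : ℕ} (hk : 0 < k) (hn : 0 < n) (hK : k * 2 ^ l ≤ n) {L : ℝ}
    (hL : 0 ≤ L) (m : ℕ) :
    ∑ r ∈ Finset.range m, 16 * (k : ℝ) ^ 4 / (n : ℝ) ^ 2 * (2 ^ l * (8 * L + 2)) *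
        ((2 * L + 1) * ∑ j ∈ Finset.range (l + 1), 2 ^ j * weight (deathRate k n) (2 ^ l) r (2 ^ j))
      ≤ 32 * (k : ℝ) ^ 3 / n * 2 ^ l * (8 * L + 2) * (2 * L + 1) * (l + 1) := by
  have hn' : (0 : ℝ) < n := by exact_mod_cast hn
  have hk' : (0 : ℝ) < k := by exact_mod_cast hk
  rw [← Finset.mul_sum, ← Finset.mul_sum, Finset.sum_comm]
  -- The size `2 ^ j` cancels against the death rate `k * 2 ^ j / n`: every strip contributes at
  -- most `2 * n / k`, for any number of steps.
  have h1 : ∀ j ∈ Finset.range (l + 1), ∑ r ∈ Finset.range m,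
      2 ^ j * weight (deathRate k n) (2 ^ l) r (2 ^ j) ≤ 2 * n / k := by
    intro j hj
    have hj' : 2 ^ j ≤ 2 ^ l :=
      Nat.pow_le_pow_right two_pos (by have := Finset.mem_range.1 hj; omega)
    have hd := deathRate_eq hn hK hj'
    push_cast at hd
    rw [← Finset.mul_sum]
    have h2 := sum_weight_le (K := 2 ^ l) (deathRate_le_one k n) (a := 2 ^ j)
      (by rw [hd]; positivity) m
    calc _ ≤ (2 : ℝ) ^ j * (2 / deathRate k n (2 ^ j)) := by gcongr
      _ = _ := by rw [hd]; field_simp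
  calc _ ≤ 16 * (k : ℝ) ^ 4 / (n : ℝ) ^ 2 * (2 ^ l * (8 * L + 2)) *
        ((2 * L + 1) * ∑ j ∈ Finset.range (l + 1), 2 * (n : ℝ) / k) := by
        have := Finset.sum_le_sum h1
        gcongr
    _ = _ := by
        rw [Finset.sum_const, Finset.card_range, nsmul_eq_mul]
        push_cast
        field_simp
        ring

/-- The walk after `m` steps compared with the Poisson vector. -/
theorem abs_integral_position_sub_le (hπ₀ : Measurable π₀) (hγ : ∀ m, Measurable (γ m))
    (hind : iIndepFun γ μ) (hind₀ : IndepFun π₀ (fun ω i => γ i ω) μ) {k l : ℕ}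
    (hlaw : ∀ m, HasLaw (γ m) (uniformOn (kCycles k n)) μ) (hne : (kCycles k n).Nonempty)
    (hk : 2 ≤ k) (hn : 2 * k ≤ n) (hK : k * 2 ^ l ≤ n) {L : ℝ} (hL : 0 ≤ L) {B : ℕ → ℝ}
    (hB0 : ∀ j, 0 ≤ B j)
    (hB : ∀ᵐ ω ∂μ, π₀ ω ∈ balanced n l L → ∀ j ≤ l, (stripCount (π₀ ω) j : ℝ) ≤ B j)
    {f : Multiset ℕ → ℝ} (hf1 : ∀ s, |f s| ≤ 1)
    (hf : IsLip (weight (deathRate k n) (2 ^ l) 0) f) (m : ℕ) :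
    |∫ ω, f (smallParts (2 ^ l) (position (π₀ ω) (fun i => γ i ω) m)) ∂μ
        - ∫ z, f (config z) ∂poissonVectorLaw (2 ^ l)|
      ≤ 2 * μ.real {ω | ∃ r < m, position (π₀ ω) (fun i => γ i ω) r ∉ balanced n l L}
        + 2 * μ.real {ω | π₀ ω ∉ balanced n l L}
        + ∑ j ∈ Finset.range (l + 1), (B j + 1) * (2 * (1 - deathRate k n (2 ^ j)) ^ m)
        + (32 * (k : ℝ) ^ 3 / n * 2 ^ l * (8 * L + 2) * (2 * L + 1) * (l + 1)
          + 20 * (k / n) * 2 ^ l * (1 + Real.log (2 ^ l))) := by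
  have hn0 : 0 < n := by omega
  have hnR : (0 : ℝ) < n := by exact_mod_cast hn0
  have hkR : (0 : ℝ) < k := by exact_mod_cast (by omega : 0 < k)
  have hp0 := deathRate_nonneg k n
  have hp1 := deathRate_le_one k n
  have hc0 : (0 : ℝ) < k / n := by positivity
  have hc1 : (k : ℝ) / n ≤ 1 := by
    rw [div_le_one hnR]; exact_mod_cast (by omega : k ≤ n)
  have hpc : ∀ i ∈ Finset.Icc 1 (2 ^ l), deathRate k n i = k / n * i := fun i hi => by
    rw [deathRate_eq hn0 hK (Finset.mem_Icc.1 hi).2]; ring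
  set p := deathRate k n with hp
  set c : ℝ := k / n with hc
  set h : ℕ → Equiv.Perm (Fin n) → ℝ := fun r σ =>
    (step p c (2 ^ l))^[r] f (smallParts (2 ^ l) σ) with hh
  have hanti : ∀ m, Antitone (weight p (2 ^ l) m) := weight_antitone hp1 (deathRate_mono k n) _
  have hbound : ∀ r s, |(step p c (2 ^ l))^[r] f s| ≤ 1 :=
    fun r => abs_iterate_step_le hp0 hp1 hc0.le hc1 _ hf1 r
  have h1 := abs_integral_walk_sub_le hπ₀ hγ hind hind₀ hlaw (balanced n l L) (h := h)
    (fun r σ => hbound r _)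
    (ε := fun r => 16 * (k : ℝ) ^ 4 / (n : ℝ) ^ 2 * (2 ^ l * (8 * L + 2)) *
        ((2 * L + 1) * ∑ j ∈ Finset.range (l + 1), 2 ^ j * weight p (2 ^ l) r (2 ^ j)))
    (fun r => by
      have : 0 ≤ ∑ j ∈ Finset.range (l + 1), 2 ^ j * weight p (2 ^ l) r (2 ^ j) :=
        Finset.sum_nonneg fun j _ => mul_nonneg (by positivity) (weight_nonneg hp1 _ _ _)
      positivity)
    (fun r σ hσ => by
      have := uniformOn_kCycles_step_error hk hn hK hne
        (iterate_step_isLip hp0 hp1 hc0.le hc1 hf r) (hanti r) (fun a => weight_eq_zero) hσ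
      simpa only [hh, Function.iterate_succ_apply'] using this) m
  have h2 := sum_step_error_le (n := n) (by omega : 0 < k) hn0 hK hL m
  set I := ∫ z, f (config z) ∂poissonVectorLaw (2 ^ l) with hI
  set R := ∑ j ∈ Finset.range (l + 1), (B j + 1) * (2 * (1 - p (2 ^ j)) ^ m) with hR
  set Q : ℝ := 20 * c * 2 ^ l * (1 + Real.log (2 ^ l)) with hQ
  have hQ0 : 0 ≤ Q := by
    have : 0 ≤ Real.log ((2 : ℝ) ^ l) := Real.log_nonneg (one_le_pow₀ one_le_two)
    positivity
  have hR0 : 0 ≤ R := Finset.sum_nonneg fun j _ => mul_nonneg (by linarith [hB0 j])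
    (mul_nonneg zero_le_two (pow_nonneg (sub_nonneg.2 (hp1 _)) _))
  have hI1 : |I| ≤ 1 := by
    have := norm_integral_le_of_norm_le_const (μ := poissonVectorLaw (2 ^ l)) (C := 1)
      (f := fun z => f (config z)) (ae_of_all _ fun z => hf1 _)
    simpa using this
  have hmS : MeasurableSet {ω | π₀ ω ∉ balanced n l L} :=
    hπ₀ (MeasurableSet.of_discrete (s := (balanced n l L)ᶜ))
  have hhi : Integrable (fun ω => h m (π₀ ω)) μ :=
    Integrable.of_bound ((measurable_of_countable (h m)).comp hπ₀).aestronglyMeasurable 1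
      (ae_of_all _ fun ω => hbound m _)
  -- From a balanced start the chain has nearly reached the Poisson vector; from any other start the
  -- difference is bounded by `2`.
  have h3 : |∫ ω, h m (π₀ ω) ∂μ - I| ≤ 2 * μ.real {ω | π₀ ω ∉ balanced n l L} + (R + Q) := by
    have e1 : ∫ ω, h m (π₀ ω) ∂μ - I = ∫ ω, (h m (π₀ ω) - I) ∂μ := by
      rw [integral_sub hhi (integrable_const _)]; simp
    have e2 : ∫ ω, ({ω | π₀ ω ∉ balanced n l L}.indicator (fun _ => (2 : ℝ)) ω + (R + Q)) ∂μ
        = 2 * μ.real {ω | π₀ ω ∉ balanced n l L} + (R + Q) := by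
      rw [integral_add ((integrable_const _).indicator hmS) (integrable_const _),
        integral_indicator_const _ hmS]
      simp [mul_comm]
    rw [e1, ← e2]
    refine abs_integral_le_integral_abs.trans (integral_mono_ae
      (hhi.sub (integrable_const _)).abs
      (((integrable_const _).indicator hmS).add (integrable_const _)) ?_)
    filter_upwards [hB] with ω hω
    by_cases hG : π₀ ω ∈ balanced n l L
    · have h4 := abs_iterate_step_sub_integral_le hp0 hp1 hc0 hc1 hpc hf1 hf m
        (smallParts (2 ^ l) (π₀ ω))
      have h5 := sum_map_smallParts_le_strips (weight_nonneg hp1 (2 ^ l) m) (hanti m) l (π₀ ω)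
      have h6 := sum_div_le_strips (weight_nonneg hp1 (2 ^ l) m) (hanti m) l
      -- In `B j + 1`, the `1` bounds the mean number of Poisson particles in a strip.
      have h7 : ∑ j ∈ Finset.range (l + 1), (stripCount (π₀ ω) j : ℝ) * weight p (2 ^ l) m (2 ^ j)
          + ∑ j ∈ Finset.range (l + 1), weight p (2 ^ l) m (2 ^ j) ≤ R := by
        rw [← Finset.sum_add_distrib]
        refine Finset.sum_le_sum fun j hj => ?_
        have hj' : j ≤ l := by have := Finset.mem_range.1 hj; omega
        rw [← weight_eq (Nat.pow_le_pow_right two_pos hj'), add_mul, one_mul]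
        have := weight_nonneg hp1 (2 ^ l) m (2 ^ j)
        have := hω hG j hj'
        gcongr
      push_cast at h4
      have e3 : {ω | π₀ ω ∉ balanced n l L}.indicator (fun _ => (2 : ℝ)) ω = 0 :=
        Set.indicator_of_notMem (not_not_intro hG) _
      rw [e3]
      simp only [hh]
      linarith
    · have e3 : {ω | π₀ ω ∉ balanced n l L}.indicator (fun _ => (2 : ℝ)) ω = 2 :=
        Set.indicator_of_mem (show π₀ ω ∉ balanced n l L from hG) _
      rw [e3]
      have h9 := abs_sub (h m (π₀ ω)) I
      have h10 : |h m (π₀ ω)| ≤ 1 := hbound m _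
      linarith
  have h8 : ∀ σ, h 0 σ = f (smallParts (2 ^ l) σ) := fun σ => rfl
  simp only [h8] at h1
  refine (abs_sub_le _ (∫ ω, h m (π₀ ω) ∂μ) _).trans ?_
  linarith

end FixedTime

end KCycleWalk

/-! ### The walk after a Poisson number of steps -/

namespace KCycleWalk

section PoissonTime

variable {n : ℕ} {Ω : Type*} [MeasurableSpace Ω] {μ : Measure Ω} [IsProbabilityMeasure μ]
  {π₀ : Ω → Equiv.Perm (Fin n)} {γ : ℕ → Ω → Equiv.Perm (Fin n)}

/-- The walk at a Poisson number of steps compared with the Poisson vector. -/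
theorem abs_integral_position_poisson_sub_le (hπ₀ : Measurable π₀) (hγ : ∀ m, Measurable (γ m))
    (hind : iIndepFun γ μ) (hind₀ : IndepFun π₀ (fun ω i => γ i ω) μ) {k l : ℕ}
    (hlaw : ∀ m, HasLaw (γ m) (uniformOn (kCycles k n)) μ) (hne : (kCycles k n).Nonempty)
    (hk : 2 ≤ k) (hn : 2 * k ≤ n) (hK : k * 2 ^ l ≤ n) {L : ℝ} (hL : 0 ≤ L) {B : ℕ → ℝ}
    (hB0 : ∀ j, 0 ≤ B j)
    (hB : ∀ᵐ ω ∂μ, π₀ ω ∈ balanced n l L → ∀ j ≤ l, (stripCount (π₀ ω) j : ℝ) ≤ B j)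
    {f : Multiset ℕ → ℝ} (hf1 : ∀ s, |f s| ≤ 1)
    (hf : IsLip (weight (deathRate k n) (2 ^ l) 0) f) {Z : Ω → ℕ} (hZ : Measurable Z) {t : ℝ≥0}
    (hZt : HasLaw Z (poissonMeasure t) μ)
    (hindZ : IndepFun (fun ω => (π₀ ω, fun i => γ i ω)) Z μ) :
    |∫ ω, f (smallParts (2 ^ l) (position (π₀ ω) (fun i => γ i ω) (Z ω))) ∂μ
        - ∫ z, f (config z) ∂poissonVectorLaw (2 ^ l)|
      ≤ 2 * μ.real {ω | ∃ r < Z ω, position (π₀ ω) (fun i => γ i ω) r ∉ balanced n l L}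
        + 2 * μ.real {ω | π₀ ω ∉ balanced n l L}
        + ∑ j ∈ Finset.range (l + 1), (B j + 1) * (2 * Real.exp (-(t * deathRate k n (2 ^ j))))
        + (32 * (k : ℝ) ^ 3 / n * 2 ^ l * (8 * L + 2) * (2 * L + 1) * (l + 1)
          + 20 * (k / n) * 2 ^ l * (1 + Real.log (2 ^ l))) := by
  classical
  have hX : Measurable fun ω => (π₀ ω, fun i => γ i ω) := hπ₀.prodMk (measurable_pi_lambda _ hγ)
  set I := ∫ z, f (config z) ∂poissonVectorLaw (2 ^ l) with hI
  set C : ℝ := 32 * (k : ℝ) ^ 3 / n * 2 ^ l * (8 * L + 2) * (2 * L + 1) * (l + 1)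
          + 20 * (k / n) * 2 ^ l * (1 + Real.log (2 ^ l)) with hC
  set φ : ℕ → ℝ := fun m =>
    ∫ ω, f (smallParts (2 ^ l) (position (π₀ ω) (fun i => γ i ω) m)) ∂μ with hφ
  set E : ℕ → Set Ω := fun m =>
    {ω | ∃ r < m, position (π₀ ω) (fun i => γ i ω) r ∉ balanced n l L} with hE
  have hmE' : ∀ m, MeasurableSet {x : Equiv.Perm (Fin n) × (ℕ → Equiv.Perm (Fin n)) |
      ∃ r < m, position x.1 x.2 r ∉ balanced n l L} := by
    intro m
    have : {x : Equiv.Perm (Fin n) × (ℕ → Equiv.Perm (Fin n)) |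
        ∃ r < m, position x.1 x.2 r ∉ balanced n l L}
        = ⋃ r, ⋃ (_ : r < m), {x | position x.1 x.2 r ∉ balanced n l L} := by
      ext x; simp
    rw [this]
    exact MeasurableSet.iUnion fun r => MeasurableSet.iUnion fun _ =>
      measurable_position r (MeasurableSet.of_discrete (s := (balanced n l L)ᶜ))
  have hmE : ∀ m, MeasurableSet (E m) := fun m => hX (hmE' m)
  have h1 : ∫ ω, f (smallParts (2 ^ l) (position (π₀ ω) (fun i => γ i ω) (Z ω))) ∂μ
      = ∫ m, φ m ∂poissonMeasure t := by
    rw [← hZt.map_eq]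
    refine integral_indep_eq_symm hX hZ hindZ (B := 1) (Ψ := fun x =>
      f (smallParts (2 ^ l) (position x.1.1 x.1.2 x.2))) ?_ fun x => hf1 _
    exact measurable_from_prod_countable_left fun m =>
      (measurable_of_countable fun σ => f (smallParts (2 ^ l) σ)).comp (measurable_position m)
  have h2 : μ.real {ω | ∃ r < Z ω, position (π₀ ω) (fun i => γ i ω) r ∉ balanced n l L}
      = ∫ m, μ.real (E m) ∂poissonMeasure t := by
    have h3 := integral_indep_eq_symm hX hZ hindZ (B := 1)
      (Ψ := fun x : (Equiv.Perm (Fin n) × (ℕ → Equiv.Perm (Fin n))) × ℕ =>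
        {x | ∃ r < x.2, position x.1.1 x.1.2 r ∉ balanced n l L}.indicator (fun _ => (1 : ℝ)) x)
      (measurable_from_prod_countable_left fun m => by
        have h5 : Measurable ({x : Equiv.Perm (Fin n) × (ℕ → Equiv.Perm (Fin n)) |
          ∃ r < m, position x.1 x.2 r ∉ balanced n l L}.indicator fun _ => (1 : ℝ)) :=
          measurable_const.indicator (hmE' m)
        exact h5)
      (fun x => by rw [Set.indicator_apply]; split_ifs <;> simp)
    rw [hZt.map_eq] at h3
    have e1 : ∀ m, ∫ ω, (E m).indicator (fun _ => (1 : ℝ)) ω ∂μ = μ.real (E m) := fun m => by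
      rw [integral_indicator_const _ (hmE m)]; simp
    have hmZ : MeasurableSet
        {ω | ∃ r < Z ω, position (π₀ ω) (fun i => γ i ω) r ∉ balanced n l L} := by
      have : {ω | ∃ r < Z ω, position (π₀ ω) (fun i => γ i ω) r ∉ balanced n l L}
          = ⋃ m, (Z ⁻¹' {m} ∩ E m) := by
        ext ω; simp [hE]
      rw [this]
      exact MeasurableSet.iUnion fun m => (hZ (measurableSet_singleton m)).inter (hmE m)
    have e2 : ∫ ω, {ω | ∃ r < Z ω, position (π₀ ω) (fun i => γ i ω) r ∉ balanced n l L}.indicator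
        (fun _ => (1 : ℝ)) ω ∂μ
        = μ.real {ω | ∃ r < Z ω, position (π₀ ω) (fun i => γ i ω) r ∉ balanced n l L} := by
      rw [integral_indicator_const _ hmZ]; simp
    rw [← e2]
    simp only [← e1]
    exact h3
  have hφi : Integrable φ (poissonMeasure t) := by
    refine Integrable.of_bound AEStronglyMeasurable.of_discrete 1 (ae_of_all _ fun m => ?_)
    have := norm_integral_le_of_norm_le_const (μ := μ) (C := 1)
      (f := fun ω => f (smallParts (2 ^ l) (position (π₀ ω) (fun i => γ i ω) m)))
      (ae_of_all _ fun z => hf1 _)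
    simpa using this
  have hEi : Integrable (fun m => μ.real (E m)) (poissonMeasure t) := by
    refine Integrable.of_bound AEStronglyMeasurable.of_discrete 1 (ae_of_all _ fun m => ?_)
    rw [Real.norm_eq_abs, abs_of_nonneg measureReal_nonneg]
    exact measureReal_le_one
  have hqi : ∀ j, Integrable (fun m : ℕ => (1 - deathRate k n (2 ^ j)) ^ m) (poissonMeasure t) := by
    intro j
    have h0 := deathRate_nonneg k n (2 ^ j)
    have h1 := deathRate_le_one k n (2 ^ j)
    refine Integrable.of_bound AEStronglyMeasurable.of_discrete 1 (ae_of_all _ fun m => ?_)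
    rw [Real.norm_eq_abs, abs_of_nonneg (pow_nonneg (by linarith) m)]
    exact pow_le_one₀ (by linarith) (by linarith)
  have hsi : Integrable (fun m : ℕ => ∑ j ∈ Finset.range (l + 1),
      (B j + 1) * (2 * (1 - deathRate k n (2 ^ j)) ^ m)) (poissonMeasure t) :=
    integrable_finsetSum _ fun j _ => ((hqi j).const_mul 2).const_mul _
  -- The generating function of the Poisson law turns survival over `m` steps into survival up to
  -- continuous time `t`.
  have h4 : ∫ m : ℕ, ∑ j ∈ Finset.range (l + 1),
      (B j + 1) * (2 * (1 - deathRate k n (2 ^ j)) ^ m) ∂poissonMeasure t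
      = ∑ j ∈ Finset.range (l + 1), (B j + 1) * (2 * Real.exp (-(t * deathRate k n (2 ^ j)))) := by
    rw [integral_finsetSum _ fun j _ => ((hqi j).const_mul 2).const_mul _]
    refine Finset.sum_congr rfl fun j _ => ?_
    rw [integral_const_mul, integral_const_mul, integral_pow_poissonMeasure, sub_sub_cancel]
  have e3 : ∫ m, φ m ∂poissonMeasure t - I = ∫ m, (φ m - I) ∂poissonMeasure t := by
    rw [integral_sub hφi (integrable_const _)]; simp
  rw [h1, h2, e3, ← h4]
  have hc : ∀ c : ℝ, Integrable (fun _ : ℕ => c) (poissonMeasure t) := fun c => integrable_const c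
  have key := integral_mono (hφi.sub (hc I)).abs
    ((((hEi.const_mul 2).add (hc (2 * μ.real {ω | π₀ ω ∉ balanced n l L}))).add hsi).add (hc C))
    (fun m => abs_integral_position_sub_le hπ₀ hγ hind hind₀ hlaw hne hk hn hK hL hB0 hB hf1 hf m)
  refine (abs_integral_le_integral_abs.trans key).trans_eq ?_
  rw [integral_add' (((hEi.const_mul 2).add (hc _)).add hsi) (hc C),
    integral_add' ((hEi.const_mul 2).add (hc _)) hsi, integral_add' (hEi.const_mul 2) (hc _),
    integral_const_mul]
  simp

end PoissonTime

/-! ### Total variation through test functions -/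

section TotalVariation

/-- Total variation is tested by functions of modulus at most one. -/
theorem tvDist_le_of_forall_integral {S : Type*} [MeasurableSpace S] [Countable S]
    [DiscreteMeasurableSpace S] {ρ ν : Measure S} [IsProbabilityMeasure ρ] [IsProbabilityMeasure ν]
    {δ : ℝ} (h : ∀ F : S → ℝ, (∀ x, |F x| ≤ 1) → |∫ x, F x ∂ρ - ∫ x, F x ∂ν| ≤ δ) :
    tvDist ρ ν ≤ 1 / 2 * δ := by
  -- The sign of the difference of the point masses is the extremal test function.
  set F : S → ℝ := fun x => SignType.sign (ρ.real {x} - ν.real {x}) with hF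
  have hF1 : ∀ x, |F x| ≤ 1 := fun x => by
    simp only [hF]
    rcases lt_trichotomy (ρ.real {x} - ν.real {x}) 0 with h | h | h
    · simp [sign_neg h]
    · simp [h]
    · simp [sign_pos h]
  have hi : ∀ (m : Measure S) [IsProbabilityMeasure m], Integrable F m := fun m _ =>
    Integrable.of_bound AEStronglyMeasurable.of_discrete 1 (ae_of_all _ hF1)
  have hs : ∀ (m : Measure S) [IsProbabilityMeasure m], Summable fun x => m.real {x} * F x := by
    intro m _
    refine Summable.of_norm_bounded (g := fun x => m.real {x}) ?_ fun x => ?_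
    · have : ∑' x, m {x} ≠ ∞ := by
        have h0 := lintegral_countable' (μ := m) fun _ : S => (1 : ℝ≥0∞)
        simp only [one_mul, lintegral_const, measure_univ] at h0
        rw [← h0]
        exact ENNReal.one_ne_top
      exact ENNReal.summable_toReal this
    · rw [norm_mul, Real.norm_eq_abs, abs_of_nonneg measureReal_nonneg]
      exact mul_le_of_le_one_right measureReal_nonneg (hF1 x)
  have e := h F hF1
  rw [integral_countable (hi ρ), integral_countable (hi ν)] at e
  simp only [smul_eq_mul] at e
  rw [← (hs ρ).tsum_sub (hs ν)] at e
  rw [tvDist]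
  refine mul_le_mul_of_nonneg_left (le_trans (le_of_eq ?_) ((le_abs_self _).trans e)) (by norm_num)
  refine tsum_congr fun x => ?_
  rw [← sub_mul, hF, mul_comm, sign_mul_self]

theorem tvDist_nonneg {S : Type*} [MeasurableSpace S] (ρ ν : Measure S) : 0 ≤ tvDist ρ ν :=
  mul_nonneg (by norm_num) (tsum_nonneg fun _ => abs_nonneg _)

end TotalVariation

end KCycleWalk

/-! ### The bound for a fixed number of points -/

namespace KCycleWalk

section MainEstimate

variable {n : ℕ}

/-- A test function bounded by `1` oscillates by at most `2` and does not see sizes above `K`; no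
regularity of `F` is needed, so total variation can be reached. -/
theorem isLip_comp_count {p : ℕ → ℝ} {K : ℕ} {F : (Fin K → ℕ) → ℝ} (hF : ∀ z, |F z| ≤ 1) :
    IsLip (weight p K 0) fun s => F fun i : Fin K => s.count ((i : ℕ) + 1) := by
  intro a s
  by_cases ha : a ≤ K
  · rw [weight_eq ha, pow_zero, mul_one]
    refine (abs_sub _ _).trans ?_
    linarith [hF fun i : Fin K => (a ::ₘ s).count ((i : ℕ) + 1),
      hF fun i : Fin K => s.count ((i : ℕ) + 1)]
  · rw [weight_eq_zero (not_le.1 ha)]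
    have e : (fun i : Fin K => (a ::ₘ s).count ((i : ℕ) + 1))
        = fun i : Fin K => s.count ((i : ℕ) + 1) := by
      funext i
      exact Multiset.count_cons_of_ne (by have := i.2; omega) s
    simp only [e, sub_self, abs_zero, le_refl]

/-- From `x ^ 7 / 7! ≤ exp x`. The power `7` is one more than the `6` in `64 ^ j = (2 ^ j) ^ 6`, so
a factor `2 ^ (-j)` remains in `sum_exp_le` and makes its bound uniform in `l`. -/
theorem exp_neg_le {x : ℝ} (hx : 0 < x) : Real.exp (-x) ≤ 5040 / x ^ 7 := by
  have h := Real.pow_div_factorial_le_exp x hx.le 7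
  have e : ((Nat.factorial 7 : ℕ) : ℝ) = 5040 := by norm_num [Nat.factorial]
  rw [e] at h
  rw [Real.exp_neg, inv_eq_one_div, div_le_div_iff₀ (Real.exp_pos x) (by positivity)]
  rw [div_le_iff₀ (by norm_num)] at h
  linarith

theorem sum_exp_le {D u : ℝ} (hD : 0 ≤ D) (hu : 0 < u) {q : ℕ → ℝ} {l : ℕ}
    (hq : ∀ j ≤ l, u * 2 ^ j ≤ q j) :
    ∑ j ∈ Finset.range (l + 1), ((D + 1) * 64 ^ j + 1) * (2 * Real.exp (-q j))
      ≤ 20160 * (D + 2) / u ^ 7 := by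
  have h1 : ∀ j ∈ Finset.range (l + 1), ((D + 1) * 64 ^ j + 1) * (2 * Real.exp (-q j))
      ≤ 10080 * (D + 2) / u ^ 7 * (1 / 2) ^ j := by
    intro j hj
    have hj' : j ≤ l := by have := Finset.mem_range.1 hj; omega
    have h2 : Real.exp (-q j) ≤ 5040 / (u * 2 ^ j) ^ 7 :=
      (Real.exp_le_exp.2 (neg_le_neg (hq j hj'))).trans (exp_neg_le (by positivity))
    have h3 : (D + 1) * 64 ^ j + 1 ≤ (D + 2) * 64 ^ j := by
      have : (1 : ℝ) ≤ 64 ^ j := one_le_pow₀ (by norm_num)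
      linarith
    calc _ ≤ ((D + 2) * 64 ^ j) * (2 * (5040 / (u * 2 ^ j) ^ 7)) := by gcongr
      _ = 10080 * (D + 2) / u ^ 7 * (64 ^ j / (2 ^ j) ^ 7) := by
        rw [mul_pow]; field_simp; ring
      _ = _ := by
        congr 1
        rw [← pow_mul, mul_comm j 7, pow_mul, ← div_pow]
        norm_num
  refine (Finset.sum_le_sum h1).trans ?_
  rw [← Finset.mul_sum]
  have h4 : ∑ j ∈ Finset.range (l + 1), (1 / 2 : ℝ) ^ j ≤ 2 := by
    have := sum_range_pow_le (q := 1 / 2) (by norm_num) (by norm_num) (l + 1)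
    norm_num at this ⊢
    exact this
  calc _ ≤ 10080 * (D + 2) / u ^ 7 * 2 := by gcongr
    _ = _ := by ring

/-- Low strips obey the hypothesis on the start. In the others `log n < 2 ^ j`, so the overflow
level `(log n) ^ 6 / 2` is below `64 ^ j`. One bound that does not involve `n` serves all strips. -/
theorem stripCount_le_of_balanced {l : ℕ} {D : ℝ} (hD : 0 ≤ D) (hn : 2 ≤ n)
    {σ : Equiv.Perm (Fin n)}
    (hσ : ∀ j : ℕ, (j : ℝ) ≤ Real.logb 2 (Real.log n) →
      (stripCount σ j : ℝ) ≤ D * Real.log (j + 2))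
    (hb : σ ∈ balanced n l (Real.log n ^ 6 / 2)) {j : ℕ} (hj : j ≤ l) :
    (stripCount σ j : ℝ) ≤ (D + 1) * 64 ^ j := by
  have hlog : 0 < Real.log n := Real.log_pos (by exact_mod_cast hn)
  by_cases h : (j : ℝ) ≤ Real.logb 2 (Real.log n)
  · refine (hσ j h).trans ?_
    have h1 : Real.log ((j : ℝ) + 2) ≤ 64 ^ j := by
      have h2 := Real.log_le_sub_one_of_pos (show (0 : ℝ) < j + 2 by positivity)
      have h3 : (j : ℝ) + 1 ≤ 2 ^ j := by exact_mod_cast Nat.lt_two_pow_self (n := j)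
      have h4 : (2 : ℝ) ^ j ≤ 64 ^ j := pow_le_pow_left₀ (by norm_num) (by norm_num) j
      linarith
    have h5 : (0 : ℝ) < 64 ^ j := by positivity
    nlinarith
  · rw [not_le, Real.logb_lt_iff_lt_rpow one_lt_two hlog, Real.rpow_natCast] at h
    have h1 := hb j (by omega)
    have h2 : Real.log n ^ 6 ≤ (2 ^ j) ^ 6 := pow_le_pow_left₀ hlog.le h.le 6
    have h3 : ((2 : ℝ) ^ j) ^ 6 = 64 ^ j := by
      rw [← pow_mul, mul_comm j 6, pow_mul]; norm_num
    rw [h3] at h2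
    have h5 : (0 : ℝ) < 64 ^ j := by positivity
    nlinarith

theorem overflowTime_lt_of_not_balanced {Ω : Type*} {π : ℝ≥0 → Ω → Equiv.Perm (Fin n)}
    {l : ℕ} {ω : Ω} {r : ℝ≥0} {T : ℝ≥0∞} (hr : (r : ℝ≥0∞) < T)
    (h : π r ω ∉ balanced n l (Real.log n ^ 6 / 2)) : overflowTime l π ω < T := by
  have h' : ∃ j : ℕ, j ≤ l + 1 ∧ Real.log n ^ 6 / 2 < (stripCount (π r ω) j : ℝ) := by
    by_contra! hc
    exact h fun j hj => hc j hj
  exact lt_of_le_of_lt (sInf_le ⟨r, rfl, h'⟩) hr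

variable {Ω : Type*} [MeasurableSpace Ω] {μ : Measure Ω} [IsProbabilityMeasure μ]
  {π : ℝ≥0 → Ω → Equiv.Perm (Fin n)}

/-- The total variation bound for a fixed number of points. -/
theorem tvDist_smallCycleLaw_le {k l : ℕ} (hπ : IsKCycleWalk k n π μ) (hk : 2 ≤ k)
    (hn : 2 * k ≤ n) (hK : k * 2 ^ l ≤ n) {D : ℝ} (hD : 0 ≤ D)
    (hM : ∀ᵐ ω ∂μ, ∀ j : ℕ, (j : ℝ) ≤ Real.logb 2 (Real.log n) →
      (stripCount (π 0 ω) j : ℝ) ≤ D * Real.log (j + 2))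
    {t : ℝ≥0} (ht0 : 0 < t) (ht : (t : ℝ) ≤ n * Real.log n) :
    tvDist (smallCycleLaw μ (2 ^ l) (π t)) (poissonVectorLaw (2 ^ l)) ≤
      1 / 2 * (4 * μ.real {ω | overflowTime l π ω < ENNReal.ofReal (n * Real.log n)}
        + 20160 * (D + 2) / ((t : ℝ) / n) ^ 7
        + (32 * (k : ℝ) ^ 3 / n * 2 ^ l * (8 * (Real.log n ^ 6 / 2) + 2) *
            (2 * (Real.log n ^ 6 / 2) + 1) * (l + 1)
          + 20 * (k / n) * 2 ^ l * (1 + Real.log (2 ^ l)))) := by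
  obtain ⟨π₀, γ, N, hπ₀, hγ, hlaw, hind, hN, hγN, hπγN, hwalk⟩ := hπ
  have hn0 : 0 < n := by omega
  have hnR : (0 : ℝ) < n := by exact_mod_cast hn0
  have hlog : 0 < Real.log n := Real.log_pos (by exact_mod_cast (by omega : 1 < n))
  have hwalk' : ∀ s ω, π s ω = position (π₀ ω) (fun i => γ i ω) (N s ω) := hwalk
  -- Without `k`-cycles `uniformOn` would be the zero measure, which is not the law of a random
  -- variable.
  have hne : (kCycles k n).Nonempty := by
    by_contra h
    rw [Set.not_nonempty_iff_eq_empty] at h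
    have h1 := (hlaw 0).map_eq
    rw [h, uniformOn_empty_meas] at h1
    have := Measure.isProbabilityMeasure_map (μ := μ) (hγ 0).aemeasurable
    rw [h1] at this
    exact IsProbabilityMeasure.ne_zero (0 : Measure (Equiv.Perm (Fin n))) rfl
  have hγ' : Measurable fun ω i => γ i ω := measurable_pi_lambda _ hγ
  have hind₀ : IndepFun π₀ (fun ω i => γ i ω) μ :=
    hπγN.comp (φ := id) (ψ := Prod.fst) measurable_id measurable_fst
  have hindZ : IndepFun (fun ω => (π₀ ω, fun i => γ i ω)) (N t) μ := by
    refine indepFun_prodMk_left hπ₀ hγ' (hN.measurable t) ?_ ?_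
    · exact hπγN.comp (φ := id) (ψ := fun x : (ℕ → Equiv.Perm (Fin n)) × (ℝ≥0 → ℕ) => (x.1, x.2 t))
        measurable_id (measurable_fst.prodMk ((measurable_pi_apply t).comp measurable_snd))
    · exact hγN.comp (φ := id) (ψ := fun x : ℝ≥0 → ℕ => x t) measurable_id (measurable_pi_apply t)
  have hzero : ∀ᵐ ω ∂μ, π 0 ω = π₀ ω := by
    filter_upwards [hN.zero] with ω hω
    rw [hwalk', hω, position_zero]
  have hB : ∀ᵐ ω ∂μ, π₀ ω ∈ balanced n l (Real.log n ^ 6 / 2) →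
      ∀ j ≤ l, (stripCount (π₀ ω) j : ℝ) ≤ (D + 1) * 64 ^ j := by
    filter_upwards [hM, hzero] with ω h1 h2 h3 j hj
    rw [h2] at h1
    exact stripCount_le_of_balanced hD (by omega) h1 h3 hj
  set P := μ.real {ω | overflowTime l π ω < ENNReal.ofReal (n * Real.log n)} with hP
  -- Each position before step `N t` is occupied at a real time `r < t ≤ n log n`, so an unbalanced
  -- one means overflow before `n log n`. Time `0` is treated likewise in `hP2`, and the two factors
  -- `2` add up to `4`.
  have hP1 : μ.real {ω | ∃ r < N t ω, position (π₀ ω) (fun i => γ i ω) r ∉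
      balanced n l (Real.log n ^ 6 / 2)} ≤ P := by
    refine ENNReal.toReal_mono (measure_ne_top _ _) ((hN.measure_exists_state_le t
      (fun r ω => position (π₀ ω) (fun i => γ i ω) r ∉ balanced n l (Real.log n ^ 6 / 2))).trans
      (measure_mono ?_))
    rintro ω ⟨r, hr, h⟩
    refine overflowTime_lt_of_not_balanced (r := r) ?_ (by rw [hwalk']; exact h)
    rw [← ENNReal.ofReal_coe_nnreal]
    refine (ENNReal.ofReal_lt_ofReal_iff (by positivity)).2 (lt_of_lt_of_le ?_ ht)
    exact_mod_cast hr
  have hP2 : μ.real {ω | π₀ ω ∉ balanced n l (Real.log n ^ 6 / 2)} ≤ P := by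
    refine ENNReal.toReal_mono (measure_ne_top _ _) (measure_mono_ae ?_)
    filter_upwards [hzero] with ω hω h
    refine overflowTime_lt_of_not_balanced (r := 0) ?_ (by rw [hω]; exact h)
    rw [ENNReal.coe_zero]
    exact ENNReal.ofReal_pos.2 (by positivity)
  have hmeas : Measurable fun ω (i : Fin (2 ^ l)) => cycleCount (π t ω) (i + 1) := by
    have : Measurable (π t) := by
      have e : π t = (fun x : (Equiv.Perm (Fin n) × (ℕ → Equiv.Perm (Fin n))) × ℕ =>
          position x.1.1 x.1.2 x.2) ∘ fun ω => ((π₀ ω, fun i => γ i ω), N t ω) := by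
        funext ω; exact hwalk' t ω
      rw [e]
      exact (measurable_from_prod_countable_left fun m => measurable_position m).comp
        ((hπ₀.prodMk hγ').prodMk (hN.measurable t))
    exact (measurable_of_countable fun (σ : Equiv.Perm (Fin n)) (i : Fin (2 ^ l)) =>
      cycleCount σ (i + 1)).comp this
  have : IsProbabilityMeasure (smallCycleLaw μ (2 ^ l) (π t)) :=
    Measure.isProbabilityMeasure_map hmeas.aemeasurable
  refine tvDist_le_of_forall_integral fun F hF => ?_
  have key := abs_integral_position_poisson_sub_le hπ₀ hγ hind hind₀ hlaw hne hk hn hK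
    (L := Real.log n ^ 6 / 2) (by positivity) (B := fun j => (D + 1) * 64 ^ j)
    (fun j => by positivity) hB
    (f := fun s => F fun i : Fin (2 ^ l) => s.count ((i : ℕ) + 1)) (fun s => hF _)
    (isLip_comp_count hF) (hN.measurable t) (hN.hasLaw t) hindZ
  have e1 : ∫ x, F x ∂smallCycleLaw μ (2 ^ l) (π t) = ∫ ω, F (fun i : Fin (2 ^ l) =>
      (smallParts (2 ^ l) (position (π₀ ω) (fun i => γ i ω) (N t ω))).count ((i : ℕ) + 1)) ∂μ := by
    rw [smallCycleLaw, integral_map hmeas.aemeasurable AEStronglyMeasurable.of_discrete]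
    refine integral_congr_ae (ae_of_all _ fun ω => ?_)
    simp only [hwalk']
    congr 1
    funext i
    rw [count_smallParts (by have := i.2; omega)]
  simp only [count_config] at key
  rw [e1]
  have hexp := sum_exp_le (l := l) hD (u := (t : ℝ) / n) (by positivity)
    (q := fun j => t * deathRate k n (2 ^ j)) (fun j hj => by
      rw [deathRate_eq hn0 hK (Nat.pow_le_pow_right two_pos hj)]
      push_cast
      have h1 : (1 : ℝ) ≤ k := by exact_mod_cast (by omega : 1 ≤ k)
      calc (t : ℝ) / n * 2 ^ j = t * (1 * 2 ^ j / n) := by ring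
        _ ≤ t * (k * 2 ^ j / n) := by gcongr)
  refine key.trans ?_
  linarith

end MainEstimate

/-! ### Asymptotics in the number of points -/

section Asymptotics

/-- If `2 ^ l` exceeded `2 * x`, its half would still be above `x` and therefore closer to it. -/
theorem IsClosestDyadic.two_pow_le {l : ℕ} {x : ℝ} (h : IsClosestDyadic l x) (hx : 1 ≤ x) :
    (2 : ℝ) ^ l ≤ 2 * x := by
  by_contra! hc
  cases l with
  | zero => norm_num at hc; linarith
  | succ m =>
    have h1 := h m
    rw [pow_succ] at hc h1
    rw [abs_of_pos (by linarith), abs_of_pos (by linarith)] at h1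
    linarith

/-- With `2 ^ l ≤ 2 * x`, both `l` and `log (2 ^ l)` are of order `log n`. The constants are `32 * 2
* 6 * 2 * 4 = 3072` and `20 * 2 * 3 = 120`, and the exponent is `13 = 6 + 6 + 1`. -/
theorem error_le {k n l : ℕ} {x : ℝ} (hx : (2 : ℝ) ^ l ≤ 2 * x)
    (hxn : x ≤ n) (hlog : 1 ≤ Real.log n) (hn : 0 < n) :
    32 * (k : ℝ) ^ 3 / n * 2 ^ l * (8 * (Real.log n ^ 6 / 2) + 2) *
        (2 * (Real.log n ^ 6 / 2) + 1) * (l + 1)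
      + 20 * (k / n) * 2 ^ l * (1 + Real.log (2 ^ l))
      ≤ (3072 * (k : ℝ) ^ 3 + 120 * k) * (x / n * Real.log n ^ 13) := by
  have hnR : (0 : ℝ) < n := by exact_mod_cast hn
  have h2 : (0 : ℝ) < 2 ^ l := by positivity
  have hx0 : 0 < x := by linarith
  have h3 : Real.log (2 ^ l) ≤ 1 + Real.log n := by
    calc Real.log ((2 : ℝ) ^ l) ≤ Real.log (2 * n) := Real.log_le_log h2 (by linarith)
      _ = Real.log 2 + Real.log n := Real.log_mul (by norm_num) hnR.ne'
      _ ≤ _ := by linarith [Real.log_two_lt_d9]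
  have h4 : (l : ℝ) + 1 ≤ 4 * Real.log n := by
    have e : Real.log ((2 : ℝ) ^ l) = l * Real.log 2 := by simp [Real.log_pow]
    have h5 : (l : ℝ) * Real.log 2 ≤ Real.log 2 + Real.log n := by
      rw [← e, ← Real.log_mul (by norm_num) hnR.ne']
      exact Real.log_le_log h2 (by linarith)
    have h6 := Real.log_two_gt_d9
    have h7 : (0 : ℝ) ≤ l := Nat.cast_nonneg l
    nlinarith
  have h5 : 1 + Real.log (2 ^ l) ≤ 3 * Real.log n := by linarith
  have h8 : 1 ≤ Real.log n ^ 6 := one_le_pow₀ hlog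
  have h9 : Real.log n ≤ Real.log n ^ 13 := le_self_pow₀ hlog (by norm_num)
  have h10 : 0 ≤ Real.log ((2 : ℝ) ^ l) := Real.log_nonneg (one_le_pow₀ one_le_two)
  have hk : (0 : ℝ) ≤ k := Nat.cast_nonneg k
  calc _ ≤ 32 * (k : ℝ) ^ 3 / n * (2 * x) * (6 * Real.log n ^ 6) *
        (2 * Real.log n ^ 6) * (4 * Real.log n)
      + 20 * (k / n) * (2 * x) * (3 * Real.log n) := by
        gcongr <;> linarith
    _ = 3072 * (k : ℝ) ^ 3 * (x / n * Real.log n ^ 13) + 120 * k * (x / n * Real.log n) := by ring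
    _ ≤ 3072 * (k : ℝ) ^ 3 * (x / n * Real.log n ^ 13) + 120 * k * (x / n * Real.log n ^ 13) := by
        gcongr
    _ = _ := by ring

theorem tendsto_rpow_div_mul_log_pow {χ : ℝ} (hχ : χ < 1) (m : ℕ) :
    Tendsto (fun n : ℕ => (n : ℝ) ^ χ / n * Real.log n ^ m) atTop (𝓝 0) := by
  have h1 := (isLittleO_log_rpow_rpow_atTop (m : ℝ) (sub_pos.2 hχ)).tendsto_div_nhds_zero
  have h2 := h1.comp tendsto_natCast_atTop_atTop
  refine h2.congr' ?_
  filter_upwards [eventually_gt_atTop 0] with n hn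
  have hnR : (0 : ℝ) < n := by exact_mod_cast hn
  simp only [Function.comp]
  rw [Real.rpow_natCast, Real.rpow_sub hnR, Real.rpow_one]
  field_simp

end Asymptotics

end KCycleWalk

theorem proposition3
    (k : ℕ) (hk : 2 ≤ k)
    (χ : ℝ) (hχ0 : 0 < χ) (hχ1 : χ < 1)
    -- `K n = 2 ^ l n` is the dyadic integer closest to `n ^ χ`
    (l : ℕ → ℕ) (hl : ∀ n : ℕ, KCycleWalk.IsClosestDyadic (l n) ((n : ℝ) ^ χ))
    -- for each `n ≥ k`, a random `k`-cycle walk, started from an arbitrary initial permutation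
    (Ω : ℕ → Type*) [∀ n, MeasurableSpace (Ω n)]
    (μ : ∀ n, Measure (Ω n)) [∀ n, IsProbabilityMeasure (μ n)]
    (π : ∀ n, ℝ≥0 → Ω n → Equiv.Perm (Fin n))
    (hπ : ∀ n, k ≤ n → KCycleWalk.IsKCycleWalk k n (π n) (μ n))
    -- `P(τ < n log n) → 0`
    (hτ : Tendsto (fun n : ℕ => μ n {ω | KCycleWalk.overflowTime (l n) (π n) ω <
      ENNReal.ofReal (n * Real.log n)}) atTop (𝓝 0))
    -- `M_j(0) ≤ D log (j + 2)` for `0 ≤ j ≤ log₂ log n`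
    (D : ℝ) (hD : 0 < D)
    (hM : ∀ n : ℕ, k ≤ n → ∀ᵐ ω ∂(μ n), ∀ j : ℕ, (j : ℝ) ≤ Real.logb 2 (Real.log n) →
      (KCycleWalk.stripCount (π n 0 ω) j : ℝ) ≤ D * Real.log (j + 2))
    (t : ℕ → ℝ≥0)
    (ht : Tendsto (fun n : ℕ => (t n : ℝ) / n) atTop atTop)
    (ht' : ∀ n : ℕ, (t n : ℝ) ≤ n * Real.log n) :
    Tendsto (fun n : ℕ => KCycleWalk.tvDist
        (KCycleWalk.smallCycleLaw (μ n) (2 ^ l n) (π n (t n)))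
        (KCycleWalk.poissonVectorLaw (2 ^ l n)))
      atTop (𝓝 0) := by
  set P : ℕ → ℝ := fun n => (μ n).real {ω | KCycleWalk.overflowTime (l n) (π n) ω <
      ENNReal.ofReal (n * Real.log n)} with hP
  have hP0 : Tendsto P atTop (𝓝 0) := by
    have := (ENNReal.tendsto_toReal ENNReal.zero_ne_top).comp hτ
    rwa [ENNReal.toReal_zero] at this
  have hu7 : Tendsto (fun n : ℕ => 20160 * (D + 2) / ((t n : ℝ) / n) ^ 7) atTop (𝓝 0) :=
    Tendsto.const_div_atTop ((tendsto_pow_atTop (by norm_num)).comp ht) _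
  have herr := (KCycleWalk.tendsto_rpow_div_mul_log_pow hχ1 13).const_mul
    (3072 * (k : ℝ) ^ 3 + 120 * k)
  have hbound := (((hP0.const_mul 4).add hu7).add herr).const_mul (1 / 2 : ℝ)
  simp only [mul_zero, add_zero] at hbound
  refine tendsto_of_tendsto_of_tendsto_of_le_of_le' tendsto_const_nhds hbound
    (Eventually.of_forall fun n => KCycleWalk.tvDist_nonneg _ _) ?_
  -- This gives `k * 2 ^ l n ≤ 2 * k * n ^ χ ≤ n`, so the death probabilities `k * a / n` are at
  -- most `1` for all sizes `a ≤ 2 ^ l n`.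
  have hlarge : ∀ᶠ n : ℕ in atTop, 2 * (k : ℝ) ≤ (n : ℝ) ^ (1 - χ) :=
    ((tendsto_rpow_atTop (sub_pos.2 hχ1)).comp tendsto_natCast_atTop_atTop).eventually_ge_atTop _
  filter_upwards [eventually_ge_atTop (2 * k), hlarge, ht.eventually_gt_atTop 0,
    (Real.tendsto_log_atTop.comp tendsto_natCast_atTop_atTop).eventually_ge_atTop 1]
    with n hn hnk htn hlog
  have hn0 : 0 < n := by omega
  have hnR : (0 : ℝ) < n := by exact_mod_cast hn0
  have hn1 : (1 : ℝ) ≤ n := by exact_mod_cast hn0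
  have hx1 : 1 ≤ (n : ℝ) ^ χ := Real.one_le_rpow hn1 hχ0.le
  have hxn : (n : ℝ) ^ χ ≤ n := by
    simpa using Real.rpow_le_rpow_of_exponent_le hn1 hχ1.le
  have hK := (hl n).two_pow_le hx1
  have hkK : k * 2 ^ l n ≤ n := by
    have h : (k : ℝ) * 2 ^ l n ≤ n := by
      calc (k : ℝ) * 2 ^ l n ≤ k * (2 * (n : ℝ) ^ χ) := by gcongr
        _ = (2 * k) * (n : ℝ) ^ χ := by ring
        _ ≤ (n : ℝ) ^ (1 - χ) * (n : ℝ) ^ χ := by gcongr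
        _ = n := by rw [← Real.rpow_add hnR, sub_add_cancel, Real.rpow_one]
    exact_mod_cast h
  have ht0 : 0 < t n := by
    rw [pos_iff_ne_zero]
    intro h
    simp [h] at htn
  refine (KCycleWalk.tvDist_smallCycleLaw_le (hπ n (by omega)) hk hn hkK hD.le (hM n (by omega))
    ht0 (ht' n)).trans ?_
  have := KCycleWalk.error_le (k := k) hK hxn hlog hn0
  simp only [hP]
  linarith
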